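/- **Setting.** Fix integers $d\ge 0$, $\tau\ge1$, a period $T>0$ and a multiplicity $M\le\infty$. Put $w(\lambda)=(1-e^{-i\lambda\tau})^d/(i\lambda)^d$, so that $|w(\lambda)|^2=|1-e^{i\lambda\tau}|^{2d}/\lambda^{2d}$. Let $\xi(t),\eta(t)$, $t\in\mathbb R$, be processes in $L_2(\Omega,\mathcal F,\mathbb P)$ whose $d$-th increments $\xi^{(d)}(t,\sigma T)=\sum_{l=0}^d(-1)^l\binom dl\xi(t-l\sigma T)$, $\eta^{(d)}(t,\sigma T)$, $\sigma\in\mathbb Z$, have zero mean, are locally square integrable in $t$, are periodically stationary (covariances invariant under $t\mapsto t+T$), and are mutually uncorrelated. With $e_k(u)=T^{-1/2}e^{2\pi i\nu_k u/T}$, $\nu_k=(-1)^k[k/2]$, $k\ge1$, let $\xi^{(d)}_{kj}=\int_0^T\xi^{(d)}(jT-u,\tau T)\overline{e_k(u)}\,du$ be the generated vector increment sequence. It has spectral density $f=(f_{kn})_{k,n\ge1}$ if $\mathsf E\,\xi^{(d)}_{kl}\overline{\xi^{(d)}_{nj}}=\frac1{2\pi}\int_{-\pi}^{\pi}e^{i(l-j)\lambda}|w(\lambda)|^2f_{kn}(\lambda)\,d\lambda$.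 Spectral densities are measurable, a.e. positive trace-class matrix functions with $\int|w|^2\operatorname{Tr} f\,d\lambda<\infty$. The noise sequence $\eta^{(d)}_{kj}$ has a known spectral density $g$. The functional $A\xi=\int_0^\infty a(t)\xi(-t)\,dt$ is understood as $\int_0^\infty b^\tau(t)\,\xi^{(d)}(-t,\tau T)\,dt$, where $a$ is locally square integrable on $[0,\infty)$, $b^\tau(t)=\sum_{0\le l\le t/(\tau T)}a(t-\tau Tl)\,d(l)$, $\sum_l d(l)x^l=(\sum_jx^j)^d$. Put $\vec b_j=(b_{kj})_{k\ge1}$, $b_{kj}=\int_0^Tb^\tau(u+jT)e_k(u)\,du$, and suppose $\sum_j(j+1)\|\vec b_j\|<\infty$; let $B(\lambda)=\sum_{j\ge0}\vec b_je^{-i\lambda j}$. The functional is estimated from $\xi(t)+\eta(t)$, $t\le0$, i.e. by elements of the closed span of $\xi^{(d)}_{kj}+\eta^{(d)}_{kj}$, $j\le 0$. Let $L_2^0(f+g)$ be the set of $\ell_2$-valued functions that are limits, in the norm $(\frac1{2\pi}\int h^\top(f+g)\bar h\,d\lambda)^{1/2}$, of finite linear combinations of $e^{i\lambda j}w(\lambda)\vec\delta_k$,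 $j\le0$, and for $h\in L_2^0(f+g)$ let $$\Delta(h;f,g)=\frac1{2\pi}\int_{-\pi}^{\pi}(wB-h)^\top f\,\overline{(wB-h)}\,d\lambda+\frac1{2\pi}\int_{-\pi}^{\pi}h^\top g\,\bar h\,d\lambda,\qquad \Delta(f,g)=\inf_{h\in L_2^0(f+g)}\Delta(h;f,g).$$ **Factorizations.** A canonical factorization of a density $S$ is $S=\Theta\Theta^*$ a.e. with an $\infty\times M$ function $\Theta=\sum_{k\ge0}\theta(k)e^{-i\lambda k}$ with square-summable coefficients such that each constant vector $\vec\delta_i\in\ell_2(\{1,\dots,M\})$ is an $L_2$-limit of functions $\Theta^\top p$ with $p$ a finitely supported vector polynomial in $e^{-i\lambda}$ (the innovations lie in the past and present of the sequence). Suppose $|w|^2g=\Omega_\tau\Omega_\tau^*$, $\Omega_\tau=\sum_{k\ge0}\omega_\tau(k)e^{-i\lambda k}$, is such a factorization and $|w|^2g\,\overline B$ is square integrable (which holds if the block Toeplitz operator $\widetilde\Omega_\tau$, $(\widetilde\Omega_\tau)_{l,j}=\omega_\tau^\top(l-j)$, $0\le j\le l$, is bounded in $\ell_2$). Put $\vec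 c^{\,g}(m)=\sum_{l\ge0}\overline{\omega_\tau(l)}\sum_{j=0}^{l+m}\omega_\tau^\top(l+m-j)\vec b_j$. A pair $(\Theta_\tau,\Psi_\tau)$ *factorizes* $f+g$ if $|w|^2(f+g)=\Theta_\tau\Theta_\tau^*$ is a canonical factorization and $\Psi_\tau=\sum_{k\ge0}\psi_\tau(k)e^{-i\lambda k}$ is an $M\times\infty$ function with square-summable rows and $\Psi_\tau\Theta_\tau=E_M$; put $(\overline\psi_\tau\mathbf C^g_\tau)_m=\sum_{k\ge0}\overline{\psi_\tau(k)}\,\vec c^{\,g}(k+m)$. **Classes.** $\mathcal D_0^k$ is the set of spectral densities $f$ for which $f+g$ is factorized by some pair, and, respectively: $k=1$: $\frac1{2\pi}\int f\,d\lambda=P$; $k=2$: $\frac1{2\pi}\int\operatorname{Tr}f\,d\lambda=p$; $k=3$: $\frac1{2\pi}\int f_{nn}\,d\lambda=p_n$ for all $n$; $k=4$: $\frac1{2\pi}\int\operatorname{Tr}(B_1f)\,d\lambda=p$. Here $p,p_n$ are given numbers, $P$ is a positive-definite trace-class matrix, $B_1$ a positive-definite Hermitian matrix bounded in $\ell_2$.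 **Theorem.** Let $f^0$ belong to $\mathcal D_0^k$ for one of $k=1,2,3,4$, and let $(\Theta_\tau,\Psi_\tau)$ factorize $f^0+g$. Let the minimality condition $\int_{-\pi}^{\pi}|w|^{-2}(f^0+g)^{-1}d\lambda<\infty$ hold entrywise, where $|w|^{-2}(f^0+g)^{-1}=\Psi_\tau^*\Psi_\tau$ (if $M=\infty$, also $\Theta_\tau\Psi_\tau=E_\infty$ a.e., so that this is the two-sided inverse; if $M<\infty$, it is a generalized inverse of $f^0+g$, which has rank $M$). Let $\Theta_\tau=w_\tau\Theta^0$ with $w_\tau=\sum_{k\ge0}w_\tau(k)e^{-i\lambda k}$, $|w_\tau|^2=|w|^2$, and $\mathbf c(\lambda)=\sum_{m\ge0}(\overline\psi_\tau\mathbf C^g_\tau)_me^{-i\lambda m}$. Suppose that for a.e. $\lambda$ $$\mathbf c(\lambda)\,\mathbf c(\lambda)^*=\Theta^0(\lambda)^\top K\,\overline{\Theta^0(\lambda)},$$ where $K=\vec\alpha\vec\alpha^*$ with $\vec\alpha\in\ell_2$ if $k=1$, $K=\alpha^2E$ with $\alpha\in\mathbb R$ if $k=2$, $K=\operatorname{diag}(\alpha_n^2)$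 with bounded real $\alpha_n$ if $k=3$, $K=\alpha^2B_1^\top$ with $\alpha\in\mathbb R$ if $k=4$. Suppose also that $f^0+g$ solves the problem $\sum_m\|(\overline\psi_\tau\mathbf C^g_\tau)_m\|^2\to\inf$ over all $f\in\mathcal D_0^k$ and all pairs $(\Theta_\tau,\Psi_\tau)$ factorizing $f+g$. Then: 1. $f^0$ is least favourable in $\mathcal D_0^k$: $\Delta(f^0,g)=\max_{f\in\mathcal D_0^k}\Delta(f,g)$. 2. The function $$\vec h_\tau(f^0,g)=\frac{(1-e^{-i\lambda\tau})^d}{(i\lambda)^d}\Big(B(\lambda)-\Big(\sum_{k\ge0}\psi_\tau^\top(k)e^{-i\lambda k}\Big)\sum_{m\ge0}(\overline\psi_\tau\mathbf C_\tau^g)_me^{-i\lambda m}\Big)$$ belongs to $L_2^0(f^0+g)$ and $\Delta(\vec h_\tau(f^0,g);f^0,g)=\Delta(f^0,g)$. 3. If $\vec h_\tau(f^0,g)\in H_{\mathcal D}=\bigcap_{f\in\mathcal D_0^k}L_2^0(f+g)$, it is minimax: $\min_{h\in H_{\mathcal D}}\sup_{f\in\mathcal D_0^k}\Delta(h;f,g)=\sup_{f\in\mathcal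 D_0^k}\Delta(\vec h_\tau(f^0,g);f,g)$. 4. For every $f\in\mathcal D_0^k$ and all processes $\xi,\eta$ as above with spectral densities $f,g$, the least mean-square error of linear estimates of $A\xi$ equals $\Delta(f,g)$; and for $f=f^0$ the optimal estimate (the orthogonal projection of $A\xi$ on the closed span of the observations) has the spectral characteristic $\vec h_\tau(f^0,g)$, i.e. it is the mean-square limit of finite combinations of observations whose spectral images converge to $\vec h_\tau(f^0,g)$ in $L_2(f^0+g)$. -/

import Mathlib

open MeasureTheory Filter Topology
open scoped ENNReal NNReal ComplexOrder ComplexConjugate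

universe u

noncomputable section

namespace PCFilter

/-! ### Continuous-time processes and their generated vector increment sequences -/

section Processes

variable {H : Type*} [NormedAddCommGroup H] [InnerProductSpace ℂ H]

/-- The `d`-th increment `(1 - B_s)^d ξ(t) = ∑ (-1)^l C(d,l) ξ(t - l s)` with step `s`. -/
def incr (d : ℕ) (s : ℝ) (ξ : ℝ → H) (t : ℝ) : H :=
  ∑ l ∈ Finset.range (d + 1), ((-1 : ℂ) ^ l * (d.choose l : ℂ)) • ξ (t - l * s)

/-- The integer frequency of the `k`-th harmonic (`k = 0, 1, 2, …`), i.e. `(-1)^m [m/2]` with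
`m = k + 1`: the enumeration `0, 1, -1, 2, -2, …` of the integers. -/
def freq (k : ℕ) : ℤ := (-1) ^ (k + 1) * (((k + 1) / 2 : ℕ) : ℤ)

/-- The `k`-th component of the `j`-th element of the vector increment sequence generated by `ξ`
(step `τ T`): the Fourier coefficient with respect to the orthonormal basis
`e_k(u) = T^{-1/2} exp(2 π i freq(k) u / T)` of `[0,T)` of the block `u ↦ ξ^{(d)}(j T - u, τ T)`.
The blocks with `j ≤ 0` fill up exactly the times `t ≤ 0`. -/
def gen (d τ : ℕ) (T : ℝ) (ξ : ℝ → H) (k : ℕ) (j : ℤ) : H :=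
  ((1 / Real.sqrt T : ℝ) : ℂ) • ∫ v in (0 : ℝ)..T,
    Complex.exp (-(2 * Real.pi * Complex.I * (freq k : ℂ) * (v : ℂ) / (T : ℂ))) •
      incr d (τ * T) ξ (j * T - v)

/-- `H^0(ξ + η)`: the closed linear span of the components of the generated sequence of the
observed process with indices `j ≤ 0`. -/
def obsSpace (d τ : ℕ) (T : ℝ) (ξ η : ℝ → H) : Submodule ℂ H :=
  (Submodule.span ℂ {x | ∃ (k : ℕ) (j : ℤ), j ≤ 0 ∧
    x = gen d τ T ξ k j + gen d τ T η k j}).topologicalClosure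

/-- The increments (of all integer multiples of `T` as steps) of `ξ` and `η` are uncorrelated. -/
def Uncorrelated (d : ℕ) (T : ℝ) (ξ η : ℝ → H) : Prop :=
  ∀ (σ₁ σ₂ : ℤ) (t s : ℝ), inner ℂ (incr d (σ₁ * T) η t) (incr d (σ₂ * T) ξ s) = 0

end Processes

/-- A process in `L²(P)` whose `d`-th increments have zero mean, are (as functions of time)
measurable and locally square integrable, and are periodically stationary with period `T`: `E ξ^{(d)}(t+T,σ₁T) conj ξ^{(d)}(s+T,σ₂T) = E ξ^{(d)}(t,σ₁T) conj ξ^{(d)}(s,σ₂T)`. -/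
structure IsPeriodicIncr {Ω : Type*} [MeasurableSpace Ω] (P : Measure Ω) (d : ℕ) (T : ℝ)
    (ξ : ℝ → Lp ℂ 2 P) : Prop where
  locL2 : ∀ (σ : ℤ) (R : ℝ),
    MemLp (incr d (σ * T) ξ) 2 (volume.restrict (Set.Icc (-R) R))
  mean : ∀ (σ : ℤ) (t : ℝ), ∫ ω, (incr d (σ * T) ξ t) ω ∂P = 0
  cov : ∀ (σ₁ σ₂ : ℤ) (t s : ℝ),
    inner ℂ (incr d (σ₂ * T) ξ (s + T)) (incr d (σ₁ * T) ξ (t + T)) =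
      inner ℂ (incr d (σ₂ * T) ξ s) (incr d (σ₁ * T) ξ t)

/-! ### The functional -/

/-- `d(l)`, the coefficients of `(∑ x^j)^d`. -/
def dcoef (d l : ℕ) : ℂ := PowerSeries.coeff l ((PowerSeries.mk fun _ : ℕ => (1 : ℂ)) ^ d)

/-- `b^τ(t) = ∑_{l ≤ t/(τT)} a(t - τ T l) d(l)`. -/
def bfun (d τ : ℕ) (T : ℝ) (a : ℝ → ℂ) (t : ℝ) : ℂ :=
  ∑ l ∈ Finset.range (⌊t / (τ * T)⌋₊ + 1), a (t - τ * T * l) * dcoef d l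

/-- The `k`-th component of the vector `b^τ_j`.  It multiplies the `k`-th component of the
increment sequence, so it is the Fourier coefficient of the block `b^τ(· + jT)` at `-freq k`. -/
def bvec (d τ : ℕ) (T : ℝ) (a : ℝ → ℂ) (j k : ℕ) : ℂ :=
  ((1 / Real.sqrt T : ℝ) : ℂ) * ∫ v in (0 : ℝ)..T,
    bfun d τ T a (v + j * T) *
      Complex.exp (2 * Real.pi * Complex.I * (freq k : ℂ) * (v : ℂ) / (T : ℂ))

/-- `‖b^τ_j‖`. -/
def bnorm (d τ : ℕ) (T : ℝ) (a : ℝ → ℂ) (j : ℕ) : ℝ :=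
  Real.sqrt (∑' k, ‖bvec d τ T a j k‖ ^ 2)

/-- The standing conditions on the weight function `a`: it is locally square integrable on
`[0,∞)`, and `∑ ‖b_j‖ < ∞`, `∑ (j+1) ‖b_j‖ < ∞`. -/
structure WeightCondition (d τ : ℕ) (T : ℝ) (a : ℝ → ℂ) : Prop where
  locL2 : ∀ R : ℝ, MemLp a 2 (volume.restrict (Set.Icc 0 R))
  summ : Summable fun j => bnorm d τ T a j
  summ' : Summable fun j : ℕ => ((j : ℝ) + 1) * bnorm d τ T a j

/-- The functional `Aξ = ∫_0^∞ a(t) ξ(-t) dt`, expressed through the increments of the process: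
`∫_0^∞ b^τ(t) ξ^{(d)}(-t, τT) dt` (a Bochner integral in `L²(P)`). -/
def functionalA {H : Type*} [NormedAddCommGroup H] [InnerProductSpace ℂ H]
    (d τ : ℕ) (T : ℝ) (a : ℝ → ℂ) (ξ : ℝ → H) : H :=
  ∫ t in Set.Ioi (0 : ℝ), bfun d τ T a t • incr d (τ * T) ξ (-t)

/-! ### Spectral densities -/

/-- Lebesgue measure on the frequency interval. -/
def freqMeasure : Measure ℝ := volume.restrict (Set.Ioc (-Real.pi) Real.pi)

/-- `(1 - e^{-iλτ})^d / (iλ)^d`; its squared modulus is `|1 - e^{iλτ}|^{2d} / λ^{2d}`. -/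
def wfun (d τ : ℕ) (l : ℝ) : ℂ :=
  (1 - Complex.exp (-(Complex.I * l * τ))) ^ d / (Complex.I * l) ^ d

/-- `|1 - e^{iλτ}|^{2d} / λ^{2d}`. -/
def wsq (d τ : ℕ) (l : ℝ) : ℝ :=
  ‖(1 : ℂ) - Complex.exp (Complex.I * l * τ)‖ ^ (2 * d) / l ^ (2 * d)

/-- Spectral densities: a.e. positive trace-class matrix functions `f` on `ℓ²` such that
`|1 - e^{iλτ}|^{2d} λ^{-2d} f(λ)` has integrable trace. -/
structure IsSpectralDensity (d τ : ℕ) (f : ℝ → Matrix ℕ ℕ ℂ) : Prop where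
  meas : ∀ k n, AEMeasurable (fun l => f l k n) freqMeasure
  pos : ∀ᵐ l ∂freqMeasure, (f l).PosSemidef
  kernel : ∀ᵐ l ∂freqMeasure, Summable fun k => (f l k k).re
  integrable : Integrable (fun l => wsq d τ l * ∑' k, (f l k k).re) freqMeasure

/-- `f` is the spectral density of the increment sequence generated by `ξ`:
`E ξ_{k,l} conj ξ_{n,j} = (2π)^{-1} ∫ e^{i(l-j)λ} |1-e^{iλτ}|^{2d} λ^{-2d} f_{kn}(λ) dλ`. -/
def HasSpectralDensity {H : Type*} [NormedAddCommGroup H] [InnerProductSpace ℂ H]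
    (d τ : ℕ) (T : ℝ) (ξ : ℝ → H) (f : ℝ → Matrix ℕ ℕ ℂ) : Prop :=
  ∀ (k n : ℕ) (l j : ℤ), inner ℂ (gen d τ T ξ n j) (gen d τ T ξ k l) =
    ((1 / (2 * Real.pi) : ℝ) : ℂ) * ∫ x, Complex.exp (Complex.I * ((l : ℂ) - j) * x) *
      (wsq d τ x : ℂ) * f x k n ∂freqMeasure

/-- The quadratic form `hᵀ F h̄`. -/
def quad (F : Matrix ℕ ℕ ℂ) (h : ℕ → ℂ) : ℝ :=
  (∑' p : ℕ × ℕ, h p.1 * F p.1 p.2 * conj (h p.2)).re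

/-- `(2π)^{-1} ∫ h(λ)ᵀ F(λ) conj h(λ) dλ`, with values in `[0,∞]`. -/
def normSq (F : ℝ → Matrix ℕ ℕ ℂ) (h : ℝ → ℕ → ℂ) : ℝ≥0∞ :=
  ENNReal.ofReal (1 / (2 * Real.pi)) * ∫⁻ l, ENNReal.ofReal (quad (F l) (h l)) ∂freqMeasure

/-- Finite linear combinations of the functions `e^{iλj} (1-e^{-iλτ})^d (iλ)^{-d} δ_k`, `j ≤ 0`;
the index `(k, m)` stands for `j = -m`. -/
def poly (d τ : ℕ) (q : (ℕ × ℕ) →₀ ℂ) (l : ℝ) (k : ℕ) : ℂ :=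
  q.sum fun p z => if p.1 = k then z * Complex.exp (-(Complex.I * l * p.2)) * wfun d τ l else 0

/-- The space `L_2^0(F)` of (`ℓ²`-valued) spectral characteristics. -/
def L20 (d τ : ℕ) (F : ℝ → Matrix ℕ ℕ ℂ) : Set (ℝ → ℕ → ℂ) :=
  {h | (∀ k, AEMeasurable (fun l => h l k) freqMeasure) ∧
    (∀ᵐ l ∂freqMeasure, Summable fun k => ‖h l k‖ ^ 2) ∧
    ∀ ε : ℝ≥0∞, 0 < ε → ∃ q : (ℕ × ℕ) →₀ ℂ,
      normSq F (fun l k => h l k - poly d τ q l k) < ε}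

/-- `B_τ(e^{-iλ}) = ∑_j b^τ_j e^{-iλj}`. -/
def Bfun (d τ : ℕ) (T : ℝ) (a : ℝ → ℂ) (l : ℝ) (k : ℕ) : ℂ :=
  ∑' j : ℕ, bvec d τ T a j k * Complex.exp (-(Complex.I * l * j))

/-- `Δ(h; f, g)`: the mean-square error, in the spectral domain, of the estimate of `Aξ` with
spectral characteristic `h` when the signal and the noise have spectral densities `f` and `g`. -/
def mse (d τ : ℕ) (T : ℝ) (a : ℝ → ℂ) (h : ℝ → ℕ → ℂ) (f g : ℝ → Matrix ℕ ℕ ℂ) : ℝ≥0∞ :=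
  normSq f (fun l k => wfun d τ l * Bfun d τ T a l k - h l k) + normSq g h

/-- `Δ(f, g)`: the mean-square error of the optimal linear estimate. -/
def optMse (d τ : ℕ) (T : ℝ) (a : ℝ → ℂ) (f g : ℝ → Matrix ℕ ℕ ℂ) : ℝ≥0∞ :=
  ⨅ h ∈ L20 d τ (fun l => f l + g l), mse d τ T a h f g

/-- The element `x` of `H^0(ξ + η)` has the spectral characteristic `h`, that is
`x = ∫ h(λ)ᵀ dZ_{ξ+η}(λ)`: it is the limit of finite combinations of the observed increments whose
spectral images converge to `h` in `L_2(f + g)`. -/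
def HasSpectralCharacteristic {H : Type*} [NormedAddCommGroup H] [InnerProductSpace ℂ H]
    (d τ : ℕ) (T : ℝ) (ξ η : ℝ → H) (F : ℝ → Matrix ℕ ℕ ℂ) (x : H) (h : ℝ → ℕ → ℂ) : Prop :=
  h ∈ L20 d τ F ∧ ∃ q : ℕ → (ℕ × ℕ) →₀ ℂ,
    Tendsto (fun N => (q N).sum fun p z =>
      z • (gen d τ T ξ p.1 (-(p.2 : ℤ)) + gen d τ T η p.1 (-(p.2 : ℤ)))) atTop (𝓝 x) ∧
    Tendsto (fun N => normSq F (fun l k => h l k - poly d τ (q N) l k)) atTop (𝓝 0)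

/-! ### Canonical factorizations -/

/-- The index set `{1, …, M}` (`M ≤ ∞`) of the innovation sequence. -/
abbrev Idx (M : ℕ∞) : Type := {m : ℕ // (m : ℕ∞) < M}

/-- The coefficient of `e^{-iλk}` in the Fourier series of `F` on `(-π, π]`. -/
def coef (F : ℝ → ℂ) (k : ℤ) : ℂ :=
  ((1 / (2 * Real.pi) : ℝ) : ℂ) * ∫ l, F l * Complex.exp (Complex.I * l * k) ∂freqMeasure

/-- `F(λ) = ∑_{k ≥ 0} φ(k) e^{-iλk}` with convergence in `L²(-π, π]`. -/
def IsH2 (F : ℝ → ℂ) : Prop :=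
  MemLp F 2 freqMeasure ∧ ∀ k : ℤ, k < 0 → coef F k = 0

/-- The canonical factorization `S = Θ Θ^*`, `Θ(e^{-iλ}) = ∑_{k ≥ 0} θ(k) e^{-iλk}`, with an
`∞ × M` matrix function `Θ` and square-summable coefficients.  Canonicity is the identity of the
pasts of the sequence with spectral density `S` and of its innovation sequence: every innovation
`ε_i(0)` is a limit of finite linear combinations of the present and past of the sequence. -/
structure IsCanonicalFactor {M : ℕ∞} (S : ℝ → Matrix ℕ ℕ ℂ) (Θ : ℝ → Matrix ℕ (Idx M) ℂ) :
    Prop where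
  analytic : ∀ n i, IsH2 fun l => Θ l n i
  sq : ∫⁻ l, ∑' n, ∑' i, ‖Θ l n i‖ₑ ^ 2 ∂freqMeasure < ∞
  factor : ∀ᵐ l ∂freqMeasure, ∀ n m, S l n m = ∑' i, Θ l n i * conj (Θ l m i)
  innovation : ∀ (i₀ : Idx M) (ε : ℝ≥0∞), 0 < ε → ∃ q : (ℕ × ℕ) →₀ ℂ,
    ∫⁻ l, ∑' i, ‖(q.sum fun p z => z * Complex.exp (-(Complex.I * l * p.2)) * Θ l p.1 i) -
      (if i = i₀ then 1 else 0)‖ₑ ^ 2 ∂freqMeasure < ε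

/-- `S = Θ Θ^*` is a canonical factorization and `Ψ(e^{-iλ}) = ∑_{k ≥ 0} ψ(k) e^{-iλk}` is an
`M × ∞` matrix function with square-summable rows and `Ψ Θ = E_M`. -/
structure IsFactorPair {M : ℕ∞} (S : ℝ → Matrix ℕ ℕ ℂ) (Θ : ℝ → Matrix ℕ (Idx M) ℂ)
    (Ψ : ℝ → Matrix (Idx M) ℕ ℂ) : Prop where
  canonical : IsCanonicalFactor S Θ
  analytic : ∀ i n, IsH2 fun l => Ψ l i n
  rows : ∀ i, ∫⁻ l, ∑' n, ‖Ψ l i n‖ₑ ^ 2 ∂freqMeasure < ∞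
  leftInv : ∀ᵐ l ∂freqMeasure, ∀ i j, ∑' n, Ψ l i n * Θ l n j = if i = j then 1 else 0

/-- `|1 - e^{iλτ}|^{2d} λ^{-2d} F(λ)`. -/
def weighted (d τ : ℕ) (F : ℝ → Matrix ℕ ℕ ℂ) (l : ℝ) : Matrix ℕ ℕ ℂ :=
  (wsq d τ l : ℂ) • F l

/-- The minimality condition `∫ λ^{2d} |1 - e^{iλτ}|^{-2d} F(λ)^{-1} dλ < ∞` for
`F = |1 - e^{iλτ}|^{-2d} λ^{2d} Θ Θ^*`, where `λ^{2d} |1 - e^{iλτ}|^{-2d} F^{-1} = Ψ^* Ψ`: the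
(diagonal) entries of this matrix function are integrable.  For `M = ∞` the matrix `Ψ^* Ψ` is
required to be the two-sided inverse of `Θ Θ^*`, i.e. `Θ Ψ = E_∞`; for `M < ∞` the density has rank
`M` and `Ψ^* Ψ` is its (reflexive generalized) inverse, by `Ψ Θ = E_M`. -/
structure MinimalityCondition {M : ℕ∞} (Θ : ℝ → Matrix ℕ (Idx M) ℂ)
    (Ψ : ℝ → Matrix (Idx M) ℕ ℂ) : Prop where
  integrable : ∀ n, ∫⁻ l, ∑' i, ‖Ψ l i n‖ₑ ^ 2 ∂freqMeasure < ∞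
  inverse : M = ⊤ → ∀ᵐ l ∂freqMeasure, ∀ n m, ∑' i, Θ l n i * Ψ l i m = if n = m then 1 else 0

/-! ### The vector `ψ̄_τ C^g_τ` -/

section Coefficients

variable {M : ℕ∞}

/-- `(Ω̃_τ D^τ a)_l = ∑_{j ≤ l} ω_τ(l-j)ᵀ b^τ_j`. -/
def omegaB (d τ : ℕ) (T : ℝ) (a : ℝ → ℂ) (Om : ℝ → Matrix ℕ (Idx M) ℂ) (l : ℕ) (i : Idx M) : ℂ :=
  ∑ j ∈ Finset.range (l + 1), ∑' n, coef (fun x => Om x n i) ((l - j : ℕ) : ℤ) * bvec d τ T a j n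

/-- `c^g_τ(m) = ∑_l conj ω_τ(l) (Ω̃_τ D^τ a)_{l+m}`. -/
def cg (d τ : ℕ) (T : ℝ) (a : ℝ → ℂ) (Om : ℝ → Matrix ℕ (Idx M) ℂ) (m n : ℕ) : ℂ :=
  ∑' l : ℕ, ∑' i, conj (coef (fun x => Om x n i) (l : ℤ)) * omegaB d τ T a Om (l + m) i

/-- `(ψ̄_τ C^g_τ)_m = ∑_k conj ψ_τ(k) c^g_τ(k+m)`. -/
def psiC (d τ : ℕ) (T : ℝ) (a : ℝ → ℂ) (Om : ℝ → Matrix ℕ (Idx M) ℂ)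
    (Ψ : ℝ → Matrix (Idx M) ℕ ℂ) (m : ℕ) (i : Idx M) : ℂ :=
  ∑' k : ℕ, ∑' n, conj (coef (fun x => Ψ x i n) (k : ℤ)) * cg d τ T a Om (k + m) n

/-- `⟨ψ̄_τ C^g_τ, ψ̄_τ C^g_τ⟩`. -/
def psiCNormSq (d τ : ℕ) (T : ℝ) (a : ℝ → ℂ) (Om : ℝ → Matrix ℕ (Idx M) ℂ)
    (Ψ : ℝ → Matrix (Idx M) ℕ ℂ) : ℝ≥0∞ :=
  ∑' m : ℕ, ∑' i, ‖psiC d τ T a Om Ψ m i‖ₑ ^ 2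

/-- `|1 - e^{iλτ}|^{2d} λ^{-2d} g(λ) conj B_τ(e^{-iλ})` is square integrable.  (This is implied by
the boundedness in `ℓ²` of the operator `Ω̃_τ`.) -/
def NoiseRegular (d τ : ℕ) (T : ℝ) (a : ℝ → ℂ) (g : ℝ → Matrix ℕ ℕ ℂ) : Prop :=
  ∫⁻ l, ∑' n, ‖(wsq d τ l : ℂ) * ∑' m, g l n m * conj (Bfun d τ T a l m)‖ₑ ^ 2 ∂freqMeasure < ∞

/-- The formula for the spectral characteristic:
`(1-e^{-iλτ})^d (iλ)^{-d} (B_τ(e^{-iλ}) - (∑ ψ_τ(k)ᵀ e^{-iλk}) c(λ))`, where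
`c(λ) = ∑_m (ψ̄_τ C^g_τ)_m e^{-iλm}`. -/
def charFormula (d τ : ℕ) (T : ℝ) (a : ℝ → ℂ) (Ψ : ℝ → Matrix (Idx M) ℕ ℂ)
    (c : ℝ → Idx M → ℂ) (l : ℝ) (n : ℕ) : ℂ :=
  wfun d τ l * (Bfun d τ T a l n - ∑' i, Ψ l i n * c l i)

end Coefficients

/-! ### The classes `D_0^k` -/

/-- The data of the four classes `D_0^1, …, D_0^4`. -/
inductive D0Data where
  | moment (P : Matrix ℕ ℕ ℂ)
  | trace (p : ℝ)
  | diagonal (p : ℕ → ℝ)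
  | scalar (B : Matrix ℕ ℕ ℂ) (p : ℝ)

/-- `P` is a positive-definite Hermitian kernel (trace-class) matrix; `B_1` is a positive-definite
Hermitian matrix of a bounded operator. -/
def D0Data.Valid : D0Data → Prop
  | .moment P => P.PosDef ∧ Summable fun k => (P k k).re
  | .trace _ => True
  | .diagonal _ => True
  | .scalar B _ => B.PosDef ∧ ∃ C : ℝ, ∀ x : ℕ →₀ ℂ,
      (x.sum fun i xi => x.sum fun j xj => star xi * B i j * xj).re ≤ C * x.sum fun _ xi => ‖xi‖ ^ 2

/-- The constraint defining the class; `⟨B_1, f⟩ = Tr (B_1 f)`. -/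
def D0Data.Constraint : D0Data → (ℝ → Matrix ℕ ℕ ℂ) → Prop
  | .moment P, f => ∀ k n, Integrable (fun l => f l k n) freqMeasure ∧
      ((1 / (2 * Real.pi) : ℝ) : ℂ) * ∫ l, f l k n ∂freqMeasure = P k n
  | .trace p, f => Integrable (fun l => ∑' k, (f l k k).re) freqMeasure ∧
      1 / (2 * Real.pi) * ∫ l, ∑' k, (f l k k).re ∂freqMeasure = p
  | .diagonal p, f => ∀ k, Integrable (fun l => (f l k k).re) freqMeasure ∧
      1 / (2 * Real.pi) * ∫ l, (f l k k).re ∂freqMeasure = p k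
  | .scalar B p, f => Integrable (fun l => (∑' k, ∑' n, B k n * f l n k).re) freqMeasure ∧
      1 / (2 * Real.pi) * ∫ l, (∑' k, ∑' n, B k n * f l n k).re ∂freqMeasure = p

/-- The matrices built from the Lagrange multipliers: `α α^*`, `α² E`, `diag(α_k²)`, `α² B_1ᵀ`. -/
def D0Data.IsMultiplier : D0Data → Matrix ℕ ℕ ℂ → Prop
  | .moment _, K => ∃ α : ℕ → ℂ, (Summable fun k => ‖α k‖ ^ 2) ∧
      K = Matrix.of fun k n => α k * conj (α n)
  | .trace _, K => ∃ α : ℝ, K = ((α ^ 2 : ℝ) : ℂ) • (1 : Matrix ℕ ℕ ℂ)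
  | .diagonal _, K => ∃ α : ℕ → ℝ, (∃ C, ∀ k, |α k| ≤ C) ∧
      K = Matrix.diagonal fun k => ((α k ^ 2 : ℝ) : ℂ)
  | .scalar B _, K => ∃ α : ℝ, K = ((α ^ 2 : ℝ) : ℂ) • B.transpose

/-- The class `D_0^k` of admissible densities for the known noise density `g`: the spectral
densities `f` that satisfy the constraint of the class and for which `f + g` has a canonical
factorization `|1 - e^{iλτ}|^{2d} λ^{-2d} (f + g) = Θ Θ^*`, `Ψ Θ = E_M`. -/
def D0Data.admissible (D : D0Data) (M : ℕ∞) (d τ : ℕ) (g : ℝ → Matrix ℕ ℕ ℂ) :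
    Set (ℝ → Matrix ℕ ℕ ℂ) :=
  {f | IsSpectralDensity d τ f ∧ D.Constraint f ∧
    ∃ (Θ : ℝ → Matrix ℕ (Idx M) ℂ) (Ψ : ℝ → Matrix (Idx M) ℕ ℂ),
      IsFactorPair (weighted d τ fun l => f l + g l) Θ Ψ}

/-! ### Least favourable densities and minimax characteristics for a known noise density -/

/-- `f⁰` is least favourable in `𝓓` (the noise density `g` being known):
`Δ(f⁰, g) = max_{f ∈ 𝓓} Δ(f, g)`. -/
def IsLeastFavourable (d τ : ℕ) (T : ℝ) (a : ℝ → ℂ) (𝓓 : Set (ℝ → Matrix ℕ ℕ ℂ))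
    (g f₀ : ℝ → Matrix ℕ ℕ ℂ) : Prop :=
  f₀ ∈ 𝓓 ∧ ∀ f ∈ 𝓓, optMse d τ T a f g ≤ optMse d τ T a f₀ g

/-- `H_𝓓 = ⋂_{f ∈ 𝓓} L_2^0(f + g)`. -/
def charClass (d τ : ℕ) (𝓓 : Set (ℝ → Matrix ℕ ℕ ℂ)) (g : ℝ → Matrix ℕ ℕ ℂ) :
    Set (ℝ → ℕ → ℂ) :=
  ⋂ f ∈ 𝓓, L20 d τ (fun l => f l + g l)

/-- `h⁰` is a minimax (robust) spectral characteristic: `h⁰ ∈ H_𝓓` and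
`min_{h ∈ H_𝓓} sup_{f ∈ 𝓓} Δ(h; f, g) = sup_{f ∈ 𝓓} Δ(h⁰; f, g)`. -/
def IsMinimaxCharacteristic (d τ : ℕ) (T : ℝ) (a : ℝ → ℂ) (𝓓 : Set (ℝ → Matrix ℕ ℕ ℂ))
    (g : ℝ → Matrix ℕ ℕ ℂ) (h₀ : ℝ → ℕ → ℂ) : Prop :=
  h₀ ∈ charClass d τ 𝓓 g ∧ ∀ h ∈ charClass d τ 𝓓 g,
    (⨆ f ∈ 𝓓, mse d τ T a h₀ f g) ≤ (⨆ f ∈ 𝓓, mse d τ T a h f g)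

/-- The admissible pairs of processes: zero-mean processes with uncorrelated, periodically
stationary increments whose generated sequences have spectral densities `f` and `g`. -/
structure IsSignalNoise {Ω : Type*} [MeasurableSpace Ω] (P : Measure Ω) (d τ : ℕ) (T : ℝ)
    (ξ η : ℝ → Lp ℂ 2 P) (f g : ℝ → Matrix ℕ ℕ ℂ) : Prop where
  signal : IsPeriodicIncr P d T ξ
  noise : IsPeriodicIncr P d T η
  uncorrelated : Uncorrelated d T ξ η
  signalDensity : HasSpectralDensity d τ T ξ f
  noiseDensity : HasSpectralDensity d τ T η g

end PCFilter

end

open PCFilter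

/-! Fix a frequency and put W = |w|², S = Θᵀ, O = Ωᵀ, operators on ℓ². The factorizations say
W(f+g)(x) = ‖Sx‖² and W g(x) = ‖Ox‖² for the quadratic forms, so positivity of f is the domination
‖Ox‖ ≤ ‖Sx‖. With h = w(B − v) the error density is W f(v) + W g(B − v) = ‖Sv‖² − 2 Re⟨OB, Ov⟩ +
‖OB‖². Since S maps the rows of Ψ to the unit vectors, domination gives ⟨OB, Ov⟩ = ⟨ζ, Sv⟩ with ζ
the conjugate of Ψ|w|²gB̄ (`exists_dual_vector`). Completing the square, the density is ‖Sv − ζ‖² +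
(‖OB‖² − ‖ζ‖²) (`PointData.exists_repr`).

Over all frequencies, h lies in L₂⁰(f+g) iff Θᵀ(h/w) is a limit of functions Θᵀp with p a polynomial
in e^{-iλ}, and canonicity makes these limits exactly the square-integrable functions with
coefficients of nonnegative index only (`Approx.isH2`, `approx_of_isH2`). The function ΘᵀB is one of
them. So Θᵀv cannot touch the negative-index part of ζ, while the coefficients of ζ with index m ≥ 0
are (ψ̄C)_m (`Ctx.coef_zbar`). By Parseval Δ(h;f,g) = ρ + ∑‖coef_m(Θᵀv) − (ψ̄C)_m‖², and ρ is the
infimum (`Ctx.mse_of_mem_L20`, `Ctx.optMse_eq`). For h = wB, that is v = 0, the error is the noise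
energy of wB, so ρ + ‖ψ̄C‖² does not depend on f (`Ctx.rho_add_psiCNormSq`): a minimizer of ‖ψ̄C‖²
maximizes Δ(f,g).

The formula for h⁰ is v = Ψᵀc, and it is optimal once Θᵀv = c. For finite M this follows from ΨΘ =
E; for M = ∞ the equation of the class, multiplied by Ψ on both sides, shows K = W v v*, which also
gives the square summability of v (`multiplier_eq_of_inverse`).

For minimaxity, every f of the class satisfies W f(Ψᵀc) = Re ∑ K_{nk} f_{nk} a.e. For M = ∞ this is
K = W v v*; for finite M the operators S, S' (of f⁰ and f) and O all have rank M, which forces ker S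
⊂ ker O = ker S', so f can be expressed through Θ (`multiplier_quad_of_finite`). The integral of the
right-hand side is prescribed by the constraint (`D0Data.lintegral_multiplier_eq`). Hence h⁰ has the
same error Δ(f⁰,g) for every f of the class, while any other h has at least this error at f⁰.

In the time domain, Aξ is the limit of square partial sums of the block Fourier expansion, finite
combinations are isometric to polynomials (`norm_genComb_sq`), and signal and noise are orthogonal.
So the error of a finite combination of observations is Δ of its polynomial. Density gives the
distance to the observation space, and Pythagoras identifies the projection. -/

noncomputable section

namespace PCFilter

/-! ### Square-summable sequences and Hilbert–Schmidt matrices -/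

section L2

variable {ι κ : Type*}

/-- The Hilbert space of square-summable families. -/
abbrev L2seq (ι : Type*) : Type _ := lp (fun _ : ι => ℂ) 2

theorem memlp_two_iff {x : ι → ℂ} : Memℓp x 2 ↔ Summable fun i => ‖x i‖ ^ 2 := by
  rw [memℓp_gen_iff (by norm_num)]
  simp

/-- A square-summable family as an element of the Hilbert space. -/
def toL2 (x : ι → ℂ) (hx : Summable fun i => ‖x i‖ ^ 2) : L2seq ι := ⟨x, memlp_two_iff.2 hx⟩

@[simp] theorem toL2_apply (x : ι → ℂ) (hx : Summable fun i => ‖x i‖ ^ 2) (i : ι) :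
    toL2 x hx i = x i := rfl

theorem L2seq.summable (x : L2seq ι) : Summable fun i => ‖x i‖ ^ 2 :=
  memlp_two_iff.1 (lp.memℓp x)

theorem L2seq.hasSum_norm_sq (x : L2seq ι) : HasSum (fun i => ‖x i‖ ^ 2) (‖x‖ ^ 2) := by
  have := lp.hasSum_norm (p := 2) (by norm_num) x
  simpa using this

theorem L2seq.norm_sq (x : L2seq ι) : ‖x‖ ^ 2 = ∑' i, ‖x i‖ ^ 2 := x.hasSum_norm_sq.tsum_eq.symm

theorem L2seq.inner_hasSum (x y : L2seq ι) :
    HasSum (fun i => conj (x i) * y i) (inner ℂ x y) := by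
  have h := lp.hasSum_inner (𝕜 := ℂ) x y
  simp only [RCLike.inner_apply'] at h
  exact h

theorem L2seq.enorm_sq (x : L2seq ι) :
    ENNReal.ofReal (‖x‖ ^ 2) = ∑' i, ‖x i‖ₑ ^ 2 := by
  rw [L2seq.norm_sq, ENNReal.ofReal_tsum_of_nonneg (fun _ => by positivity) x.summable]
  congr 1; ext i
  rw [ENNReal.ofReal_pow (norm_nonneg _), ofReal_norm]

theorem summable_sq_iff_tsum_enorm {x : ι → ℂ} :
    (Summable fun i => ‖x i‖ ^ 2) ↔ ∑' i, ‖x i‖ₑ ^ 2 < ∞ := by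
  have h1 : ∀ i, ‖x i‖ₑ ^ 2 = ((‖x i‖₊ ^ 2 : ℝ≥0) : ℝ≥0∞) := fun i => by
    rw [ENNReal.coe_pow]; rfl
  simp_rw [h1, lt_top_iff_ne_top, ENNReal.tsum_coe_ne_top_iff_summable]
  rw [← NNReal.summable_coe]
  simp

theorem summable_sq_star {x : ι → ℂ} (hx : Summable fun i => ‖x i‖ ^ 2) :
    Summable fun i => ‖conj (x i)‖ ^ 2 := by simpa using hx

theorem summable_mul_of_sq {x y : ι → ℂ} (hx : Summable fun i => ‖x i‖ ^ 2)
    (hy : Summable fun i => ‖y i‖ ^ 2) : Summable fun i => ‖x i‖ * ‖y i‖ := by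
  refine Summable.of_nonneg_of_le (fun i => by positivity) (fun i => ?_) ((hx.add hy).div_const 2)
  nlinarith [sq_nonneg (‖x i‖ - ‖y i‖)]

theorem summable_mul_of_sq' {x y : ι → ℂ} (hx : Summable fun i => ‖x i‖ ^ 2)
    (hy : Summable fun i => ‖y i‖ ^ 2) : Summable fun i => x i * y i := by
  refine Summable.of_norm ?_
  simpa using summable_mul_of_sq hx hy

/-- Cauchy–Schwarz inequality for bilinear pairings. -/
theorem norm_tsum_mul_sq_le {x y : ι → ℂ} (hx : Summable fun i => ‖x i‖ ^ 2)
    (hy : Summable fun i => ‖y i‖ ^ 2) :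
    ‖∑' i, x i * y i‖ ^ 2 ≤ (∑' i, ‖x i‖ ^ 2) * ∑' i, ‖y i‖ ^ 2 := by
  have h := L2seq.inner_hasSum (toL2 (fun i => conj (x i)) (summable_sq_star hx)) (toL2 y hy)
  simp only [toL2_apply, Complex.conj_conj] at h
  rw [h.tsum_eq]
  have h1 := norm_inner_le_norm (𝕜 := ℂ) (toL2 (fun i => conj (x i)) (summable_sq_star hx))
    (toL2 y hy)
  have h2 := L2seq.norm_sq (toL2 (fun i => conj (x i)) (summable_sq_star hx))
  have h3 := L2seq.norm_sq (toL2 y hy)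
  simp only [toL2_apply, Complex.norm_conj] at h2 h3
  rw [← h2, ← h3, ← mul_pow]
  gcongr

/-- The standard unit vectors. -/
def unit [DecidableEq ι] (i : ι) : L2seq ι := lp.single 2 i (1 : ℂ)

theorem unit_apply [DecidableEq ι] (i j : ι) : unit i j = if j = i then (1 : ℂ) else 0 := by
  rw [unit, lp.single_apply, Pi.single_apply]

theorem inner_unit_left [DecidableEq ι] (i : ι) (x : L2seq ι) : inner ℂ (unit i) x = x i := by
  rw [unit, lp.inner_single_left]; simp

theorem inner_unit_right [DecidableEq ι] (i : ι) (x : L2seq ι) :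
    inner ℂ x (unit i) = conj (x i) := by
  rw [← inner_conj_symm, inner_unit_left]

theorem hasSum_unit [DecidableEq ι] (x : L2seq ι) : HasSum (fun i => x i • unit i) x := by
  have := lp.hasSum_single (p := 2) (by norm_num) x
  convert this using 2 with i
  rw [unit, ← lp.single_smul, smul_eq_mul, mul_one]

theorem L2seq.norm_unit [DecidableEq ι] (i : ι) : ‖(unit i : L2seq ι)‖ = 1 := by
  rw [unit, lp.norm_single (by norm_num)]; simp

/-- The columns of a Hilbert–Schmidt matrix are square summable. -/
theorem summable_col {A : ι → κ → ℂ} (hA : Summable fun p : ι × κ => ‖A p.1 p.2‖ ^ 2) (j : κ) :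
    Summable fun i => ‖A i j‖ ^ 2 :=
  hA.comp_injective (i := fun i => (i, j)) (fun a b h => by simpa using h)

theorem hasSum_col_sq {A : ι → κ → ℂ} (hA : Summable fun p : ι × κ => ‖A p.1 p.2‖ ^ 2) :
    HasSum (fun j => ∑' i, ‖A i j‖ ^ 2) (∑' p : ι × κ, ‖A p.1 p.2‖ ^ 2) := by
  have h := (Equiv.prodComm κ ι).summable_iff.2 hA
  have h2 := h.hasSum.prod_fiberwise (fun j => (summable_col hA j).hasSum)
  rwa [show ∑' b, ((fun p : ι × κ => ‖A p.1 p.2‖ ^ 2) ∘ (Equiv.prodComm κ ι)) b =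
    ∑' p : ι × κ, ‖A p.1 p.2‖ ^ 2 from
      (Equiv.prodComm κ ι).tsum_eq (fun p : ι × κ => ‖A p.1 p.2‖ ^ 2)] at h2

theorem hs_apply_summable {A : ι → κ → ℂ} (hA : Summable fun p : ι × κ => ‖A p.1 p.2‖ ^ 2)
    {x : ι → ℂ} (hx : Summable fun i => ‖x i‖ ^ 2) :
    Summable fun j => ‖∑' i, A i j * x i‖ ^ 2 :=
  Summable.of_nonneg_of_le (fun _ => by positivity)
    (fun j => norm_tsum_mul_sq_le (summable_col hA j) hx)
    ((hasSum_col_sq hA).summable.mul_right _)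

/-- The operator `x ↦ Aᵀ x` of a Hilbert–Schmidt matrix `A`. -/
def hsOp (A : ι → κ → ℂ) (hA : Summable fun p : ι × κ => ‖A p.1 p.2‖ ^ 2) :
    L2seq ι →L[ℂ] L2seq κ :=
  LinearMap.mkContinuous
    { toFun := fun x => toL2 (fun j => ∑' i, A i j * x i) (hs_apply_summable hA x.summable)
      map_add' := fun x y => by
        ext j
        simp only [toL2_apply, lp.coeFn_add, Pi.add_apply, mul_add]
        exact (summable_mul_of_sq' (summable_col hA j) x.summable).tsum_add
          (summable_mul_of_sq' (summable_col hA j) y.summable)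
      map_smul' := fun c x => by
        ext j
        simp only [toL2_apply, lp.coeFn_smul, Pi.smul_apply, smul_eq_mul, RingHom.id_apply]
        rw [← tsum_mul_left]
        congr 1; ext i; ring }
    (Real.sqrt (∑' p : ι × κ, ‖A p.1 p.2‖ ^ 2)) (fun x => by
      refine le_of_sq_le_sq ?_ (by positivity)
      rw [mul_pow, Real.sq_sqrt (tsum_nonneg fun _ => by positivity), L2seq.norm_sq, L2seq.norm_sq,
        ← (hasSum_col_sq hA).tsum_eq, ← tsum_mul_right]
      exact (hs_apply_summable hA x.summable).tsum_le_tsum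
        (fun j => norm_tsum_mul_sq_le (summable_col hA j) x.summable)
        ((hasSum_col_sq hA).summable.mul_right _))

theorem hsOp_apply (A : ι → κ → ℂ) (hA : Summable fun p : ι × κ => ‖A p.1 p.2‖ ^ 2) (x : L2seq ι)
    (j : κ) : hsOp A hA x j = ∑' i, A i j * x i := rfl

theorem hsOp_unit [DecidableEq ι] (A : ι → κ → ℂ)
    (hA : Summable fun p : ι × κ => ‖A p.1 p.2‖ ^ 2) (i : ι) (j : κ) :
    hsOp A hA (unit i) j = A i j := by
  rw [hsOp_apply, tsum_eq_single i]
  · simp [unit_apply]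
  · intro b hb; simp [unit_apply, hb]

theorem hsOp_inner_unit [DecidableEq ι] (A : ι → κ → ℂ)
    (hA : Summable fun p : ι × κ => ‖A p.1 p.2‖ ^ 2) (n m : ι) :
    inner ℂ (hsOp A hA (unit m)) (hsOp A hA (unit n)) = ∑' i, A n i * conj (A m i) := by
  rw [← (L2seq.inner_hasSum _ _).tsum_eq]
  simp [hsOp_unit, mul_comm]

theorem hasSum_apply_unit [DecidableEq ι] {G : Type*} [NormedAddCommGroup G] [NormedSpace ℂ G]
    (O : L2seq ι →L[ℂ] G) (x : L2seq ι) : HasSum (fun n => x n • O (unit n)) (O x) := by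
  simpa using (hasSum_unit x).mapL O

theorem hasSum_inner_apply_unit [DecidableEq ι] {G : Type*} [NormedAddCommGroup G]
    [InnerProductSpace ℂ G] (O : L2seq ι →L[ℂ] G) (x : L2seq ι) (y : G) :
    HasSum (fun n => x n * inner ℂ y (O (unit n))) (inner ℂ y (O x)) := by
  have := (hasSum_apply_unit O x).mapL (innerSL ℂ y)
  simpa using this

theorem hasSum_inner_apply_unit_left [DecidableEq ι] {G : Type*} [NormedAddCommGroup G]
    [InnerProductSpace ℂ G] (O : L2seq ι →L[ℂ] G) (x : L2seq ι) (y : G) :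
    HasSum (fun n => conj (x n) * inner ℂ (O (unit n)) y) (inner ℂ (O x) y) := by
  have := (hasSum_inner_apply_unit O x y)
  have h2 := this.map (starRingEnd ℂ) Complex.continuous_conj
  simpa [Function.comp_def] using h2

/-- Duality: if `O` is dominated by `S` and the unit vectors are in the range of `S`, then
`⟪x₀, O v⟫` is a bounded functional of `S v`. -/
theorem exists_dual_vector {E G : Type*} [NormedAddCommGroup E] [InnerProductSpace ℂ E]
    [NormedAddCommGroup G] [InnerProductSpace ℂ G] [DecidableEq κ] (S : E →L[ℂ] L2seq κ)
    (O : E →L[ℂ] G) (hOS : ∀ v, ‖O v‖ ≤ ‖S v‖) (ψ : κ → E) (hψ : ∀ i, S (ψ i) = unit i) (x₀ : G) :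
    ∃ ζ : L2seq κ, (∀ i, ζ i = conj (inner ℂ x₀ (O (ψ i)))) ∧ ‖ζ‖ ≤ ‖x₀‖ ∧
      ∀ v, inner ℂ x₀ (O v) = inner ℂ ζ (S v) := by
  set z : κ → ℂ := fun i => inner ℂ x₀ (O (ψ i)) with hz
  have key : ∀ s : Finset κ, ∑ i ∈ s, ‖conj (z i)‖ ^ 2 ≤ ‖x₀‖ ^ 2 := by
    intro s
    set Q := ∑ i ∈ s, ‖conj (z i)‖ ^ 2 with hQ
    have hQ0 : 0 ≤ Q := Finset.sum_nonneg fun _ _ => by positivity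
    -- Test vector for Bessel's inequality: with Q the partial sum, ⟪x₀, O v⟫ = Q and ‖S v‖² = Q, so
    -- the domination gives Q ≤ ‖x₀‖ √Q.
    set v : E := ∑ i ∈ s, conj (z i) • ψ i with hv
    have h1 : inner ℂ x₀ (O v) = (Q : ℂ) := by
      rw [hv, map_sum, inner_sum, hQ]
      push_cast
      refine Finset.sum_congr rfl fun i _ => ?_
      rw [map_smul, inner_smul_right, Complex.norm_conj]
      exact Complex.conj_mul' (z i)
    have h2 : ‖S v‖ ^ 2 = Q := by
      rw [hv, map_sum]
      simp_rw [map_smul, hψ]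
      have h3 := lp.norm_sum_single (p := 2) (E := fun _ : κ => ℂ) (by norm_num)
        (fun i => conj (z i)) s
      have h4 : ∀ i, (conj (z i)) • (unit i : L2seq κ) = lp.single 2 i (conj (z i)) := fun i => by
        rw [unit, ← lp.single_smul, smul_eq_mul, mul_one]
      simp_rw [h4]
      simpa [hQ] using h3
    have h5 : Q ≤ ‖x₀‖ * ‖S v‖ := by
      calc Q = ‖inner ℂ x₀ (O v)‖ := by rw [h1]; simp [abs_of_nonneg hQ0]
        _ ≤ ‖x₀‖ * ‖O v‖ := norm_inner_le_norm _ _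
        _ ≤ _ := by gcongr; exact hOS v
    have h6 : ‖S v‖ * ‖S v‖ ≤ ‖x₀‖ * ‖S v‖ := by nlinarith
    rw [← h2]
    rcases (norm_nonneg (S v)).eq_or_lt with h | h
    · rw [← h]; nlinarith [sq_nonneg ‖x₀‖]
    · have := le_of_mul_le_mul_right h6 h
      gcongr
  have hsum : Summable fun i => ‖conj (z i)‖ ^ 2 :=
    summable_of_sum_le (fun _ => by positivity) key
  refine ⟨toL2 _ hsum, fun i => rfl, ?_, fun v => ?_⟩
  · refine le_of_sq_le_sq ?_ (norm_nonneg _)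
    rw [L2seq.norm_sq]
    exact hsum.tsum_le_of_sum_le key
  · have h1 := hasSum_unit (S v)
    have h2 : HasSum (fun i => inner ℂ (toL2 _ hsum) ((S v i) • unit i))
        (inner ℂ (toL2 _ hsum) (S v)) := h1.mapL (innerSL ℂ (toL2 _ hsum))
    have h3 : Tendsto (fun s : Finset κ => ‖x₀‖ * ‖S v - ∑ i ∈ s, S v i • unit i‖) atTop (𝓝 0) := by
      have : Tendsto (fun s : Finset κ => S v - ∑ i ∈ s, S v i • unit i) atTop (𝓝 (S v - S v)) :=
        tendsto_const_nhds.sub h1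
      simpa using this.norm.const_mul ‖x₀‖
    -- The vector `v` need not be a combination of the `ψ i`. It is enough that `S v` is
    -- approximated by the images of such combinations: domination carries the error over to `O`.
    refine tendsto_nhds_unique (f := fun s : Finset κ => ∑ i ∈ s,
      inner ℂ (toL2 _ hsum) ((S v i) • unit i)) ?_ h2
    rw [tendsto_iff_norm_sub_tendsto_zero]
    refine squeeze_zero (fun _ => norm_nonneg _) (fun s => ?_) h3
    have h4 : ∑ i ∈ s, inner ℂ (toL2 _ hsum) ((S v i) • unit i) =
        inner ℂ x₀ (O (∑ i ∈ s, S v i • ψ i)) := by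
      rw [map_sum, inner_sum]
      refine Finset.sum_congr rfl fun i _ => ?_
      rw [map_smul, inner_smul_right, inner_smul_right, inner_unit_right]
      simp [hz]
    rw [h4, ← inner_sub_right, ← map_sub]
    refine (norm_inner_le_norm _ _).trans ?_
    gcongr
    refine (hOS _).trans (le_of_eq ?_)
    rw [map_sub, map_sum, ← norm_neg]
    simp [hψ]

end L2

/-! ### The quadratic form of a positive trace-class matrix -/

section Quad

variable {κ : Type*} {F G : Matrix ℕ ℕ ℂ} {h : ℕ → ℂ}

theorem posSemidef_diag_re {n : Type*} {F : Matrix n n ℂ} (hF : F.PosSemidef) (k : n) :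
    F k k = ((F k k).re : ℂ) ∧ 0 ≤ (F k k).re := by
  have h := hF.diag_nonneg (i := k)
  rw [Complex.le_def] at h
  refine ⟨Complex.ext rfl ?_, h.1⟩
  simpa using h.2.symm

/-- The principal 2×2 minor on the indices `k`, `m` is nonnegative. With `![k, m]` no case
distinction for `k = m` is needed. -/
theorem posSemidef_norm_sq_le {n : Type*} {F : Matrix n n ℂ} (hF : F.PosSemidef) (k m : n) :
    ‖F k m‖ ^ 2 ≤ (F k k).re * (F m m).re := by
  have h := (hF.submatrix ![k, m]).det_nonneg
  rw [Matrix.det_fin_two] at h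
  simp only [Matrix.submatrix_apply, Matrix.cons_val_zero, Matrix.cons_val_one] at h
  rw [← hF.isHermitian.apply m k, (posSemidef_diag_re hF k).1, (posSemidef_diag_re hF m).1] at h
  have h2 : F k m * star (F k m) = ((‖F k m‖ ^ 2 : ℝ) : ℂ) := by
    push_cast; exact Complex.mul_conj' _
  rw [h2, ← Complex.ofReal_mul, ← Complex.ofReal_sub, Complex.zero_le_real] at h
  linarith

theorem posSemidef_norm_le {n : Type*} {F : Matrix n n ℂ} (hF : F.PosSemidef) (k m : n) :
    ‖F k m‖ ≤ Real.sqrt (F k k).re * Real.sqrt (F m m).re := by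
  rw [← Real.sqrt_mul (posSemidef_diag_re hF k).2]
  exact Real.le_sqrt_of_sq_le (posSemidef_norm_sq_le hF k m)

theorem summable_mul_sqrt_diag (hF : F.PosSemidef) (hs : Summable fun k => (F k k).re)
    (hh : Summable fun k => ‖h k‖ ^ 2) : Summable fun k => ‖h k‖ * Real.sqrt (F k k).re := by
  have h1 : Summable fun k => ‖(Real.sqrt (F k k).re : ℂ)‖ ^ 2 := by
    convert hs using 2 with k
    rw [Complex.norm_real, Real.norm_eq_abs, sq_abs, Real.sq_sqrt (posSemidef_diag_re hF k).2]
  convert summable_mul_of_sq hh h1 using 2 with k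
  rw [Complex.norm_real, Real.norm_eq_abs, abs_of_nonneg (Real.sqrt_nonneg _)]

theorem quad_norm_le (hF : F.PosSemidef) (p : ℕ × ℕ) :
    ‖h p.1 * F p.1 p.2 * conj (h p.2)‖ ≤
      (‖h p.1‖ * Real.sqrt (F p.1 p.1).re) * (‖h p.2‖ * Real.sqrt (F p.2 p.2).re) := by
  rw [norm_mul, norm_mul, Complex.norm_conj]
  calc ‖h p.1‖ * ‖F p.1 p.2‖ * ‖h p.2‖
      ≤ ‖h p.1‖ * (Real.sqrt (F p.1 p.1).re * Real.sqrt (F p.2 p.2).re) * ‖h p.2‖ := by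
        gcongr; exact posSemidef_norm_le hF _ _
    _ = _ := by ring

theorem quad_summable (hF : F.PosSemidef) (hs : Summable fun k => (F k k).re)
    (hh : Summable fun k => ‖h k‖ ^ 2) :
    Summable fun p : ℕ × ℕ => h p.1 * F p.1 p.2 * conj (h p.2) := by
  have h1 := summable_mul_sqrt_diag hF hs hh
  exact Summable.of_norm_bounded (h1.mul_of_nonneg h1 (fun _ => by positivity)
    (fun _ => by positivity)) (quad_norm_le hF)

/-- The entry bound splits the double series into the square of ∑ |h_k| √F_kk, and Cauchy–Schwarz
bounds this square. The trace on the right later serves as an integrable majorant. -/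
theorem quad_le (hF : F.PosSemidef) (hs : Summable fun k => (F k k).re)
    (hh : Summable fun k => ‖h k‖ ^ 2) :
    quad F h ≤ (∑' k, ‖h k‖ ^ 2) * ∑' k, (F k k).re := by
  have h1 := summable_mul_sqrt_diag hF hs hh
  have h2 := h1.mul_of_nonneg h1 (fun _ => by positivity) (fun _ => by positivity)
  have h3 : quad F h ≤ (∑' k, ‖h k‖ * Real.sqrt (F k k).re) ^ 2 := by
    refine (Complex.re_le_norm _).trans ?_
    refine (tsum_of_norm_bounded h2.hasSum (quad_norm_le hF)).trans (le_of_eq ?_)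
    rw [sq, h1.tsum_mul_tsum h1 h2]
  refine h3.trans ?_
  have h4 : Summable fun k => ‖(Real.sqrt (F k k).re : ℂ)‖ ^ 2 := by
    convert hs using 2 with k
    rw [Complex.norm_real, Real.norm_eq_abs, sq_abs, Real.sq_sqrt (posSemidef_diag_re hF k).2]
  have hh' : Summable fun k => ‖((‖h k‖ : ℝ) : ℂ)‖ ^ 2 := by simpa using hh
  have h5 := norm_tsum_mul_sq_le hh' h4
  simp_rw [← Complex.ofReal_mul] at h5
  rw [← Complex.ofReal_tsum, Complex.norm_real, Real.norm_eq_abs, sq_abs] at h5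
  refine h5.trans (le_of_eq ?_)
  congr 1
  · simp
  · congr 1; ext k
    rw [Complex.norm_real, Real.norm_eq_abs, sq_abs, Real.sq_sqrt (posSemidef_diag_re hF k).2]

theorem quad_nonneg (hF : F.PosSemidef) (h : ℕ → ℂ) : 0 ≤ quad F h := by
  by_cases hsum : Summable fun p : ℕ × ℕ => h p.1 * F p.1 p.2 * conj (h p.2)
  · have h1 : Tendsto (fun N : ℕ => (∑ p ∈ Finset.range N ×ˢ Finset.range N,
        h p.1 * F p.1 p.2 * conj (h p.2)).re) atTop (𝓝 (quad F h)) := by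
      refine (Complex.continuous_re.tendsto _).comp (hsum.hasSum.comp ?_)
      refine tendsto_atTop_finset_of_monotone ?_ ?_
      · intro a b hab
        have : Finset.range a ⊆ Finset.range b := by
          intro x hx; simp only [Finset.mem_range] at *; omega
        exact Finset.product_subset_product this this
      · intro x
        refine ⟨max x.1 x.2 + 1, ?_⟩
        simp only [Finset.mem_product, Finset.mem_range]
        omega
    refine ge_of_tendsto' h1 fun N => ?_
    -- Positivity is stated for x* F x, whereas the form here is hᵀ F h̄; hence the test vector is
    -- the conjugate of the truncation of `h`.
    have h2 := hF.2 (Finsupp.onFinset (Finset.range N)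
      (fun k => if k ∈ Finset.range N then conj (h k) else 0) (fun a ha => by
        by_contra hc; exact ha (if_neg hc)))
    rw [Finsupp.onFinset_sum _ (by simp)] at h2
    rw [Complex.le_def] at h2
    refine h2.1.trans (le_of_eq ?_)
    congr 1
    rw [Finset.sum_product]
    refine Finset.sum_congr rfl fun k hk => ?_
    rw [Finsupp.onFinset_sum _ (by simp)]
    refine Finset.sum_congr rfl fun n hn => ?_
    rw [if_pos hk, if_pos hn]
    simp
  -- A divergent double series has the default sum 0.
  · rw [quad, tsum_eq_zero_of_not_summable hsum]; simp

theorem quad_add (hF : F.PosSemidef) (hs : Summable fun k => (F k k).re)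
    (hG : G.PosSemidef) (hsG : Summable fun k => (G k k).re)
    (hh : Summable fun k => ‖h k‖ ^ 2) : quad (F + G) h = quad F h + quad G h := by
  rw [quad, quad, quad, ← Complex.add_re, ← (quad_summable hF hs hh).tsum_add
    (quad_summable hG hsG hh)]
  congr 2; ext p; simp; ring

theorem quad_const_mul (F : Matrix ℕ ℕ ℂ) (h : ℕ → ℂ) (c : ℂ) :
    quad F (fun k => c * h k) = ‖c‖ ^ 2 * quad F h := by
  rw [quad, quad, ← Complex.re_ofReal_mul, ← tsum_mul_left]
  congr 2; ext p
  have : c * conj c = ((‖c‖ ^ 2 : ℝ) : ℂ) := by push_cast; exact Complex.mul_conj' c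
  rw [← this, map_mul]; ring

/-- If `W F = Θ Θ^*`, then `W hᵀ F h̄ = ‖Θᵀ h‖²`. -/
theorem quad_eq_norm_sq {W : ℝ} {A : ℕ → κ → ℂ}
    (hA : Summable fun p : ℕ × κ => ‖A p.1 p.2‖ ^ 2)
    (hfac : ∀ n m, (W : ℂ) * F n m = ∑' i, A n i * conj (A m i)) (x : L2seq ℕ)
    (hsum : Summable fun p : ℕ × ℕ => x p.1 * F p.1 p.2 * conj (x p.2)) :
    W * quad F x = ‖hsOp A hA x‖ ^ 2 := by
  rw [quad, ← Complex.re_ofReal_mul, hsum.tsum_prod, ← tsum_mul_left]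
  have h1 : ∀ k, (W : ℂ) * ∑' n, x k * F k n * conj (x n) =
      x k * inner ℂ (hsOp A hA x) (hsOp A hA (unit k)) := by
    intro k
    rw [← (hasSum_inner_apply_unit_left (hsOp A hA) x (hsOp A hA (unit k))).tsum_eq,
      ← tsum_mul_left, ← tsum_mul_left]
    congr 1; ext n
    rw [hsOp_inner_unit, ← hfac]; ring
  simp_rw [h1]
  rw [(hasSum_inner_apply_unit (hsOp A hA) x (hsOp A hA x)).tsum_eq, inner_self_eq_norm_sq_to_K]
  norm_cast

end Quad

/-! ### Pointwise identities for the mean-square error -/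

section Pointwise

variable {κ : Type*}

/-- The pointwise data at a frequency: positive trace-class `f`, `g` with `W (f + g) = Θ Θ^*`,
`W g = Ω Ω^*`. -/
structure PointData {κ' : Type*} (W : ℝ) (f g : Matrix ℕ ℕ ℂ) (Th : ℕ → κ → ℂ) (Om : ℕ → κ' → ℂ) :
    Prop where
  W_pos : 0 < W
  fpos : f.PosSemidef
  gpos : g.PosSemidef
  fsum : Summable fun k => (f k k).re
  gsum : Summable fun k => (g k k).re
  thsum : Summable fun p : ℕ × κ => ‖Th p.1 p.2‖ ^ 2
  omsum : Summable fun p : ℕ × κ' => ‖Om p.1 p.2‖ ^ 2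
  thfac : ∀ n m, (W : ℂ) * (f n m + g n m) = ∑' i, Th n i * conj (Th m i)
  omfac : ∀ n m, (W : ℂ) * g n m = ∑' i, Om n i * conj (Om m i)

namespace PointData

variable {κ' : Type*} {W : ℝ} {f g : Matrix ℕ ℕ ℂ} {Th : ℕ → κ → ℂ} {Om : ℕ → κ' → ℂ}

theorem quad_g (H : PointData W f g Th Om) (x : L2seq ℕ) :
    W * quad g x = ‖hsOp Om H.omsum x‖ ^ 2 :=
  quad_eq_norm_sq H.omsum H.omfac x (quad_summable H.gpos H.gsum x.summable)

theorem quad_sum (H : PointData W f g Th Om) (x : L2seq ℕ) :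
    W * quad (f + g) x = ‖hsOp Th H.thsum x‖ ^ 2 := by
  have hs : Summable fun k => ((f + g) k k).re := by
    simpa using H.fsum.add H.gsum
  exact quad_eq_norm_sq (F := f + g) H.thsum H.thfac x
    (quad_summable (F := f + g) (H.fpos.add H.gpos) hs x.summable)

theorem quad_f (H : PointData W f g Th Om) (x : L2seq ℕ) :
    W * quad f x = ‖hsOp Th H.thsum x‖ ^ 2 - ‖hsOp Om H.omsum x‖ ^ 2 := by
  rw [← H.quad_g, ← H.quad_sum, quad_add H.fpos H.fsum H.gpos H.gsum x.summable]
  ring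

/-- This is the positivity of `f`, read off from the two factorizations. -/
theorem norm_le (H : PointData W f g Th Om) (x : L2seq ℕ) :
    ‖hsOp Om H.omsum x‖ ≤ ‖hsOp Th H.thsum x‖ := by
  have h1 := H.quad_f x
  have h2 := mul_nonneg H.W_pos.le (quad_nonneg H.fpos x)
  exact le_of_sq_le_sq (by linarith) (norm_nonneg _)

theorem conj_apply_g (H : PointData W f g Th Om) (x : L2seq ℕ) (n : ℕ) :
    (W : ℂ) * ∑' m, g n m * conj (x m) =
      inner ℂ (hsOp Om H.omsum x) (hsOp Om H.omsum (unit n)) := by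
  rw [← (hasSum_inner_apply_unit_left (hsOp Om H.omsum) x _).tsum_eq, ← tsum_mul_left]
  congr 1; ext m
  rw [hsOp_inner_unit, ← H.omfac]; ring

/-- The pointwise mean-square error is `‖Θᵀ v - ζ‖²` up to a nonnegative constant. -/
theorem exists_repr [DecidableEq κ] (H : PointData W f g Th Om) {Ps : κ → ℕ → ℂ}
    (hrow : ∀ i, Summable fun n => ‖Ps i n‖ ^ 2)
    (hinv : ∀ i j, ∑' n, Ps i n * Th n j = if i = j then 1 else 0) (b : L2seq ℕ) :
    ∃ ζ : L2seq κ, (∀ i, ζ i = conj (∑' n, Ps i n * ((W : ℂ) * ∑' m, g n m * conj (b m)))) ∧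
      ‖ζ‖ ≤ ‖hsOp Om H.omsum b‖ ∧
      ∀ v : L2seq ℕ, W * quad f v + W * quad g (b - v : L2seq ℕ) =
        ‖hsOp Th H.thsum v - ζ‖ ^ 2 + (‖hsOp Om H.omsum b‖ ^ 2 - ‖ζ‖ ^ 2) := by
  -- The domination needed for duality is the positivity of `f`; the preimages of the unit vectors
  -- are the rows of Ψ, since ΨΘ = E.
  obtain ⟨ζ, h1, h2, h3⟩ := exists_dual_vector (hsOp Th H.thsum) (hsOp Om H.omsum) H.norm_le
    (fun i => toL2 (Ps i) (hrow i)) (fun i => by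
      ext j
      rw [hsOp_apply, unit_apply]
      simp_rw [toL2_apply, mul_comm (Th _ _), hinv, eq_comm]) (hsOp Om H.omsum b)
  refine ⟨ζ, fun i => ?_, h2, fun v => ?_⟩
  · rw [h1]
    simp_rw [H.conj_apply_g b]
    rw [← (hasSum_inner_apply_unit (hsOp Om H.omsum) (toL2 (Ps i) (hrow i)) _).tsum_eq]
    rfl
  · rw [H.quad_f, H.quad_g, map_sub, @norm_sub_sq ℂ, @norm_sub_sq ℂ, h3,
      inner_re_symm (𝕜 := ℂ) (hsOp Th H.thsum v) ζ]
    ring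

end PointData

end Pointwise

/-! ### Fourier coefficients on `(-π, π]` -/

section Fourier

variable {ι : Type*} {F G : ℝ → ℂ}

instance : IsFiniteMeasure freqMeasure := by
  unfold freqMeasure; infer_instance

theorem memLp_two_iff_lintegral {α : Type*} [MeasurableSpace α] {μ : Measure α} {F : α → ℂ}
    (hF : AEMeasurable F μ) : MemLp F 2 μ ↔ ∫⁻ l, ‖F l‖ₑ ^ 2 ∂μ < ∞ := by
  have h := eLpNorm_lt_top_iff_lintegral_rpow_enorm_lt_top (f := F) (μ := μ) (p := 2)
    (by norm_num) (by norm_num)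
  simp only [ENNReal.toReal_ofNat, ENNReal.rpow_ofNat] at h
  rw [← h]
  exact ⟨fun h => h.2, fun h => ⟨hF.aestronglyMeasurable, h⟩⟩

theorem lintegral_enorm_sq {α : Type*} [MeasurableSpace α] {μ : Measure α} {F : α → ℂ}
    (hF : MemLp F 2 μ) : ∫⁻ l, ‖F l‖ₑ ^ 2 ∂μ = ENNReal.ofReal (∫ l, ‖F l‖ ^ 2 ∂μ) := by
  rw [ofReal_integral_eq_lintegral_ofReal (hF.integrable_norm_pow (p := 2) (by norm_num)) (by
    filter_upwards with l; positivity)]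
  congr 1; ext l
  rw [ENNReal.ofReal_pow (norm_nonneg _), ofReal_norm]

/-- The index is that of e^{-iλk}, so the sign is opposite to the usual convention. -/
theorem coef_eq (F : ℝ → ℂ) (k : ℤ) :
    coef F k = fourierCoeffOn (a := -Real.pi) (b := Real.pi) (by linarith [Real.pi_pos]) F (-k) := by
  rw [fourierCoeffOn_eq_integral, coef, freqMeasure,
    intervalIntegral.integral_of_le (by linarith [Real.pi_pos]), sub_neg_eq_add, ← two_mul,
    Complex.real_smul]
  congr 1
  refine integral_congr_ae (Eventually.of_forall fun l => ?_)
  simp only [smul_eq_mul]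
  rw [fourier_coe_apply, mul_comm]
  congr 2
  have : (Real.pi : ℂ) ≠ 0 := by exact_mod_cast Real.pi_ne_zero
  push_cast
  field_simp

theorem hasSum_coef_sq (hF : MemLp F 2 freqMeasure) :
    HasSum (fun k => ‖coef F k‖ ^ 2) (1 / (2 * Real.pi) * ∫ l, ‖F l‖ ^ 2 ∂freqMeasure) := by
  have h := hasSum_sq_fourierCoeffOn (a := -Real.pi) (b := Real.pi) (f := F)
    (by linarith [Real.pi_pos]) hF
  rw [intervalIntegral.integral_of_le (by linarith [Real.pi_pos]),
    show ((Real.pi - -Real.pi)⁻¹ : ℝ) = 1 / (2 * Real.pi) by rw [one_div]; congr 1; ring,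
    smul_eq_mul] at h
  rw [← (Equiv.neg ℤ).hasSum_iff] at h
  convert h using 2 with k
  · rw [coef_eq]; rfl
  · rfl

theorem coef_congr (h : F =ᵐ[freqMeasure] G) (k : ℤ) : coef F k = coef G k := by
  unfold coef
  congr 1
  exact integral_congr_ae (by filter_upwards [h] with l hl; rw [hl])

theorem norm_exp_I_mul (x : ℝ) (k : ℤ) : ‖Complex.exp (Complex.I * x * k)‖ = 1 := by
  rw [show Complex.I * (x : ℂ) * (k : ℂ) = ((x * k : ℝ) : ℂ) * Complex.I by push_cast; ring]
  exact Complex.norm_exp_ofReal_mul_I _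

theorem norm_exp_neg_I_mul (x : ℝ) (k : ℕ) : ‖Complex.exp (-(Complex.I * x * k))‖ = 1 := by
  rw [show -(Complex.I * (x : ℂ) * (k : ℂ)) = ((-(x * k) : ℝ) : ℂ) * Complex.I by push_cast; ring]
  exact Complex.norm_exp_ofReal_mul_I _

theorem integrable_mul_exp (hF : Integrable F freqMeasure) (k : ℤ) :
    Integrable (fun l : ℝ => F l * Complex.exp (Complex.I * l * k)) freqMeasure := by
  refine hF.mul_bdd (c := 1) ?_ ?_
  · exact (by fun_prop : Continuous fun l : ℝ =>
      Complex.exp (Complex.I * l * k)).aestronglyMeasurable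
  · exact Eventually.of_forall fun l => (norm_exp_I_mul l k).le

theorem memLp_mul_exp (hF : MemLp F 2 freqMeasure) (k : ℤ) :
    MemLp (fun l : ℝ => F l * Complex.exp (Complex.I * l * k)) 2 freqMeasure := by
  refine hF.of_le (g := F) (hF.1.mul (by fun_prop : Continuous fun l : ℝ =>
      Complex.exp (Complex.I * l * k)).aestronglyMeasurable) ?_
  exact Eventually.of_forall fun l => by rw [norm_mul, norm_exp_I_mul, mul_one]

theorem integrable_of_memLp_freq (hF : MemLp F 2 freqMeasure) : Integrable F freqMeasure :=
  hF.integrable (by norm_num)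

theorem coef_add (hF : Integrable F freqMeasure) (hG : Integrable G freqMeasure) (k : ℤ) :
    coef (fun l => F l + G l) k = coef F k + coef G k := by
  unfold coef
  rw [← mul_add, ← integral_add (integrable_mul_exp hF k) (integrable_mul_exp hG k)]
  simp_rw [add_mul]

theorem coef_sub (hF : Integrable F freqMeasure) (hG : Integrable G freqMeasure) (k : ℤ) :
    coef (fun l => F l - G l) k = coef F k - coef G k := by
  unfold coef
  rw [← mul_sub, ← integral_sub (integrable_mul_exp hF k) (integrable_mul_exp hG k)]
  simp_rw [sub_mul]

theorem coef_const_mul (c : ℂ) (F : ℝ → ℂ) (k : ℤ) :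
    coef (fun l => c * F l) k = c * coef F k := by
  unfold coef
  simp_rw [mul_assoc c]
  rw [integral_const_mul]; ring

theorem coef_mul_exp (F : ℝ → ℂ) (m k : ℤ) :
    coef (fun l => F l * Complex.exp (Complex.I * l * m)) k = coef F (k + m) := by
  unfold coef
  congr 2; ext l
  rw [mul_assoc, ← Complex.exp_add]
  congr 2; push_cast; ring

/-- Polarization of the norm identity over the four fourth roots of unity. -/
theorem hasSum_coef_conj_mul (hF : MemLp F 2 freqMeasure) (hG : MemLp G 2 freqMeasure) :
    HasSum (fun k => conj (coef F k) * coef G k)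
      (((1 / (2 * Real.pi) : ℝ) : ℂ) * ∫ l, conj (F l) * G l ∂freqMeasure) := by
  have pol : ∀ a b : ℂ, conj a * b = (1 / 4 : ℂ) * (((‖a + 1 * b‖ ^ 2 : ℝ) : ℂ)
      - ((‖a + (-1) * b‖ ^ 2 : ℝ) : ℂ) - Complex.I * ((‖a + Complex.I * b‖ ^ 2 : ℝ) : ℂ) +
      Complex.I * ((‖a + (-Complex.I) * b‖ ^ 2 : ℝ) : ℂ)) := by
    intro a b
    push_cast
    simp_rw [← Complex.conj_mul', map_add, map_mul, map_neg, map_one, Complex.conj_I]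
    ring_nf
    simp only [Complex.I_sq]
    ring
  have key : ∀ c : ℂ, HasSum (fun k => ((‖coef F k + c * coef G k‖ ^ 2 : ℝ) : ℂ))
      (((1 / (2 * Real.pi) : ℝ) : ℂ) * ∫ l, ((‖F l + c * G l‖ ^ 2 : ℝ) : ℂ) ∂freqMeasure) := by
    intro c
    have h := hasSum_coef_sq (hF.add (hG.const_mul c))
    have h' := Complex.hasSum_ofReal.2 h
    rw [Complex.ofReal_mul, ← integral_complex_ofReal] at h'
    have e : ∀ k, coef F k + c * coef G k = coef (F + fun x => c * G x) k := fun k => by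
      rw [← coef_const_mul, ← coef_add (integrable_of_memLp_freq hF)
        (integrable_of_memLp_freq (hG.const_mul c))]
      rfl
    simp_rw [e]
    exact h'
  have kint : ∀ c : ℂ, Integrable (fun l => ((‖F l + c * G l‖ ^ 2 : ℝ) : ℂ)) freqMeasure :=
    fun c => ((hF.add (hG.const_mul c)).integrable_norm_pow (p := 2) (by norm_num)).ofReal
  have h := ((((key 1).sub (key (-1))).sub ((key Complex.I).mul_left Complex.I)).add
    ((key (-Complex.I)).mul_left Complex.I)).mul_left (1 / 4 : ℂ)
  have h' := h
  rw [← funext fun k => pol (coef F k) (coef G k)] at h'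
  refine (congrArg (fun z => HasSum (fun k => conj (coef F k) * coef G k) z) ?_).mp h'
  simp_rw [pol (F _)]
  rw [integral_const_mul, integral_add, integral_sub, integral_sub, integral_const_mul,
    integral_const_mul]
  · ring
  · exact kint _
  · exact kint _
  · exact (kint _).sub (kint _)
  · exact (kint _).const_mul _
  · exact ((kint _).sub (kint _)).sub ((kint _).const_mul _)
  · exact (kint _).const_mul _

theorem hasSum_coef_conj_mul_shift (hF : MemLp F 2 freqMeasure) (hG : MemLp G 2 freqMeasure)
    (m : ℤ) : HasSum (fun k => conj (coef F k) * coef G (k + m))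
      (coef (fun l => conj (F l) * G l) m) := by
  have h := hasSum_coef_conj_mul hF (memLp_mul_exp hG m)
  simp_rw [coef_mul_exp] at h
  convert h using 1
  unfold coef
  simp_rw [mul_assoc]

theorem tsum_coef_enorm_sq (hF : MemLp F 2 freqMeasure) :
    ENNReal.ofReal (1 / (2 * Real.pi)) * ∫⁻ l, ‖F l‖ₑ ^ 2 ∂freqMeasure =
      ∑' k : ℤ, ‖coef F k‖ₑ ^ 2 := by
  have h := hasSum_coef_sq hF
  rw [lintegral_enorm_sq hF, ← ENNReal.ofReal_mul (by positivity), ← h.tsum_eq,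
    ENNReal.ofReal_tsum_of_nonneg (fun _ => by positivity) h.summable]
  congr 1; ext k
  rw [ENNReal.ofReal_pow (norm_nonneg _), ofReal_norm]

/-! ### Vector functions -/

/-- `∫ ‖u(λ)‖² dλ`. -/
def sqInt (u : ℝ → ι → ℂ) : ℝ≥0∞ := ∫⁻ l, ∑' i, ‖u l i‖ₑ ^ 2 ∂freqMeasure

/-- Componentwise measurability. -/
def CompMeas (u : ℝ → ι → ℂ) : Prop := ∀ i, AEMeasurable (fun l => u l i) freqMeasure

variable {u v : ℝ → ι → ℂ}

theorem CompMeas.tsum_meas [Countable ι] (hu : CompMeas u) :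
    AEMeasurable (fun l => ∑' i, ‖u l i‖ₑ ^ 2) freqMeasure :=
  AEMeasurable.tsum fun i => (hu i).enorm.pow_const 2

theorem sqInt_eq_tsum [Countable ι] (hu : CompMeas u) :
    sqInt u = ∑' i, ∫⁻ l, ‖u l i‖ₑ ^ 2 ∂freqMeasure :=
  lintegral_tsum fun i => (hu i).enorm.pow_const 2

theorem CompMeas.sub (hu : CompMeas u) (hv : CompMeas v) : CompMeas fun l i => u l i - v l i :=
  fun i => (hu i).sub (hv i)

theorem sqInt_congr (h : ∀ᵐ l ∂freqMeasure, ∀ i, u l i = v l i) : sqInt u = sqInt v :=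
  lintegral_congr_ae (by filter_upwards [h] with l hl; simp [hl])

theorem enorm_add_sq_le (a b : ℂ) : ‖a + b‖ₑ ^ 2 ≤ 2 * ‖a‖ₑ ^ 2 + 2 * ‖b‖ₑ ^ 2 := by
  calc ‖a + b‖ₑ ^ 2 ≤ (‖a‖ₑ + ‖b‖ₑ) ^ 2 := by gcongr; exact enorm_add_le _ _
    _ ≤ 2 * ‖a‖ₑ ^ 2 + 2 * ‖b‖ₑ ^ 2 := by
      have : ((‖a‖₊ + ‖b‖₊) ^ 2 : ℝ≥0) ≤ 2 * ‖a‖₊ ^ 2 + 2 * ‖b‖₊ ^ 2 := by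
        rw [← NNReal.coe_le_coe]; push_cast
        nlinarith [sq_nonneg (‖a‖ - ‖b‖)]
      simp only [enorm_eq_nnnorm]
      exact_mod_cast this

theorem sqInt_add_le [Countable ι] (hu : CompMeas u) :
    sqInt (fun l i => u l i + v l i) ≤ 2 * sqInt u + 2 * sqInt v := by
  unfold sqInt
  rw [← lintegral_const_mul' _ _ (by norm_num), ← lintegral_const_mul' _ _ (by norm_num),
    ← lintegral_add_left' (hu.tsum_meas.const_mul 2)]
  refine lintegral_mono fun l => ?_
  simp only
  rw [← ENNReal.tsum_mul_left, ← ENNReal.tsum_mul_left, ← ENNReal.tsum_add]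
  exact ENNReal.tsum_le_tsum fun i => enorm_add_sq_le _ _

theorem sqInt_neg (u : ℝ → ι → ℂ) : sqInt (fun l i => -u l i) = sqInt u := by
  simp [sqInt]

theorem sqInt_sub_comm (u v : ℝ → ι → ℂ) :
    sqInt (fun l i => u l i - v l i) = sqInt (fun l i => v l i - u l i) := by
  rw [← sqInt_neg]; simp

theorem sqInt_sub_le [Countable ι] (hu : CompMeas u) :
    sqInt (fun l i => u l i - v l i) ≤ 2 * sqInt u + 2 * sqInt v := by
  rw [← sqInt_neg v]
  simpa [sub_eq_add_neg] using sqInt_add_le (v := fun l i => -v l i) hu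

theorem memLp_comp (hu : CompMeas u) (h : sqInt u < ∞) (i : ι) :
    MemLp (fun l => u l i) 2 freqMeasure := by
  rw [memLp_two_iff_lintegral (hu i)]
  refine lt_of_le_of_lt (lintegral_mono fun l => ?_) h
  exact ENNReal.le_tsum (f := fun i => ‖u l i‖ₑ ^ 2) i

theorem sqInt_parseval [Countable ι] (hu : CompMeas u) (h : sqInt u < ∞) :
    ENNReal.ofReal (1 / (2 * Real.pi)) * sqInt u = ∑' i, ∑' k : ℤ, ‖coef (fun l => u l i) k‖ₑ ^ 2 := by
  rw [sqInt_eq_tsum hu, ← ENNReal.tsum_mul_left]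
  exact tsum_congr fun i => tsum_coef_enorm_sq (memLp_comp hu h i)

theorem ae_summable_of_sqInt [Countable ι] (hu : CompMeas u) (h : sqInt u < ∞) :
    ∀ᵐ l ∂freqMeasure, Summable fun i => ‖u l i‖ ^ 2 := by
  filter_upwards [ae_lt_top' hu.tsum_meas h.ne] with l hl
  exact summable_sq_iff_tsum_enorm.2 hl

theorem summable_coef_sq [Countable ι] (hu : CompMeas u) (h : sqInt u < ∞) :
    Summable fun p : ι × ℤ => ‖coef (fun l => u l p.1) p.2‖ ^ 2 := by
  rw [summable_sq_iff_tsum_enorm, ENNReal.tsum_prod', ← sqInt_parseval hu h]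
  exact ENNReal.mul_lt_top ENNReal.ofReal_lt_top h

theorem summable_integral_sq [Countable ι] (hu : CompMeas u) (h : sqInt u < ∞) :
    Summable fun i => ∫ l, ‖u l i‖ ^ 2 ∂freqMeasure := by
  have h1 := sqInt_eq_tsum hu
  simp_rw [fun i => lintegral_enorm_sq (memLp_comp hu h i)] at h1
  have h2 := ENNReal.summable_toReal (h1 ▸ h.ne)
  refine h2.congr fun i => ?_
  exact ENNReal.toReal_ofReal (integral_nonneg fun _ => by positivity)

/-- Fourier coefficients of the pairing of two square-integrable vector functions. -/
theorem coef_pairing [Countable ι] (hu : CompMeas u) (h : sqInt u < ∞) (hv : CompMeas v) (h' : sqInt v < ∞)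
    (hH : ∀ i, IsH2 fun l => u l i) (m : ℤ) :
    coef (fun l => ∑' i, conj (u l i) * v l i) m =
      ∑' k : ℕ, ∑' i, conj (coef (fun l => u l i) k) * coef (fun l => v l i) (k + m) := by
  have hmu := memLp_comp hu h
  have hmv := memLp_comp hv h'
  have hint : ∀ i, Integrable (fun l => conj (u l i) * v l i) freqMeasure := fun i =>
    (hmu i).star.integrable_mul (hmv i)
  have hsum : Summable fun i => ∫ l, ‖conj (u l i) * v l i‖ ∂freqMeasure := by
    refine Summable.of_nonneg_of_le (fun i => integral_nonneg fun _ => norm_nonneg _) (fun i => ?_)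
      ((summable_integral_sq hu h).add (summable_integral_sq hv h'))
    have h1 := (hmu i).integrable_norm_pow (p := 2) (by norm_num)
    have h2 := (hmv i).integrable_norm_pow (p := 2) (by norm_num)
    rw [← integral_add h1 h2]
    refine integral_mono (hint i).norm (h1.add h2) fun l => ?_
    simp only [norm_mul, Complex.norm_conj]
    nlinarith [sq_nonneg (‖u l i‖ - ‖v l i‖), sq_nonneg (‖u l i‖), sq_nonneg (‖v l i‖)]
  have h1 : coef (fun l => ∑' i, conj (u l i) * v l i) m =
      ∑' i, coef (fun l => conj (u l i) * v l i) m := by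
    have h2 := hasSum_integral_of_summable_integral_norm
      (F := fun i l => conj (u l i) * v l i * Complex.exp (Complex.I * l * m))
      (μ := freqMeasure) (fun i => integrable_mul_exp (hint i) m) (by
        simpa [norm_mul, norm_exp_I_mul] using hsum)
    unfold coef
    rw [tsum_mul_left, h2.tsum_eq]
    simp_rw [tsum_mul_right]
  have h2 : Summable fun p : ι × ℤ =>
      conj (coef (fun l => u l p.1) p.2) * coef (fun l => v l p.1) (p.2 + m) := by
    refine summable_mul_of_sq' (summable_sq_star (summable_coef_sq hu h)) ?_
    exact (summable_coef_sq hv h').comp_injective (i := fun p : ι × ℤ => (p.1, p.2 + m))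
      (fun p q hpq => by simpa [Prod.ext_iff] using hpq)
  have h4 : ∀ i, coef (fun l => conj (u l i) * v l i) m =
      ∑' k : ℤ, conj (coef (fun l => u l i) k) * coef (fun l => v l i) (k + m) :=
    fun i => (hasSum_coef_conj_mul_shift (hmu i) (hmv i) m).tsum_eq.symm
  rw [h1, tsum_congr h4]
  have h3 : Summable (Function.uncurry fun (k : ℤ) i => conj (coef (fun l => u l i) k) *
      coef (fun l => v l i) (k + m)) :=
    h2.comp_injective (i := fun p : ℤ × ι => (p.2, p.1))
      (fun p q hpq => by simpa [Prod.ext_iff, and_comm] using hpq)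
  rw [Summable.tsum_comm h3]
  -- Analyticity of `u` kills the terms with negative `k`, so the sum over ℤ becomes a sum over ℕ.
  refine (Function.Injective.tsum_eq (g := fun n : ℕ => (n : ℤ)) Nat.cast_injective ?_).symm
  intro k hk
  by_contra hc
  have hk0 : k < 0 := by
    by_contra hk1
    exact hc ⟨k.toNat, Int.toNat_of_nonneg (not_lt.1 hk1)⟩
  apply hk
  simp [fun i => (hH i).2 k hk0]

end Fourier

/-! ### The weight of the increments -/

section Weight

theorem norm_wfun_sq (d τ : ℕ) (l : ℝ) : ‖wfun d τ l‖ ^ 2 = wsq d τ l := by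
  have h1 : ‖(1 : ℂ) - Complex.exp (-(Complex.I * l * τ))‖ =
      ‖(1 : ℂ) - Complex.exp (Complex.I * l * τ)‖ := by
    rw [← Complex.norm_conj]
    congr 1
    rw [map_sub, map_one, ← Complex.exp_conj]
    simp
  rw [wfun, wsq, norm_div, norm_pow, norm_pow, h1, div_pow, ← pow_mul, ← pow_mul, mul_comm d 2]
  congr 1
  rw [norm_mul, Complex.norm_I, one_mul, Complex.norm_real, Real.norm_eq_abs, pow_mul, sq_abs,
    ← pow_mul]

theorem wsq_nonneg (d τ : ℕ) (l : ℝ) : 0 ≤ wsq d τ l := by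
  rw [← norm_wfun_sq]; positivity

theorem ae_wsq_pos (d : ℕ) {τ : ℕ} (hτ : 1 ≤ τ) : ∀ᵐ l ∂freqMeasure, 0 < wsq d τ l := by
  -- The zeros of 1 − e^{iλτ} form a countable set. It contains 0, so the point where the
  -- denominator vanishes is excluded as well.
  have hc : (Set.range fun n : ℤ => 2 * Real.pi * n / τ).Countable := Set.countable_range _
  have h1 : ∀ᵐ l ∂freqMeasure, l ∉ Set.range fun n : ℤ => 2 * Real.pi * n / τ :=
    ae_restrict_of_ae (measure_eq_zero_iff_ae_notMem.1 (hc.measure_zero volume))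
  filter_upwards [h1] with l hl
  have hτ' : (τ : ℝ) ≠ 0 := by positivity
  have hl0 : l ≠ 0 := by
    rintro rfl
    exact hl ⟨0, by simp⟩
  have he : (1 : ℂ) - Complex.exp (Complex.I * l * τ) ≠ 0 := by
    intro h0
    rw [sub_eq_zero, eq_comm, Complex.exp_eq_one_iff] at h0
    obtain ⟨n, hn⟩ := h0
    refine hl ⟨n, ?_⟩
    have h2 : ((l * τ : ℝ) : ℂ) = ((n * (2 * Real.pi) : ℝ) : ℂ) := by
      push_cast
      refine mul_left_cancel₀ Complex.I_ne_zero ?_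
      linear_combination hn
    have h3 : l * τ = n * (2 * Real.pi) := by exact_mod_cast h2
    field_simp
    linarith
  rw [wsq]
  have : 0 < l ^ (2 * d) := by
    rw [pow_mul]; positivity
  positivity

theorem ae_wfun_ne (d : ℕ) {τ : ℕ} (hτ : 1 ≤ τ) : ∀ᵐ l ∂freqMeasure, wfun d τ l ≠ 0 := by
  filter_upwards [ae_wsq_pos d hτ] with l hl h0
  rw [← norm_wfun_sq, h0] at hl
  simp at hl

theorem measurable_wfun (d τ : ℕ) : Measurable (wfun d τ) := by
  unfold wfun; fun_prop

theorem measurable_wsq (d τ : ℕ) : Measurable (wsq d τ) := by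
  unfold wsq; fun_prop

end Weight

/-! ### Canonical factors -/

section Factor

variable {M : ℕ∞} {S : ℝ → Matrix ℕ ℕ ℂ} {Th : ℝ → Matrix ℕ (Idx M) ℂ}

namespace IsCanonicalFactor

theorem meas (H : IsCanonicalFactor S Th) (n : ℕ) (i : Idx M) :
    AEMeasurable (fun l => Th l n i) freqMeasure := (H.analytic n i).1.1.aemeasurable

theorem ae_summable (H : IsCanonicalFactor S Th) :
    ∀ᵐ l ∂freqMeasure, Summable fun p : ℕ × Idx M => ‖Th l p.1 p.2‖ ^ 2 := by
  refine ae_summable_of_sqInt (u := fun l (p : ℕ × Idx M) => Th l p.1 p.2)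
    (fun p => H.meas p.1 p.2) ?_
  unfold sqInt
  simpa only [ENNReal.tsum_prod'] using H.sq

theorem row_sqInt (H : IsCanonicalFactor S Th) (n : ℕ) : sqInt (fun l i => Th l n i) < ∞ := by
  refine lt_of_le_of_lt (lintegral_mono fun l => ?_) H.sq
  exact ENNReal.le_tsum (f := fun n => ∑' i, ‖Th l n i‖ₑ ^ 2) n

theorem col_sqInt (H : IsCanonicalFactor S Th) (i : Idx M) : sqInt (fun l n => Th l n i) < ∞ := by
  refine lt_of_le_of_lt (lintegral_mono fun l => ?_) H.sq
  exact ENNReal.tsum_le_tsum fun n => ENNReal.le_tsum (f := fun i => ‖Th l n i‖ₑ ^ 2) i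

end IsCanonicalFactor

/-- The vector function `Θᵀ u`. -/
def tmul {ι : Type*} (Th : ℝ → Matrix ℕ ι ℂ) (u : ℝ → ℕ → ℂ) (l : ℝ) (i : ι) : ℂ :=
  ∑' n, Th l n i * u l n

theorem tmul_compMeas (H : IsCanonicalFactor S Th) {u : ℝ → ℕ → ℂ} (hu : CompMeas u) :
    CompMeas (tmul Th u) := fun i => AEMeasurable.tsum fun n => (H.meas n i).mul (hu n)

theorem hsOp_toL2 {ι : Type*} (Th : ℝ → Matrix ℕ ι ℂ) (u : ℝ → ℕ → ℂ) (l : ℝ)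
    (hT : Summable fun p : ℕ × ι => ‖Th l p.1 p.2‖ ^ 2) (hu : Summable fun n => ‖u l n‖ ^ 2)
    (i : ι) : hsOp (Th l) hT (toL2 (u l) hu) i = tmul Th u l i := rfl

variable {d τ : ℕ} {f g : ℝ → Matrix ℕ ℕ ℂ} {Om : ℝ → Matrix ℕ (Idx M) ℂ}

theorem ae_pointData (hτ : 1 ≤ τ) (hf : IsSpectralDensity d τ f) (hg : IsSpectralDensity d τ g)
    (hOm : IsCanonicalFactor (weighted d τ g) Om)
    (hTh : IsCanonicalFactor (weighted d τ fun l => f l + g l) Th) :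
    ∀ᵐ l ∂freqMeasure, PointData (wsq d τ l) (f l) (g l) (Th l) (Om l) := by
  filter_upwards [ae_wsq_pos d hτ, hf.pos, hg.pos, hf.kernel, hg.kernel, hTh.ae_summable,
    hOm.ae_summable, hTh.factor, hOm.factor] with l h1 h2 h3 h4 h5 h6 h7 h8 h9
  exact ⟨h1, h2, h3, h4, h5, h6, h7, fun n m => by rw [← h8]; rfl, fun n m => by rw [← h9]; rfl⟩

theorem ofReal_quad_meas {F : ℝ → Matrix ℕ ℕ ℂ} (hF : ∀ k n, AEMeasurable (fun l => F l k n) freqMeasure)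
    {h : ℝ → ℕ → ℂ} (hh : CompMeas h) :
    AEMeasurable (fun l => ENNReal.ofReal (quad (F l) (h l))) freqMeasure := by
  unfold quad
  refine AEMeasurable.ennreal_ofReal (Complex.measurable_re.comp_aemeasurable ?_)
  refine AEMeasurable.tsum fun p => ?_
  exact ((hh p.1).mul (hF p.1 p.2)).mul (Complex.continuous_conj.measurable.comp_aemeasurable (hh p.2))

end Factor

/-! ### The function `B` -/

section Series

/-- The value of an absolutely convergent vector series. -/
def vecSeries (b : ℕ → ℕ → ℂ) (l : ℝ) (k : ℕ) : ℂ :=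
  ∑' j : ℕ, b j k * Complex.exp (-(Complex.I * l * j))

/-- Square-summable coefficient vectors with summable norms. -/
structure SummableCoeffs (b : ℕ → ℕ → ℂ) : Prop where
  sq : ∀ j, Summable fun k => ‖b j k‖ ^ 2
  norms : Summable fun j => Real.sqrt (∑' k, ‖b j k‖ ^ 2)

namespace SummableCoeffs

variable {b : ℕ → ℕ → ℂ}

/-- The coefficient vectors in `ℓ²`. -/
def vec (hb : SummableCoeffs b) (j : ℕ) : L2seq ℕ := toL2 (b j) (hb.sq j)

theorem norm_vec (hb : SummableCoeffs b) (j : ℕ) :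
    ‖hb.vec j‖ = Real.sqrt (∑' k, ‖b j k‖ ^ 2) := by
  have := L2seq.norm_sq (hb.vec j)
  rw [eq_comm, Real.sqrt_eq_iff_mul_self_eq (tsum_nonneg fun _ => by positivity) (norm_nonneg _),
    ← pow_two, this]
  rfl

theorem summable_norm_vec (hb : SummableCoeffs b) : Summable fun j => ‖hb.vec j‖ := by
  simp_rw [hb.norm_vec]; exact hb.norms

theorem norm_smul_vec (hb : SummableCoeffs b) (l : ℝ) (j : ℕ) :
    ‖Complex.exp (-(Complex.I * l * j)) • hb.vec j‖ = ‖hb.vec j‖ := by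
  rw [norm_smul, norm_exp_neg_I_mul, one_mul]

theorem hasSum_vec (hb : SummableCoeffs b) (l : ℝ) :
    HasSum (fun j : ℕ => Complex.exp (-(Complex.I * l * j)) • hb.vec j)
      (∑' j : ℕ, Complex.exp (-(Complex.I * l * j)) • hb.vec j) := by
  refine Summable.hasSum (Summable.of_norm ?_)
  simp_rw [hb.norm_smul_vec]
  exact hb.summable_norm_vec

theorem vecSeries_eq (hb : SummableCoeffs b) (l : ℝ) (k : ℕ) :
    (∑' j : ℕ, Complex.exp (-(Complex.I * l * j)) • hb.vec j : L2seq ℕ) k = vecSeries b l k := by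
  have h := (hb.hasSum_vec l).mapL (lp.evalCLM ℂ (fun _ : ℕ => ℂ) 2 k)
  refine h.tsum_eq.symm.trans ?_
  refine tsum_congr fun j => ?_
  rw [mul_comm (b j k)]; rfl

theorem summable_sq (hb : SummableCoeffs b) (l : ℝ) :
    Summable fun k => ‖vecSeries b l k‖ ^ 2 := by
  have := (∑' j : ℕ, Complex.exp (-(Complex.I * l * j)) • hb.vec j : L2seq ℕ).summable
  simpa only [hb.vecSeries_eq] using this

theorem toL2_eq (hb : SummableCoeffs b) (l : ℝ) :
    toL2 (vecSeries b l) (hb.summable_sq l) =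
      ∑' j : ℕ, Complex.exp (-(Complex.I * l * j)) • hb.vec j := by
  ext k; rw [hb.vecSeries_eq]; rfl

theorem norm_le (hb : SummableCoeffs b) (l : ℝ) :
    ‖toL2 (vecSeries b l) (hb.summable_sq l)‖ ≤ ∑' j, ‖hb.vec j‖ := by
  rw [hb.toL2_eq]
  refine tsum_of_norm_bounded hb.summable_norm_vec.hasSum fun j => (hb.norm_smul_vec l j).le

theorem compMeas : CompMeas (vecSeries b) := fun k => by
  unfold vecSeries
  exact AEMeasurable.tsum fun j => (by fun_prop : Measurable fun l : ℝ =>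
    b j k * Complex.exp (-(Complex.I * l * j))).aemeasurable

end SummableCoeffs

theorem coef_tsum {ι : Type*} [Countable ι] {F : ι → ℝ → ℂ}
    (hF : ∀ i, Integrable (F i) freqMeasure)
    (hs : Summable fun i => ∫ l, ‖F i l‖ ∂freqMeasure) (m : ℤ) :
    coef (fun l => ∑' i, F i l) m = ∑' i, coef (F i) m := by
  have h2 := hasSum_integral_of_summable_integral_norm
    (F := fun i l => F i l * Complex.exp (Complex.I * l * m))
    (μ := freqMeasure) (fun i => integrable_mul_exp (hF i) m) (by
      simpa [norm_mul, norm_exp_I_mul] using hs)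
  unfold coef
  rw [tsum_mul_left, h2.tsum_eq]
  simp_rw [tsum_mul_right]

theorem coef_mul_exp_neg (F : ℝ → ℂ) (m : ℕ) (k : ℤ) :
    coef (fun l => F l * Complex.exp (-(Complex.I * l * m))) k = coef F (k - m) := by
  rw [sub_eq_add_neg, ← coef_mul_exp]
  congr 1; ext l; congr 2; push_cast; ring

variable {M : ℕ∞} {S : ℝ → Matrix ℕ ℕ ℂ} {Th : ℝ → Matrix ℕ (Idx M) ℂ} {b : ℕ → ℕ → ℂ}

/-- Fourier coefficients of `Θᵀ B`. -/
theorem coef_tmul_vecSeries (H : IsCanonicalFactor S Th) (hb : SummableCoeffs b) (i : Idx M)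
    (k : ℤ) : coef (fun l => tmul Th (vecSeries b) l i) k =
      ∑' j : ℕ, ∑' n, b j n * coef (fun l => Th l n i) (k - j) := by
  have hmem := fun n => (H.analytic n i).1
  have hcol : CompMeas fun l n => Th l n i := fun n => H.meas n i
  have h1 : ∀ᵐ l ∂freqMeasure, tmul Th (vecSeries b) l i =
      ∑' j : ℕ, (∑' n, Th l n i * b j n) * Complex.exp (-(Complex.I * l * j)) := by
    filter_upwards [H.ae_summable] with l hl
    rw [← hsOp_toL2 Th (vecSeries b) l hl (hb.summable_sq l), hb.toL2_eq]
    have h := ((hb.hasSum_vec l).mapL (hsOp (Th l) hl)).mapL (lp.evalCLM ℂ (fun _ : Idx M => ℂ) 2 i)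
    refine h.tsum_eq.symm.trans (tsum_congr fun j => ?_)
    rw [map_smul, mul_comm (∑' n, _)]
    rfl
  -- the integrable majorant
  set N : ℝ → ℝ := fun l => Real.sqrt (∑' n, ‖Th l n i‖ ^ 2) with hN
  have hmeas : ∀ j : ℕ, AEMeasurable (fun l => ∑' n, Th l n i * b j n) freqMeasure :=
    fun j => AEMeasurable.tsum fun n => (H.meas n i).mul_const _
  have hNint : Integrable (fun l => 1 + ∑' n, ‖Th l n i‖ ^ 2) freqMeasure := by
    refine (integrable_const _).add ?_
    refine ⟨(AEMeasurable.tsum fun n => ((H.meas n i).norm.pow_const 2)).aestronglyMeasurable, ?_⟩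
    refine lt_of_le_of_lt (le_of_eq ?_) (H.col_sqInt i)
    refine lintegral_congr_ae ?_
    filter_upwards [H.ae_summable] with l hl
    rw [Real.enorm_eq_ofReal (tsum_nonneg fun _ => by positivity),
      ENNReal.ofReal_tsum_of_nonneg (fun _ => by positivity) (summable_col hl i)]
    congr 1; ext n
    rw [ENNReal.ofReal_pow (norm_nonneg _), ofReal_norm]
  have hbd : ∀ j : ℕ, ∀ᵐ l ∂freqMeasure, ‖∑' n, Th l n i * b j n‖ ≤
      ‖hb.vec j‖ * (1 + ∑' n, ‖Th l n i‖ ^ 2) := by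
    intro j
    filter_upwards [H.ae_summable] with l hl
    have h2 := norm_tsum_mul_sq_le (summable_col hl i) (hb.sq j)
    have h3 : ∑' k, ‖b j k‖ ^ 2 = ‖hb.vec j‖ ^ 2 := (L2seq.norm_sq (hb.vec j)).symm
    rw [h3] at h2
    have h4 : 0 ≤ ∑' n, ‖Th l n i‖ ^ 2 := tsum_nonneg fun _ => by positivity
    refine le_of_sq_le_sq (h2.trans ?_) (by positivity)
    nlinarith [sq_nonneg ‖hb.vec j‖, sq_nonneg (∑' n, ‖Th l n i‖ ^ 2),
      mul_nonneg (sq_nonneg ‖hb.vec j‖) h4,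
      mul_nonneg (sq_nonneg ‖hb.vec j‖) (sq_nonneg (∑' n, ‖Th l n i‖ ^ 2))]
  have hint : ∀ j : ℕ, Integrable (fun l => ∑' n, Th l n i * b j n) freqMeasure := fun j =>
    (hNint.const_mul ‖hb.vec j‖).mono' (hmeas j).aestronglyMeasurable (hbd j)
  have hint' : ∀ j : ℕ, Integrable (fun l : ℝ => (∑' n, Th l n i * b j n) *
      Complex.exp (-(Complex.I * l * j))) freqMeasure := fun j => by
    have := integrable_mul_exp (hint j) (-(j : ℤ))
    refine this.congr (Eventually.of_forall fun l => ?_)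
    simp only
    congr 2; push_cast; ring
  rw [coef_congr h1, coef_tsum hint']
  · refine tsum_congr fun j => ?_
    rw [coef_mul_exp_neg, coef_tsum (F := fun n l => Th l n i * b j n)
      (fun n => (integrable_of_memLp_freq (hmem n)).mul_const _)]
    · refine tsum_congr fun n => ?_
      simp_rw [mul_comm (Th _ n i)]
      exact coef_const_mul _ _ _
    · refine Summable.of_nonneg_of_le (fun n => integral_nonneg fun _ => norm_nonneg _) (fun n => ?_)
        ((summable_integral_sq hcol (H.col_sqInt i)).add
          ((hb.sq j).mul_left (freqMeasure.real Set.univ)))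
      have h2 := (hmem n).integrable_norm_pow (p := 2) (by norm_num)
      have h3 : freqMeasure.real Set.univ * ‖b j n‖ ^ 2 = ∫ _, ‖b j n‖ ^ 2 ∂freqMeasure := by
        rw [integral_const, smul_eq_mul]
      rw [h3, ← integral_add h2 (integrable_const _)]
      refine integral_mono ((integrable_of_memLp_freq (hmem n)).mul_const _).norm
        (h2.add (integrable_const _)) fun l => ?_
      simp only [norm_mul]
      nlinarith [sq_nonneg (‖Th l n i‖ - ‖b j n‖), sq_nonneg ‖Th l n i‖, sq_nonneg ‖b j n‖]
  · refine Summable.of_nonneg_of_le (fun n => integral_nonneg fun _ => norm_nonneg _) (fun j => ?_)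
        (hb.summable_norm_vec.mul_right (∫ l, (1 + ∑' n, ‖Th l n i‖ ^ 2) ∂freqMeasure))
    rw [← integral_const_mul]
    refine integral_mono_ae (hint' j).norm (hNint.const_mul _) ?_
    filter_upwards [hbd j] with l hl
    rw [norm_mul, norm_exp_neg_I_mul, mul_one]
    exact hl

end Series

/-! ### Approximation by the past of the process -/

section Approx

/-- Vector polynomials in `e^{-iλ}`. -/
def pvec (q : (ℕ × ℕ) →₀ ℂ) (l : ℝ) (k : ℕ) : ℂ :=
  q.sum fun p z => if p.1 = k then z * Complex.exp (-(Complex.I * l * p.2)) else 0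

theorem poly_eq (d τ : ℕ) (q : (ℕ × ℕ) →₀ ℂ) (l : ℝ) (k : ℕ) :
    poly d τ q l k = wfun d τ l * pvec q l k := by
  rw [poly, pvec, Finsupp.mul_sum]
  refine Finsupp.sum_congr fun p _ => ?_
  split_ifs <;> ring

theorem pvec_eq_zero (q : (ℕ × ℕ) →₀ ℂ) (l : ℝ) {k : ℕ} (hk : k ∉ q.support.image Prod.fst) :
    pvec q l k = 0 := by
  refine Finset.sum_eq_zero fun p hp => if_neg ?_
  rintro rfl
  exact hk (Finset.mem_image_of_mem _ hp)

theorem pvec_summable (q : (ℕ × ℕ) →₀ ℂ) (l : ℝ) : Summable fun k => ‖pvec q l k‖ ^ 2 :=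
  summable_of_ne_finset_zero (s := q.support.image Prod.fst) fun k hk => by
    rw [pvec_eq_zero q l hk]; simp

theorem pvec_compMeas (q : (ℕ × ℕ) →₀ ℂ) : CompMeas (pvec q) := fun k => by
  unfold pvec Finsupp.sum
  refine (Finset.measurable_sum _ fun p _ => ?_).aemeasurable
  beta_reduce
  split_ifs
  · fun_prop
  · exact measurable_const

variable {ι : Type*} {M : ℕ∞} {S : ℝ → Matrix ℕ ℕ ℂ} {Th : ℝ → Matrix ℕ (Idx M) ℂ}

/-- `Θᵀ p` for a vector polynomial `p`. -/
def pTh (Th : ℝ → Matrix ℕ ι ℂ) (q : (ℕ × ℕ) →₀ ℂ) (l : ℝ) (i : ι) : ℂ :=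
  q.sum fun p z => z * Complex.exp (-(Complex.I * l * p.2)) * Th l p.1 i

theorem tmul_pvec (Th : ℝ → Matrix ℕ ι ℂ) (q : (ℕ × ℕ) →₀ ℂ) : tmul Th (pvec q) = pTh Th q := by
  funext l i
  unfold tmul pvec pTh Finsupp.sum
  simp_rw [Finset.mul_sum]
  rw [Summable.tsum_finsetSum]
  · refine Finset.sum_congr rfl fun p _ => ?_
    rw [tsum_eq_single p.1]
    · rw [if_pos rfl]; ring
    · intro n hn; rw [if_neg (Ne.symm hn), mul_zero]
  · intro p _
    refine summable_of_ne_finset_zero (s := {p.1}) fun n hn => ?_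
    rw [if_neg (fun h => hn (by simp [h])), mul_zero]

theorem pTh_add (Th : ℝ → Matrix ℕ ι ℂ) (q r : (ℕ × ℕ) →₀ ℂ) (l : ℝ) (i : ι) :
    pTh Th (q + r) l i = pTh Th q l i + pTh Th r l i :=
  Finsupp.sum_add_index' (fun _ => by simp) (fun _ _ _ => by ring)

theorem pTh_smul (Th : ℝ → Matrix ℕ ι ℂ) (c : ℂ) (q : (ℕ × ℕ) →₀ ℂ) (l : ℝ) (i : ι) :
    pTh Th (c • q) l i = c * pTh Th q l i := by
  unfold pTh
  rw [Finsupp.sum_smul_index' (fun _ => by simp), Finsupp.mul_sum]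
  refine Finsupp.sum_congr fun p _ => ?_
  rw [smul_eq_mul]; ring

theorem pTh_shift (Th : ℝ → Matrix ℕ ι ℂ) (q : (ℕ × ℕ) →₀ ℂ) (m : ℕ) (l : ℝ) (i : ι) :
    pTh Th (q.mapDomain fun p => (p.1, p.2 + m)) l i =
      Complex.exp (-(Complex.I * l * m)) * pTh Th q l i := by
  unfold pTh
  rw [Finsupp.sum_mapDomain_index (fun _ => by simp) (fun _ _ _ => by ring), Finsupp.mul_sum]
  refine Finsupp.sum_congr fun p _ => ?_
  have : Complex.exp (-(Complex.I * l * ((p.2 + m : ℕ) : ℂ))) =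
      Complex.exp (-(Complex.I * l * m)) * Complex.exp (-(Complex.I * l * p.2)) := by
    rw [← Complex.exp_add]; congr 1; push_cast; ring
  rw [this]; ring

theorem pTh_compMeas (H : IsCanonicalFactor S Th) (q : (ℕ × ℕ) →₀ ℂ) : CompMeas (pTh Th q) := by
  rw [← tmul_pvec]
  exact tmul_compMeas H (pvec_compMeas q)

theorem IsH2.add {F G : ℝ → ℂ} (hF : IsH2 F) (hG : IsH2 G) : IsH2 fun l => F l + G l :=
  ⟨hF.1.add hG.1, fun k hk => by
    rw [coef_add (integrable_of_memLp_freq hF.1) (integrable_of_memLp_freq hG.1), hF.2 k hk,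
      hG.2 k hk, add_zero]⟩

theorem IsH2.const_mul {F : ℝ → ℂ} (hF : IsH2 F) (c : ℂ) : IsH2 fun l => c * F l :=
  ⟨hF.1.const_mul c, fun k hk => by rw [coef_const_mul, hF.2 k hk, mul_zero]⟩

theorem IsH2.sub {F G : ℝ → ℂ} (hF : IsH2 F) (hG : IsH2 G) : IsH2 fun l => F l - G l := by
  simpa [sub_eq_add_neg] using hF.add (hG.const_mul (-1))

theorem IsH2.zero : IsH2 fun _ => 0 := ⟨by simp, fun k _ => by simp [coef]⟩

theorem IsH2.sum {α : Type*} (s : Finset α) {F : α → ℝ → ℂ} (hF : ∀ a ∈ s, IsH2 (F a)) :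
    IsH2 fun l => ∑ a ∈ s, F a l := by
  classical
  induction s using Finset.induction_on with
  | empty => simpa using IsH2.zero
  | insert a s ha ih =>
    simp_rw [Finset.sum_insert ha]
    exact (hF a (Finset.mem_insert_self a s)).add (ih fun b hb => hF b (Finset.mem_insert_of_mem hb))

theorem IsH2.mul_exp {F : ℝ → ℂ} (hF : IsH2 F) (m : ℕ) :
    IsH2 fun l : ℝ => F l * Complex.exp (-(Complex.I * l * m)) := by
  refine ⟨?_, fun k hk => ?_⟩
  · have := memLp_mul_exp hF.1 (-(m : ℤ))
    convert this using 3 with l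
    push_cast; ring_nf
  · rw [coef_mul_exp_neg, hF.2 _ (by omega)]

theorem IsH2.congr {F G : ℝ → ℂ} (hF : IsH2 F) (h : F =ᵐ[freqMeasure] G) : IsH2 G :=
  ⟨hF.1.ae_eq h, fun k hk => by rw [← coef_congr h, hF.2 k hk]⟩

theorem pTh_isH2 (H : IsCanonicalFactor S Th) (q : (ℕ × ℕ) →₀ ℂ) (i : Idx M) :
    IsH2 fun l => pTh Th q l i := by
  unfold pTh Finsupp.sum
  refine IsH2.sum _ fun p _ => ?_
  have := ((H.analytic p.1 i).mul_exp p.2).const_mul (q p)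
  convert this using 2
  ring

theorem sqInt_const_mul (c : ℂ) (u : ℝ → ι → ℂ) :
    sqInt (fun l i => c * u l i) = ‖c‖ₑ ^ 2 * sqInt u := by
  unfold sqInt
  rw [← lintegral_const_mul' _ _ (by simp)]
  congr 1; ext l
  rw [← ENNReal.tsum_mul_left]
  simp_rw [enorm_mul, mul_pow]

theorem sqInt_exp_mul (m : ℕ) (u : ℝ → ι → ℂ) :
    sqInt (fun l i => Complex.exp (-(Complex.I * l * m)) * u l i) = sqInt u := by
  unfold sqInt
  simp_rw [enorm_mul, mul_pow, ← ofReal_norm (Complex.exp _), norm_exp_neg_I_mul]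
  simp

theorem sqInt_zero : sqInt (fun _ (_ : ι) => 0) = 0 := by simp [sqInt]

theorem sqInt_pTh_lt (H : IsCanonicalFactor S Th) (q : (ℕ × ℕ) →₀ ℂ) : sqInt (pTh Th q) < ∞ := by
  classical
  have hm := pTh_compMeas H
  induction q using Finsupp.induction_linear with
  | zero => unfold pTh; simp [sqInt_zero]
  | add q r hq hr =>
    have : pTh Th (q + r) = fun l i => pTh Th q l i + pTh Th r l i := by
      funext l i; exact pTh_add Th q r l i
    rw [this]
    refine (sqInt_add_le (hm q)).trans_lt ?_
    exact ENNReal.add_lt_top.2 ⟨ENNReal.mul_lt_top (by norm_num) hq, ENNReal.mul_lt_top (by norm_num) hr⟩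
  | single p z =>
    have : pTh Th (Finsupp.single p z) = fun (l : ℝ) i =>
        z * (Complex.exp (-(Complex.I * l * p.2)) * Th l p.1 i) := by
      funext l i; unfold pTh; rw [Finsupp.sum_single_index (by simp)]; ring
    rw [this, sqInt_const_mul, sqInt_exp_mul p.2 (fun l i => Th l p.1 i)]
    exact ENNReal.mul_lt_top (by simp) (H.row_sqInt p.1)

/-- The closure of the functions `Θᵀ p`, `p` a vector polynomial. -/
def Approx (Th : ℝ → Matrix ℕ ι ℂ) (y : ℝ → ι → ℂ) : Prop :=
  ∀ ε : ℝ≥0∞, 0 < ε → ∃ q : (ℕ × ℕ) →₀ ℂ, sqInt (fun l i => y l i - pTh Th q l i) < ε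

namespace Approx

variable {y y' : ℝ → Idx M → ℂ}

theorem congr {y y' : ℝ → ι → ℂ} {Th : ℝ → Matrix ℕ ι ℂ} (hy : Approx Th y)
    (h : ∀ᵐ l ∂freqMeasure, ∀ i, y l i = y' l i) : Approx Th y' := by
  intro ε hε
  obtain ⟨q, hq⟩ := hy ε hε
  refine ⟨q, lt_of_le_of_lt (le_of_eq (sqInt_congr ?_)) hq⟩
  filter_upwards [h] with l hl i
  rw [hl]

theorem of_limit (hm : CompMeas y) (h : ∀ ε : ℝ≥0∞, 0 < ε → ∃ y', CompMeas y' ∧ Approx Th y' ∧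
    sqInt (fun l i => y l i - y' l i) < ε) : Approx Th y := by
  intro ε hε
  -- A quarter, because the squared norm of a sum is only bounded by twice the sum of the squared
  -- norms.
  have h4 : (0 : ℝ≥0∞) < ε / 4 := ENNReal.div_pos hε.ne' (by norm_num)
  obtain ⟨y', hm', hy', h1⟩ := h _ h4
  obtain ⟨q, hq⟩ := hy' _ h4
  refine ⟨q, ?_⟩
  have h2 := sqInt_add_le (u := fun l i => y l i - y' l i)
    (v := fun l i => y' l i - pTh Th q l i) (hm.sub hm')
  simp only [sub_add_sub_cancel] at h2
  refine h2.trans_lt ?_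
  calc 2 * sqInt (fun l i => y l i - y' l i) + 2 * sqInt (fun l i => y' l i - pTh Th q l i)
      < 2 * (ε / 4) + 2 * (ε / 4) := by
        refine ENNReal.add_lt_add ?_ ?_ <;>
          exact (ENNReal.mul_lt_mul_iff_right (by norm_num) (by norm_num)).2 (by assumption)
    _ = ε := by
        rw [← two_mul, ← mul_assoc]; norm_num
        exact ENNReal.mul_div_cancel (by norm_num) (by norm_num)

theorem add (H : IsCanonicalFactor S Th) (hm : CompMeas y) (hy : Approx Th y)
    (hy' : Approx Th y') : Approx Th fun l i => y l i + y' l i := by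
  intro ε hε
  have h4 : (0 : ℝ≥0∞) < ε / 4 := ENNReal.div_pos hε.ne' (by norm_num)
  obtain ⟨q, hq⟩ := hy _ h4
  obtain ⟨r, hr⟩ := hy' _ h4
  refine ⟨q + r, ?_⟩
  have h2 := sqInt_add_le (u := fun l i => y l i - pTh Th q l i)
    (v := fun l i => y' l i - pTh Th r l i) (hm.sub (pTh_compMeas H q))
  have h3 : (fun l i => y l i + y' l i - pTh Th (q + r) l i) =
      fun l i => (y l i - pTh Th q l i) + (y' l i - pTh Th r l i) := by
    funext l i; rw [pTh_add]; ring
  rw [h3]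
  refine h2.trans_lt ?_
  calc 2 * sqInt (fun l i => y l i - pTh Th q l i) + 2 * sqInt (fun l i => y' l i - pTh Th r l i)
      < 2 * (ε / 4) + 2 * (ε / 4) := by
        refine ENNReal.add_lt_add ?_ ?_ <;>
          exact (ENNReal.mul_lt_mul_iff_right (by norm_num) (by norm_num)).2 (by assumption)
    _ = ε := by
        rw [← two_mul, ← mul_assoc]; norm_num
        exact ENNReal.mul_div_cancel (by norm_num) (by norm_num)

theorem const_mul {y : ℝ → ι → ℂ} {Th : ℝ → Matrix ℕ ι ℂ} (hy : Approx Th y) (c : ℂ) :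
    Approx Th fun l i => c * y l i := by
  intro ε hε
  -- The added 1 keeps the divisor nonzero when `c = 0`.
  obtain ⟨q, hq⟩ := hy (ε / (‖c‖ₑ ^ 2 + 1)) (ENNReal.div_pos hε.ne' (by simp))
  refine ⟨c • q, ?_⟩
  have h3 : (fun l i => c * y l i - pTh Th (c • q) l i) =
      fun l i => c * (y l i - pTh Th q l i) := by
    funext l i; rw [pTh_smul]; ring
  rw [h3, sqInt_const_mul]
  by_cases hc : c = 0
  · simpa [hc] using hε
  rw [ENNReal.lt_div_iff_mul_lt (by simp) (by simp)] at hq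
  refine lt_of_le_of_lt ?_ hq
  rw [mul_comm]
  gcongr
  exact le_self_add

theorem exp_mul {y : ℝ → ι → ℂ} {Th : ℝ → Matrix ℕ ι ℂ} (hy : Approx Th y) (m : ℕ) :
    Approx Th fun l i => Complex.exp (-(Complex.I * l * m)) * y l i := by
  intro ε hε
  obtain ⟨q, hq⟩ := hy ε hε
  refine ⟨q.mapDomain fun p => (p.1, p.2 + m), ?_⟩
  simp_rw [pTh_shift, ← mul_sub]
  rw [sqInt_exp_mul m (fun l i => y l i - pTh Th q l i)]
  exact hq

theorem zero {Th : ℝ → Matrix ℕ ι ℂ} : Approx Th fun _ _ => 0 := fun ε hε =>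
  ⟨0, by simpa [pTh, sqInt_zero] using hε⟩

theorem sum (H : IsCanonicalFactor S Th) {α : Type*} (s : Finset α) {y : α → ℝ → Idx M → ℂ}
    (hm : ∀ a ∈ s, CompMeas (y a)) (hy : ∀ a ∈ s, Approx Th (y a)) :
    Approx Th fun l i => ∑ a ∈ s, y a l i := by
  classical
  induction s using Finset.induction_on with
  | empty => simpa using Approx.zero
  | insert a s ha ih =>
    simp_rw [Finset.sum_insert ha]
    exact add H (hm a (Finset.mem_insert_self a s)) (hy a (Finset.mem_insert_self a s))
      (ih (fun b hb => hm b (Finset.mem_insert_of_mem hb))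
        fun b hb => hy b (Finset.mem_insert_of_mem hb))

theorem sqInt_lt (H : IsCanonicalFactor S Th) (hm : CompMeas y) (hy : Approx Th y) :
    sqInt y < ∞ := by
  obtain ⟨q, hq⟩ := hy 1 (by norm_num)
  have h2 := sqInt_add_le (u := fun l i => y l i - pTh Th q l i) (v := pTh Th q)
    (hm.sub (pTh_compMeas H q))
  simp only [sub_add_cancel] at h2
  refine h2.trans_lt (ENNReal.add_lt_top.2 ⟨ENNReal.mul_lt_top (by norm_num) (hq.trans (by simp)),
    ENNReal.mul_lt_top (by norm_num) (sqInt_pTh_lt H q)⟩)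

/-- Coefficients of negative index vanish for Θᵀp, because Θ and p contain only nonnegative powers
of e^{-iλ}, and each coefficient is continuous in mean square. -/
theorem isH2 (H : IsCanonicalFactor S Th) (hm : CompMeas y) (hy : Approx Th y) (i : Idx M) :
    IsH2 fun l => y l i := by
  have hlt := hy.sqInt_lt H hm
  refine ⟨memLp_comp hm hlt i, fun k hk => ?_⟩
  have key : ∀ ε : ℝ≥0∞, 0 < ε →
      ‖coef (fun l => y l i) k‖ₑ ^ 2 ≤ ENNReal.ofReal (1 / (2 * Real.pi)) * ε := by
    intro ε hε
    -- The cap 1 makes the difference square integrable even for `ε = ∞`, as Parseval's identity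
    -- requires.
    obtain ⟨q, hq⟩ := hy (min ε 1) (by simpa using hε)
    have h1 := pTh_isH2 H q i
    have h2 : coef (fun l => y l i) k = coef (fun l => y l i - pTh Th q l i) k := by
      rw [coef_sub (integrable_of_memLp_freq (memLp_comp hm hlt i)) (integrable_of_memLp_freq h1.1),
        h1.2 k hk, sub_zero]
    have h3 := sqInt_parseval (hm.sub (pTh_compMeas H q))
      (hq.trans (lt_of_le_of_lt (min_le_right _ _) (by simp)))
    rw [h2]
    calc ‖coef (fun l => y l i - pTh Th q l i) k‖ₑ ^ 2
        ≤ ∑' k : ℤ, ‖coef (fun l => y l i - pTh Th q l i) k‖ₑ ^ 2 :=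
          ENNReal.le_tsum (f := fun k => ‖coef (fun l => y l i - pTh Th q l i) k‖ₑ ^ 2) k
      _ ≤ _ := ENNReal.le_tsum
          (f := fun i => ∑' k : ℤ, ‖coef (fun l => y l i - pTh Th q l i) k‖ₑ ^ 2) i
      _ ≤ _ := by
        rw [← h3]
        gcongr
        exact hq.le.trans (min_le_left _ _)
  have h0 : ‖coef (fun l => y l i) k‖ₑ ^ 2 = 0 := by
    by_contra hne
    set X := ‖coef (fun l => y l i) k‖ₑ ^ 2
    have hpi : ENNReal.ofReal (1 / (2 * Real.pi)) ≤ 1 := by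
      rw [ENNReal.ofReal_le_one, div_le_one (by positivity)]
      nlinarith [Real.pi_gt_three]
    have hX : X ≠ ∞ := by simp [X]
    -- A nonzero X would satisfy X ≤ X/2, because 1/(2π) ≤ 1.
    have h1 := key (X / 2) (ENNReal.half_pos hne)
    have h2 : X ≤ X / 2 := h1.trans ((mul_le_mul_left hpi _).trans (by simp))
    exact absurd h2 (not_le.2 (ENNReal.half_lt_self hne hX))
  simpa using h0

theorem unit (H : IsCanonicalFactor S Th) (i₀ : Idx M) :
    Approx Th fun _ i => if i = i₀ then 1 else 0 := by
  intro ε hε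
  obtain ⟨q, hq⟩ := H.innovation i₀ ε hε
  refine ⟨q, ?_⟩
  rw [sqInt_sub_comm]
  exact hq

end Approx

/-- Trigonometric vector polynomials. -/
def trigvec [DecidableEq ι] (s : Finset (ι × ℕ)) (a : ι → ℕ → ℂ) (l : ℝ) (i : ι) : ℂ :=
  ∑ p ∈ s, a p.1 p.2 * (Complex.exp (-(Complex.I * l * p.2)) * if i = p.1 then 1 else 0)

/-- Here canonicity enters: the unit vectors are limits of functions Θᵀp, and multiplication by
e^{-iλm} with m ≥ 0 keeps the set of limits invariant. -/
theorem approx_trigvec (H : IsCanonicalFactor S Th) (s : Finset (Idx M × ℕ)) (a : Idx M → ℕ → ℂ) :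
    Approx Th (trigvec s a) := by
  refine Approx.sum H s (y := fun p l i => a p.1 p.2 * (Complex.exp (-(Complex.I * l * p.2)) *
    if i = p.1 then 1 else 0)) (fun p _ i => ?_) fun p _ =>
    ((Approx.unit H p.1).exp_mul p.2).const_mul _
  exact (by fun_prop : Measurable _).aemeasurable

theorem coef_one (k : ℤ) : coef (fun _ => 1) k = if k = 0 then 1 else 0 := by
  have hpi : (Real.pi : ℂ) ≠ 0 := by exact_mod_cast Real.pi_ne_zero
  unfold coef freqMeasure
  rw [← intervalIntegral.integral_of_le (by linarith [Real.pi_pos])]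
  split_ifs with h
  · subst h
    simp
    field_simp
    norm_num
  · have hk : Complex.I * (k : ℂ) ≠ 0 := by simp [h]
    have h1 : ∀ l : ℝ, (1 : ℂ) * Complex.exp (Complex.I * l * k) =
        Complex.exp (Complex.I * k * l) := fun l => by rw [one_mul]; congr 1; ring
    simp_rw [h1]
    rw [integral_exp_mul_complex hk]
    have h2 : Complex.exp (Complex.I * k * (Real.pi : ℝ)) =
        Complex.exp (Complex.I * k * ((-Real.pi : ℝ) : ℂ)) := by
      rw [Complex.exp_eq_exp_iff_exists_int]
      refine ⟨k, ?_⟩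
      push_cast; ring
    rw [h2]; simp

theorem trigvec_compMeas [DecidableEq ι] (s : Finset (ι × ℕ)) (a : ι → ℕ → ℂ) :
    CompMeas (trigvec s a) := fun i => by
  unfold trigvec
  exact (by fun_prop : Measurable _).aemeasurable

theorem coef_trigvec [DecidableEq ι] (s : Finset (ι × ℕ)) (a : ι → ℕ → ℂ) (i : ι) (k : ℤ) :
    coef (fun l => trigvec s a l i) k =
      ∑ p ∈ s, if i = p.1 ∧ k = p.2 then a p.1 p.2 else 0 := by
  classical
  unfold trigvec
  have hint : ∀ p : ι × ℕ, Integrable (fun l : ℝ => a p.1 p.2 *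
      (Complex.exp (-(Complex.I * l * p.2)) * if i = p.1 then 1 else 0)) freqMeasure := fun p => by
    refine Integrable.const_mul (Integrable.mul_const ?_ _) _
    have := integrable_mul_exp (integrable_const (μ := freqMeasure) (1 : ℂ)) (-(p.2 : ℤ))
    refine this.congr (Eventually.of_forall fun l => ?_)
    simp only [one_mul]; congr 1; push_cast; ring
  induction s using Finset.induction_on with
  | empty => simp [coef]
  | insert p s hp ih =>
    simp_rw [Finset.sum_insert hp]
    rw [coef_add (hint p) (integrable_finsetSum _ fun p _ => hint p), ih]
    congr 1
    rw [coef_const_mul]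
    have h1 := coef_mul_exp_neg (fun _ => (1 : ℂ)) p.2 k
    rw [coef_one] at h1
    by_cases hi : i = p.1
    · simp only [one_mul] at h1
      simp only [hi, if_true, mul_one, true_and, h1, sub_eq_zero]
      simp
    · simp [hi, coef]

end Approx

/-! ### Hardy-space functions as limits of functions of the past -/

section H2Approx

theorem tsum_enorm_sq {κ : Type*} {x : κ → ℂ} (hx : Summable fun i => ‖x i‖ ^ 2) :
    ∑' i, ‖x i‖ₑ ^ 2 = ENNReal.ofReal (∑' i, ‖x i‖ ^ 2) := by
  rw [ENNReal.ofReal_tsum_of_nonneg (fun _ => by positivity) hx]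
  refine tsum_congr fun i => ?_
  rw [ENNReal.ofReal_pow (norm_nonneg _), ofReal_norm]

variable {ι : Type*} {M : ℕ∞} {S : ℝ → Matrix ℕ ℕ ℂ} {Th : ℝ → Matrix ℕ (Idx M) ℂ}

theorem isH2_exp (m : ℕ) : IsH2 fun l : ℝ => Complex.exp (-(Complex.I * l * m)) := by
  have h1 : IsH2 fun _ => (1 : ℂ) :=
    ⟨memLp_const 1, fun k hk => by rw [coef_one, if_neg hk.ne]⟩
  simpa using h1.mul_exp m

theorem trigvec_isH2 [DecidableEq ι] (s : Finset (ι × ℕ)) (a : ι → ℕ → ℂ) (i : ι) :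
    IsH2 fun l => trigvec s a l i := by
  unfold trigvec
  refine IsH2.sum s fun p _ => ?_
  have := ((isH2_exp p.2).const_mul (if i = p.1 then 1 else 0)).const_mul (a p.1 p.2)
  convert this using 3
  ring

theorem coef_trigvec_nat [DecidableEq ι] (s : Finset (ι × ℕ)) (a : ι → ℕ → ℂ) (i : ι) (m : ℕ) :
    coef (fun l => trigvec s a l i) (m : ℤ) = if (i, m) ∈ s then a i m else 0 := by
  rw [coef_trigvec]
  have : ∀ p : ι × ℕ, (if i = p.1 ∧ (m : ℤ) = p.2 then a p.1 p.2 else 0) =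
      if (i, m) = p then a p.1 p.2 else 0 := by
    intro p
    simp [Prod.ext_iff]
  simp_rw [this]
  rw [Finset.sum_ite_eq]

theorem sqInt_trigvec_lt [Countable ι] [DecidableEq ι] (s : Finset (ι × ℕ)) (a : ι → ℕ → ℂ) :
    sqInt (trigvec s a) < ∞ := by
  classical
  have hm : ∀ s : Finset (ι × ℕ), CompMeas (trigvec s a) := fun s => trigvec_compMeas s a
  induction s using Finset.induction_on with
  | empty => unfold trigvec; simp [sqInt]
  | insert p s hp ih =>
    have h1 : trigvec (insert p s) a = fun l i => trigvec s a l i + trigvec {p} a l i := by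
      funext l i
      simp only [trigvec]
      rw [Finset.sum_insert hp, add_comm]; simp
    rw [h1]
    refine (sqInt_add_le (hm s)).trans_lt (ENNReal.add_lt_top.2
      ⟨ENNReal.mul_lt_top (by norm_num) ih, ENNReal.mul_lt_top (by norm_num) ?_⟩)
    have h2 : trigvec {p} a = fun (l : ℝ) i => a p.1 p.2 * (Complex.exp (-(Complex.I * l * p.2)) *
        if i = p.1 then 1 else 0) := by
      funext l i; simp [trigvec]
    rw [h2, sqInt_const_mul, sqInt_exp_mul p.2 fun _ i => if i = p.1 then 1 else 0]
    refine ENNReal.mul_lt_top (by simp) ?_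
    unfold sqInt
    have h3 : ∑' i, ‖(if i = p.1 then 1 else 0 : ℂ)‖ₑ ^ 2 = 1 := by
      rw [tsum_eq_single p.1]
      · simp
      · intro i hi; simp [hi]
    simp only [h3]
    simp

/-- Splitting Parseval's identity into nonnegative and negative indices. -/
theorem parseval_split [Countable ι] {u : ℝ → ι → ℂ} (hu : CompMeas u) (h : sqInt u < ∞) :
    ENNReal.ofReal (1 / (2 * Real.pi)) * sqInt u =
      ∑' i, ∑' m : ℕ, ‖coef (fun l => u l i) (m : ℤ)‖ₑ ^ 2 +
      ∑' i, ∑' m : ℕ, ‖coef (fun l => u l i) (-((m : ℤ) + 1))‖ₑ ^ 2 := by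
  rw [sqInt_parseval hu h, ← ENNReal.tsum_add]
  refine tsum_congr fun i => ?_
  exact tsum_of_nat_of_neg_add_one (f := fun k : ℤ => ‖coef (fun l => u l i) k‖ₑ ^ 2)
    ENNReal.summable ENNReal.summable

theorem exists_finset_tail [DecidableEq ι] (a : ι → ℕ → ℂ) (ha : ∑' i, ∑' m, ‖a i m‖ₑ ^ 2 < ∞)
    {ε : ℝ≥0∞} (hε : 0 < ε) : ∃ s : Finset (ι × ℕ),
      ∑' i, ∑' m, ‖(if (i, m) ∈ s then a i m else 0) - a i m‖ₑ ^ 2 < ε := by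
  rw [← ENNReal.tsum_prod (f := fun i m => ‖a i m‖ₑ ^ 2)] at ha
  have h1 := ENNReal.tendsto_tsum_compl_atTop_zero ha.ne
  obtain ⟨s, hs⟩ := (h1.eventually (gt_mem_nhds hε)).exists
  refine ⟨s, lt_of_le_of_lt (le_of_eq ?_) hs⟩
  rw [← ENNReal.tsum_prod (f := fun i m => ‖(if (i, m) ∈ s then a i m else 0) - a i m‖ₑ ^ 2),
    show ∑' b : {x // x ∉ s}, ‖a b.1.1 b.1.2‖ₑ ^ 2 = _ from
      tsum_subtype {p : ι × ℕ | p ∉ s} (fun p => ‖a p.1 p.2‖ₑ ^ 2)]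
  refine tsum_congr fun p => ?_
  by_cases hp : p ∈ s
  · simp [hp]
  · simp [hp, Set.indicator]

/-- The converse of `Approx.isH2`. Truncating the coefficients to a finite set gives a trigonometric
polynomial, which is a limit by canonicity; the difference is small by Parseval, since neither
function has coefficients of negative index. -/
theorem approx_of_isH2 (H : IsCanonicalFactor S Th) {y : ℝ → Idx M → ℂ} (hm : CompMeas y)
    (hlt : sqInt y < ∞) (hy : ∀ i, IsH2 fun l => y l i) : Approx Th y := by
  refine Approx.of_limit hm fun ε hε => ?_
  set c0 := ENNReal.ofReal (1 / (2 * Real.pi)) with hc0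
  have hc0p : 0 < c0 := by rw [hc0]; simp [Real.pi_pos]
  have hfin : ∑' i, ∑' m : ℕ, ‖coef (fun l => y l i) (m : ℤ)‖ₑ ^ 2 < ∞ := by
    refine lt_of_le_of_lt le_self_add ((parseval_split hm hlt).symm.trans_lt ?_)
    exact ENNReal.mul_lt_top (by simp) hlt
  obtain ⟨s, hs⟩ := exists_finset_tail (fun i (m : ℕ) => coef (fun l => y l i) (m : ℤ)) hfin
    (ε := c0 * ε) (ENNReal.mul_pos hc0p.ne' hε.ne')
  set t := trigvec s (fun i (m : ℕ) => coef (fun l => y l i) (m : ℤ)) with ht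
  have htm : CompMeas t := trigvec_compMeas _ _
  have htl : sqInt t < ∞ := sqInt_trigvec_lt _ _
  have htH : ∀ i, IsH2 fun l => t l i := trigvec_isH2 _ _
  refine ⟨t, htm, approx_trigvec H _ _, ?_⟩
  rw [sqInt_sub_comm]
  have hdl : sqInt (fun l i => t l i - y l i) < ∞ := (sqInt_sub_le htm).trans_lt
    (ENNReal.add_lt_top.2 ⟨ENNReal.mul_lt_top (by norm_num) htl,
      ENNReal.mul_lt_top (by norm_num) hlt⟩)
  have h1 := parseval_split (htm.sub hm) hdl
  have h2 : ∀ i k, coef (fun l => t l i - y l i) k =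
      coef (fun l => t l i) k - coef (fun l => y l i) k := fun i k =>
    coef_sub (integrable_of_memLp_freq (htH i).1) (integrable_of_memLp_freq (hy i).1) k
  simp_rw [h2] at h1
  have h3 : ∀ i (m : ℕ), coef (fun l => t l i) (-((m : ℤ) + 1)) -
      coef (fun l => y l i) (-((m : ℤ) + 1)) = 0 := fun i m => by
    rw [(htH i).2 _ (by omega), (hy i).2 _ (by omega), sub_zero]
  simp_rw [h3, ht, coef_trigvec_nat] at h1
  simp only [enorm_zero, ne_eq, OfNat.ofNat_ne_zero, not_false_eq_true, zero_pow, tsum_zero,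
    add_zero] at h1
  rw [← h1] at hs
  exact (ENNReal.mul_lt_mul_iff_right hc0p.ne' (by simp [hc0])).1 hs

/-- The absolutely convergent series is bounded in ℓ² uniformly in the frequency, and Θ has
integrable Hilbert–Schmidt norm squared. -/
theorem sqInt_tmul_vecSeries_lt (H : IsCanonicalFactor S Th) {b : ℕ → ℕ → ℂ}
    (hb : SummableCoeffs b) : sqInt (tmul Th (vecSeries b)) < ∞ := by
  set C := ∑' j, ‖hb.vec j‖ with hC
  have h1 : sqInt (tmul Th (vecSeries b)) ≤
      ENNReal.ofReal (C ^ 2) * ∫⁻ l, ∑' n, ∑' i, ‖Th l n i‖ₑ ^ 2 ∂freqMeasure := by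
    unfold sqInt
    rw [← lintegral_const_mul' _ _ (by simp)]
    refine lintegral_mono_ae ?_
    filter_upwards [H.ae_summable] with l hl
    rw [ENNReal.tsum_comm, ← ENNReal.tsum_mul_left]
    refine ENNReal.tsum_le_tsum fun i => ?_
    have h2 := norm_tsum_mul_sq_le (summable_col hl i) (hb.summable_sq l)
    have h3 : ∑' k, ‖vecSeries b l k‖ ^ 2 ≤ C ^ 2 := by
      have := L2seq.norm_sq (toL2 _ (hb.summable_sq l))
      simp only [toL2_apply] at this
      rw [← this]
      have := hb.norm_le l
      gcongr
    rw [tsum_enorm_sq (summable_col hl i), ← ENNReal.ofReal_mul (by positivity), ← ofReal_norm,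
      ← ENNReal.ofReal_pow (norm_nonneg _)]
    refine ENNReal.ofReal_le_ofReal (h2.trans ?_)
    rw [mul_comm]
    have : 0 ≤ ∑' n, ‖Th l n i‖ ^ 2 := tsum_nonneg fun _ => by positivity
    gcongr
  exact h1.trans_lt (ENNReal.mul_lt_top (by simp) H.sq)

theorem tmul_vecSeries_isH2 (H : IsCanonicalFactor S Th) {b : ℕ → ℕ → ℂ}
    (hb : SummableCoeffs b) (i : Idx M) : IsH2 fun l => tmul Th (vecSeries b) l i := by
  refine ⟨memLp_comp (tmul_compMeas H SummableCoeffs.compMeas) (sqInt_tmul_vecSeries_lt H hb) i,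
    fun k hk => ?_⟩
  rw [coef_tmul_vecSeries H hb]
  have : ∀ (j n : ℕ), coef (fun l => Th l n i) (k - j) = 0 := fun j n =>
    (H.analytic n i).2 _ (by omega)
  simp [this]

/-- The terms with `j > k` involve coefficients of negative index of an analytic factor, so the
convolution stops at `j = k`. -/
theorem coef_tmul_eq_omegaB (d τ : ℕ) (T : ℝ) (a : ℝ → ℂ) (H : IsCanonicalFactor S Th)
    (hb : SummableCoeffs (bvec d τ T a)) (i : Idx M) (k : ℕ) :
    coef (fun l => tmul Th (vecSeries (bvec d τ T a)) l i) (k : ℤ) = omegaB d τ T a Th k i := by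
  rw [coef_tmul_vecSeries H hb, omegaB, tsum_eq_sum (s := Finset.range (k + 1))]
  · refine Finset.sum_congr rfl fun j hj => tsum_congr fun n => ?_
    have : ((k - j : ℕ) : ℤ) = (k : ℤ) - j := by
      have := Finset.mem_range.1 hj
      omega
    rw [mul_comm, this]
  · intro j hj
    have hj' : (k : ℤ) - j < 0 := by
      have := Finset.mem_range.not.1 hj
      omega
    simp [fun n => (H.analytic n i).2 _ hj']

end H2Approx

/-! ### The mean-square error in terms of the factorization -/

/-- The data of the estimation problem for one signal density. -/
structure Ctx (d τ : ℕ) (T : ℝ) (a : ℝ → ℂ) {M : ℕ∞} (f g : ℝ → Matrix ℕ ℕ ℂ)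
    (Om Th : ℝ → Matrix ℕ (Idx M) ℂ) (Ps : ℝ → Matrix (Idx M) ℕ ℂ) : Prop where
  hτ : 1 ≤ τ
  hb : SummableCoeffs (bvec d τ T a)
  hf : IsSpectralDensity d τ f
  hg : IsSpectralDensity d τ g
  hOm : IsCanonicalFactor (weighted d τ g) Om
  hreg : NoiseRegular d τ T a g
  hpair : IsFactorPair (weighted d τ fun l => f l + g l) Th Ps

/-- `|w|² g B̄`. -/
def qfun (d τ : ℕ) (T : ℝ) (a : ℝ → ℂ) (g : ℝ → Matrix ℕ ℕ ℂ) (l : ℝ) (n : ℕ) : ℂ :=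
  (wsq d τ l : ℂ) * ∑' m, g l n m * conj (Bfun d τ T a l m)

/-- The conjugate of `Ψ |w|² g B̄`. -/
def zbar (d τ : ℕ) (T : ℝ) (a : ℝ → ℂ) {M : ℕ∞} (g : ℝ → Matrix ℕ ℕ ℂ)
    (Ps : ℝ → Matrix (Idx M) ℕ ℂ) (l : ℝ) (i : Idx M) : ℂ :=
  conj (∑' n, Ps l i n * qfun d τ T a g l n)

/-- The part of the error that does not depend on the estimate, at a frequency. -/
def kappa (d τ : ℕ) (T : ℝ) (a : ℝ → ℂ) {M : ℕ∞} (g : ℝ → Matrix ℕ ℕ ℂ)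
    (Om : ℝ → Matrix ℕ (Idx M) ℂ) (Ps : ℝ → Matrix (Idx M) ℕ ℂ) (l : ℝ) : ℝ :=
  ∑' i, ‖tmul Om (Bfun d τ T a) l i‖ ^ 2 - ∑' i, ‖zbar d τ T a g Ps l i‖ ^ 2

/-- The least mean-square error. -/
def rho (d τ : ℕ) (T : ℝ) (a : ℝ → ℂ) {M : ℕ∞} (g : ℝ → Matrix ℕ ℕ ℂ)
    (Om : ℝ → Matrix ℕ (Idx M) ℂ) (Ps : ℝ → Matrix (Idx M) ℕ ℂ) : ℝ≥0∞ :=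
  ∑' i, ∑' m : ℕ, ‖coef (fun l => zbar d τ T a g Ps l i) (-((m : ℤ) + 1))‖ₑ ^ 2 +
    ENNReal.ofReal (1 / (2 * Real.pi)) *
      ∫⁻ l, ENNReal.ofReal (kappa d τ T a g Om Ps l) ∂freqMeasure

namespace Ctx

variable {d τ : ℕ} {T : ℝ} {a : ℝ → ℂ} {M : ℕ∞} {f g : ℝ → Matrix ℕ ℕ ℂ}
    {Om Th : ℝ → Matrix ℕ (Idx M) ℂ} {Ps : ℝ → Matrix (Idx M) ℕ ℂ}

theorem hTh (C : Ctx d τ T a f g Om Th Ps) :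
    IsCanonicalFactor (weighted d τ fun l => f l + g l) Th := C.hpair.canonical

theorem sqB (C : Ctx d τ T a f g Om Th Ps) (l : ℝ) : Summable fun k => ‖Bfun d τ T a l k‖ ^ 2 :=
  C.hb.summable_sq l

theorem measB : CompMeas (Bfun d τ T a) := SummableCoeffs.compMeas (b := bvec d τ T a)

theorem ae_data (C : Ctx d τ T a f g Om Th Ps) :
    ∀ᵐ l ∂freqMeasure, PointData (wsq d τ l) (f l) (g l) (Th l) (Om l) :=
  ae_pointData C.hτ C.hf C.hg C.hOm C.hTh

theorem psMeas (C : Ctx d τ T a f g Om Th Ps) (i : Idx M) (n : ℕ) :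
    AEMeasurable (fun l => Ps l i n) freqMeasure := (C.hpair.analytic i n).1.1.aemeasurable

theorem ae_rows (C : Ctx d τ T a f g Om Th Ps) :
    ∀ᵐ l ∂freqMeasure, ∀ i, Summable fun n => ‖Ps l i n‖ ^ 2 :=
  ae_all_iff.2 fun i => ae_summable_of_sqInt (u := fun l n => Ps l i n) (fun n => C.psMeas i n)
    (C.hpair.rows i)

/-- The quantifier over `v` stands inside the almost-everywhere statement, so a single null set
serves and `v` may vary with the frequency. The bound on ζ makes `kappa` nonnegative, so the passage
to `ℝ≥0∞` loses nothing. -/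
theorem ae_repr (C : Ctx d τ T a f g Om Th Ps) : ∀ᵐ l ∂freqMeasure,
    (Summable fun i => ‖zbar d τ T a g Ps l i‖ ^ 2) ∧
    ∑' i, ‖zbar d τ T a g Ps l i‖ ^ 2 ≤ ∑' i, ‖tmul Om (Bfun d τ T a) l i‖ ^ 2 ∧
    ∀ v : ℕ → ℂ, (Summable fun n => ‖v n‖ ^ 2) →
      ENNReal.ofReal (quad (f l) fun n => wfun d τ l * v n) +
        ENNReal.ofReal (quad (g l) fun n => wfun d τ l * (Bfun d τ T a l n - v n)) =
      ∑' i, ‖∑' n, Th l n i * v n - zbar d τ T a g Ps l i‖ₑ ^ 2 +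
        ENNReal.ofReal (kappa d τ T a g Om Ps l) := by
  filter_upwards [C.ae_data, C.ae_rows, C.hpair.leftInv] with l hl hrow hinv
  obtain ⟨ζ, h1, h2, h3⟩ := hl.exists_repr hrow hinv (toL2 _ (C.sqB l))
  have hζ : ∀ i, ζ i = zbar d τ T a g Ps l i := h1
  have hs : Summable fun i => ‖zbar d τ T a g Ps l i‖ ^ 2 := by
    simpa only [hζ] using ζ.summable
  have hn : ‖ζ‖ ^ 2 = ∑' i, ‖zbar d τ T a g Ps l i‖ ^ 2 := by
    simpa only [hζ] using L2seq.norm_sq ζ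
  have ho : ‖hsOp (Om l) hl.omsum (toL2 _ (C.sqB l))‖ ^ 2 =
      ∑' i, ‖tmul Om (Bfun d τ T a) l i‖ ^ 2 := L2seq.norm_sq _
  have hle : ∑' i, ‖zbar d τ T a g Ps l i‖ ^ 2 ≤ ∑' i, ‖tmul Om (Bfun d τ T a) l i‖ ^ 2 := by
    rw [← hn, ← ho]; gcongr
  refine ⟨hs, hle, fun v hv => ?_⟩
  have h4 := h3 (toL2 v hv)
  rw [hn, ho] at h4
  have e1 := quad_const_mul (f l) v (wfun d τ l)
  have e2 := quad_const_mul (g l) (fun n => Bfun d τ T a l n - v n) (wfun d τ l)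
  rw [norm_wfun_sq] at e1 e2
  rw [e1, e2, ← ENNReal.ofReal_add (mul_nonneg hl.W_pos.le (quad_nonneg hl.fpos _))
    (mul_nonneg hl.W_pos.le (quad_nonneg hl.gpos _))]
  refine (congrArg ENNReal.ofReal h4).trans ?_
  rw [ENNReal.ofReal_add (by positivity) (sub_nonneg.2 hle), L2seq.enorm_sq]
  congr 1
  refine tsum_congr fun i => ?_
  rw [lp.coeFn_sub, Pi.sub_apply, hζ]
  rfl

theorem sqInt_OmB_lt (C : Ctx d τ T a f g Om Th Ps) : sqInt (tmul Om (Bfun d τ T a)) < ∞ :=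
  sqInt_tmul_vecSeries_lt C.hOm C.hb

theorem qMeas (C : Ctx d τ T a f g Om Th Ps) : CompMeas (qfun d τ T a g) := fun n =>
  (Complex.measurable_ofReal.comp (measurable_wsq d τ)).aemeasurable.mul
    (AEMeasurable.tsum fun m => (C.hg.meas n m).mul
      (Complex.continuous_conj.measurable.comp_aemeasurable (measB m)))

theorem zMeas (C : Ctx d τ T a f g Om Th Ps) : CompMeas (zbar d τ T a g Ps) := fun i =>
  Complex.continuous_conj.measurable.comp_aemeasurable
    (AEMeasurable.tsum fun n => (C.psMeas i n).mul (C.qMeas n))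

theorem sqInt_z_lt (C : Ctx d τ T a f g Om Th Ps) : sqInt (zbar d τ T a g Ps) < ∞ := by
  refine lt_of_le_of_lt (lintegral_mono_ae ?_) C.sqInt_OmB_lt
  filter_upwards [C.ae_repr, C.ae_data] with l hl hd
  have hs : Summable fun i => ‖tmul Om (Bfun d τ T a) l i‖ ^ 2 :=
    hs_apply_summable hd.omsum (C.sqB l)
  rw [tsum_enorm_sq hl.1, tsum_enorm_sq hs]
  exact ENNReal.ofReal_le_ofReal hl.2.1

/-- Since |w|²g = ΩΩ*, the conjugate of |w|²gB̄ is the product of Ω̄ with ΩᵀB. The coefficients of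
ΩᵀB are the vectors `omegaB`, and pairing with the analytic Ω produces the correlation sum that
defines `cg`. -/
theorem coef_qbar (C : Ctx d τ T a f g Om Th Ps) (n m : ℕ) :
    coef (fun l => conj (qfun d τ T a g l n)) (m : ℤ) = cg d τ T a Om m n := by
  have h1 : (fun l => conj (qfun d τ T a g l n)) =ᵐ[freqMeasure]
      fun l => ∑' i, conj (Om l n i) * tmul Om (Bfun d τ T a) l i := by
    filter_upwards [C.ae_data] with l hl
    have h2 := hl.conj_apply_g (toL2 _ (C.sqB l)) n
    have h3 : qfun d τ T a g l n = inner ℂ (hsOp (Om l) hl.omsum (toL2 _ (C.sqB l)))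
      (hsOp (Om l) hl.omsum (unit n)) := h2
    rw [h3, inner_conj_symm, ← (L2seq.inner_hasSum _ _).tsum_eq]
    exact tsum_congr fun i => congrArg (fun z : ℂ => conj z * tmul Om (Bfun d τ T a) l i)
      (hsOp_unit (Om l) hl.omsum n i)
  rw [coef_congr h1, coef_pairing (u := fun l i => Om l n i) (fun i => C.hOm.meas n i)
    (C.hOm.row_sqInt n) (tmul_compMeas C.hOm measB) C.sqInt_OmB_lt (fun i => C.hOm.analytic n i)]
  refine tsum_congr fun k => tsum_congr fun i => ?_
  congr 1
  exact_mod_cast coef_tmul_eq_omegaB d τ T a C.hOm C.hb i (k + m)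

theorem sqInt_qbar_lt (C : Ctx d τ T a f g Om Th Ps) :
    sqInt (fun l n => conj (qfun d τ T a g l n)) < ∞ := by
  refine lt_of_le_of_lt (le_of_eq ?_) C.hreg
  unfold sqInt
  refine lintegral_congr fun l => tsum_congr fun n => ?_
  rw [← ofReal_norm, Complex.norm_conj, ofReal_norm]
  rfl

/-- Pairing of the analytic rows of Ψ with the conjugate of |w|²gB̄. The regularity of the noise
supplies the square integrability of the second factor. -/
theorem coef_zbar (C : Ctx d τ T a f g Om Th Ps) (i : Idx M) (m : ℕ) :
    coef (fun l => zbar d τ T a g Ps l i) (m : ℤ) = psiC d τ T a Om Ps m i := by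
  have h1 : (fun l => zbar d τ T a g Ps l i) =
      fun l => ∑' n, conj (Ps l i n) * conj (qfun d τ T a g l n) := by
    funext l
    rw [zbar, Complex.conj_tsum]
    simp
  rw [h1, coef_pairing (u := fun l n => Ps l i n) (v := fun l n => conj (qfun d τ T a g l n)) (fun n => C.psMeas i n) (C.hpair.rows i)
    (fun n => Complex.continuous_conj.measurable.comp_aemeasurable (C.qMeas n)) C.sqInt_qbar_lt
    (fun n => C.hpair.analytic i n)]
  refine tsum_congr fun k => tsum_congr fun n => ?_
  congr 1
  exact_mod_cast C.coef_qbar n (k + m)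

theorem mse_eq (C : Ctx d τ T a f g Om Th Ps) {v h : ℝ → ℕ → ℂ} (hv : CompMeas v)
    (hh : CompMeas h) (hs : ∀ᵐ l ∂freqMeasure, Summable fun n => ‖v l n‖ ^ 2)
    (e : ∀ᵐ l ∂freqMeasure, ∀ n, h l n = wfun d τ l * (Bfun d τ T a l n - v l n)) :
    mse d τ T a h f g = ENNReal.ofReal (1 / (2 * Real.pi)) *
        sqInt (fun l i => tmul Th v l i - zbar d τ T a g Ps l i) +
      ENNReal.ofReal (1 / (2 * Real.pi)) *
      ∫⁻ l, ENNReal.ofReal (kappa d τ T a g Om Ps l) ∂freqMeasure := by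
  rw [mse, normSq, normSq, ← mul_add, ← mul_add, ← lintegral_add_right' _
    (ofReal_quad_meas C.hg.meas hh), sqInt, ← lintegral_add_left'
    (((tmul_compMeas C.hTh hv).sub C.zMeas).tsum_meas)]
  congr 1
  refine lintegral_congr_ae ?_
  filter_upwards [C.ae_repr, hs, e] with l h1 h2 h3
  have h4 := h1.2.2 (v l) h2
  have e1 : (fun k => wfun d τ l * Bfun d τ T a l k - h l k) = fun n => wfun d τ l * v l n := by
    funext k; rw [h3]; ring
  have e2 : h l = fun n => wfun d τ l * (Bfun d τ T a l n - v l n) := funext h3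
  rw [e1, e2, h4]
  rfl

/-- Parseval for Θᵀv − ζ, split by the sign of the index. As Θᵀv is analytic, the negative part
belongs to ζ alone and is absorbed into `rho`. -/
theorem mse_eq_rho (C : Ctx d τ T a f g Om Th Ps) {v h : ℝ → ℕ → ℂ} (hv : CompMeas v)
    (hh : CompMeas h) (hs : ∀ᵐ l ∂freqMeasure, Summable fun n => ‖v l n‖ ^ 2)
    (e : ∀ᵐ l ∂freqMeasure, ∀ n, h l n = wfun d τ l * (Bfun d τ T a l n - v l n))
    (hy : ∀ i, IsH2 fun l => tmul Th v l i) (hlt : sqInt (tmul Th v) < ∞) :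
    mse d τ T a h f g = rho d τ T a g Om Ps +
      ∑' i, ∑' m : ℕ, ‖coef (fun l => tmul Th v l i) (m : ℤ) - psiC d τ T a Om Ps m i‖ₑ ^ 2 := by
  have hm := tmul_compMeas C.hTh hv
  have hdl : sqInt (fun l i => tmul Th v l i - zbar d τ T a g Ps l i) < ∞ :=
    (sqInt_sub_le hm).trans_lt (ENNReal.add_lt_top.2 ⟨ENNReal.mul_lt_top (by norm_num) hlt,
      ENNReal.mul_lt_top (by norm_num) C.sqInt_z_lt⟩)
  have h2 : ∀ i k, coef (fun l => tmul Th v l i - zbar d τ T a g Ps l i) k =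
      coef (fun l => tmul Th v l i) k - coef (fun l => zbar d τ T a g Ps l i) k := fun i k =>
    coef_sub (integrable_of_memLp_freq (hy i).1)
      (integrable_of_memLp_freq (memLp_comp C.zMeas C.sqInt_z_lt i)) k
  have h3 : ∀ i (m : ℕ), ‖coef (fun l => tmul Th v l i) (-((m : ℤ) + 1)) -
      coef (fun l => zbar d τ T a g Ps l i) (-((m : ℤ) + 1))‖ₑ ^ 2 =
      ‖coef (fun l => zbar d τ T a g Ps l i) (-((m : ℤ) + 1))‖ₑ ^ 2 := fun i m => by
    rw [(hy i).2 _ (by omega), zero_sub, enorm_neg]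
  rw [C.mse_eq hv hh hs e, parseval_split (hm.sub C.zMeas) hdl, rho]
  simp_rw [h2, h3, C.coef_zbar]
  ring

end Ctx

/-! ### Admissible characteristics and the least error for one signal density -/

theorem CompMeas.div_wfun {d τ : ℕ} {h : ℝ → ℕ → ℂ} (hh : CompMeas h) :
    CompMeas fun l n => h l n / wfun d τ l := fun n =>
  (hh n).div (measurable_wfun d τ).aemeasurable

theorem CompMeas.wfun_mul {d τ : ℕ} {h : ℝ → ℕ → ℂ} (hh : CompMeas h) :
    CompMeas fun l n => wfun d τ l * h l n := fun n =>
  (measurable_wfun d τ).aemeasurable.mul (hh n)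

theorem summable_sq_sub {ι : Type*} {x y : ι → ℂ} (hx : Summable fun i => ‖x i‖ ^ 2)
    (hy : Summable fun i => ‖y i‖ ^ 2) : Summable fun i => ‖x i - y i‖ ^ 2 :=
  (toL2 x hx - toL2 y hy).summable

theorem summable_sq_mul {ι : Type*} {x : ι → ℂ} (c : ℂ) (hx : Summable fun i => ‖x i‖ ^ 2) :
    Summable fun i => ‖c * x i‖ ^ 2 :=
  (c • toL2 x hx).summable

theorem summable_sq_div {ι : Type*} {x : ι → ℂ} (c : ℂ) (hx : Summable fun i => ‖x i‖ ^ 2) :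
    Summable fun i => ‖x i / c‖ ^ 2 := by
  simpa [div_eq_inv_mul] using summable_sq_mul c⁻¹ hx

theorem c0_pos : 0 < ENNReal.ofReal (1 / (2 * Real.pi)) := by simp [Real.pi_pos]

theorem poly_compMeas (d τ : ℕ) (q : (ℕ × ℕ) →₀ ℂ) : CompMeas (poly d τ q) := by
  have := (pvec_compMeas q).wfun_mul (d := d) (τ := τ)
  simpa only [← poly_eq] using this

theorem poly_summable (d τ : ℕ) (q : (ℕ × ℕ) →₀ ℂ) (l : ℝ) :
    Summable fun k => ‖poly d τ q l k‖ ^ 2 := by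
  simp_rw [poly_eq]
  exact summable_sq_mul _ (pvec_summable q l)

theorem poly_mem_L20 (d τ : ℕ) (F : ℝ → Matrix ℕ ℕ ℂ) (q : (ℕ × ℕ) →₀ ℂ) :
    poly d τ q ∈ L20 d τ F := by
  refine ⟨poly_compMeas d τ q, Eventually.of_forall fun l => poly_summable d τ q l,
    fun ε hε => ⟨q, ?_⟩⟩
  simpa [normSq, quad] using hε

namespace Ctx

variable {d τ : ℕ} {T : ℝ} {a : ℝ → ℂ} {M : ℕ∞} {f g : ℝ → Matrix ℕ ℕ ℂ}
    {Om Th : ℝ → Matrix ℕ (Idx M) ℂ} {Ps : ℝ → Matrix (Idx M) ℕ ℂ}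

theorem tmul_sub_ae (C : Ctx d τ T a f g Om Th Ps) {u v : ℝ → ℕ → ℂ}
    (hu : ∀ᵐ l ∂freqMeasure, Summable fun n => ‖u l n‖ ^ 2)
    (hv : ∀ᵐ l ∂freqMeasure, Summable fun n => ‖v l n‖ ^ 2) :
    ∀ᵐ l ∂freqMeasure, ∀ i, tmul Th (fun l n => u l n - v l n) l i =
      tmul Th u l i - tmul Th v l i := by
  filter_upwards [hu, hv, C.hTh.ae_summable] with l h1 h2 h3 i
  unfold tmul
  simp_rw [mul_sub]
  exact (summable_mul_of_sq' (summable_col h3 i) h1).tsum_sub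
    (summable_mul_of_sq' (summable_col h3 i) h2)

theorem normSq_wfun_mul (C : Ctx d τ T a f g Om Th Ps) {h u : ℝ → ℕ → ℂ}
    (hu : ∀ᵐ l ∂freqMeasure, Summable fun n => ‖u l n‖ ^ 2)
    (e : ∀ᵐ l ∂freqMeasure, ∀ n, h l n = wfun d τ l * u l n) :
    normSq (fun l => f l + g l) h = ENNReal.ofReal (1 / (2 * Real.pi)) * sqInt (tmul Th u) := by
  unfold normSq sqInt
  congr 1
  refine lintegral_congr_ae ?_
  filter_upwards [C.ae_data, hu, e] with l h1 h2 h3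
  have h4 := h1.quad_sum (toL2 _ h2)
  have h5 : h l = fun n => wfun d τ l * u l n := funext h3
  rw [h5, quad_const_mul, norm_wfun_sq]
  refine (congrArg ENNReal.ofReal h4).trans ?_
  rw [L2seq.enorm_sq]
  rfl

theorem normSq_g_wfun_mul (C : Ctx d τ T a f g Om Th Ps) {h u : ℝ → ℕ → ℂ}
    (hu : ∀ᵐ l ∂freqMeasure, Summable fun n => ‖u l n‖ ^ 2)
    (e : ∀ᵐ l ∂freqMeasure, ∀ n, h l n = wfun d τ l * u l n) :
    normSq g h = ENNReal.ofReal (1 / (2 * Real.pi)) * sqInt (tmul Om u) := by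
  unfold normSq sqInt
  congr 1
  refine lintegral_congr_ae ?_
  filter_upwards [C.ae_data, hu, e] with l h1 h2 h3
  have h4 := h1.quad_g (toL2 _ h2)
  have h5 : h l = fun n => wfun d τ l * u l n := funext h3
  rw [h5, quad_const_mul, norm_wfun_sq]
  refine (congrArg ENNReal.ofReal h4).trans ?_
  rw [L2seq.enorm_sq]
  rfl

theorem normSq_sub_poly (C : Ctx d τ T a f g Om Th Ps) {h : ℝ → ℕ → ℂ}
    (hh : ∀ᵐ l ∂freqMeasure, Summable fun n => ‖h l n‖ ^ 2) (q : (ℕ × ℕ) →₀ ℂ) :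
    normSq (fun l => f l + g l) (fun l k => h l k - poly d τ q l k) =
      ENNReal.ofReal (1 / (2 * Real.pi)) *
        sqInt (fun l i => tmul Th (fun l n => h l n / wfun d τ l) l i - pTh Th q l i) := by
  have h1 : ∀ᵐ l ∂freqMeasure, Summable fun n => ‖h l n / wfun d τ l‖ ^ 2 := by
    filter_upwards [hh] with l hl using summable_sq_div _ hl
  have h2 : ∀ᵐ l ∂freqMeasure, Summable fun n => ‖pvec q l n‖ ^ 2 :=
    Eventually.of_forall (pvec_summable q)
  rw [C.normSq_wfun_mul (u := fun l n => h l n / wfun d τ l - pvec q l n)]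
  · congr 1
    refine sqInt_congr ?_
    filter_upwards [C.tmul_sub_ae h1 h2] with l hl i
    rw [hl, tmul_pvec]
  · filter_upwards [h1] with l hl using summable_sq_sub hl (pvec_summable q l)
  · filter_upwards [ae_wfun_ne d C.hτ] with l hl n
    rw [poly_eq]
    field_simp

/-- Division by w, which is nonzero a.e., turns the norm of L₂(f+g) into the L² norm of Θᵀ(h/w) and
the admissible polynomials into the functions Θᵀp. -/
theorem mem_L20_iff (C : Ctx d τ T a f g Om Th Ps) {h : ℝ → ℕ → ℂ} (hm : CompMeas h)
    (hh : ∀ᵐ l ∂freqMeasure, Summable fun n => ‖h l n‖ ^ 2) :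
    h ∈ L20 d τ (fun l => f l + g l) ↔ Approx Th (tmul Th fun l n => h l n / wfun d τ l) := by
  constructor
  · rintro ⟨-, -, h3⟩ ε hε
    obtain ⟨q, hq⟩ := h3 (ENNReal.ofReal (1 / (2 * Real.pi)) * ε) (ENNReal.mul_pos c0_pos.ne' hε.ne')
    rw [C.normSq_sub_poly hh] at hq
    exact ⟨q, (ENNReal.mul_lt_mul_iff_right c0_pos.ne' (by simp)).1 hq⟩
  · intro h1
    refine ⟨hm, hh, fun ε hε => ?_⟩
    obtain ⟨q, hq⟩ := h1 (ε / ENNReal.ofReal (1 / (2 * Real.pi))) (ENNReal.div_pos hε.ne' (by simp))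
    refine ⟨q, ?_⟩
    rw [C.normSq_sub_poly hh]
    rwa [ENNReal.lt_div_iff_mul_lt (by simp [Real.pi_pos]) (by simp), mul_comm] at hq

theorem approx_B (C : Ctx d τ T a f g Om Th Ps) : Approx Th (tmul Th (Bfun d τ T a)) :=
  approx_of_isH2 C.hTh (tmul_compMeas C.hTh measB) (sqInt_tmul_vecSeries_lt C.hTh C.hb)
    (tmul_vecSeries_isH2 C.hTh C.hb)

/-- The error of an admissible estimate. -/
theorem mse_of_mem_L20 (C : Ctx d τ T a f g Om Th Ps) {h : ℝ → ℕ → ℂ}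
    (hL : h ∈ L20 d τ (fun l => f l + g l)) :
    mse d τ T a h f g = rho d τ T a g Om Ps +
      ∑' i, ∑' m : ℕ, ‖coef (fun l => tmul Th (Bfun d τ T a) l i) (m : ℤ) -
        coef (fun l => tmul Th (fun l n => h l n / wfun d τ l) l i) (m : ℤ) -
        psiC d τ T a Om Ps m i‖ₑ ^ 2 := by
  have hm : CompMeas h := hL.1
  have hA := (C.mem_L20_iff hm hL.2.1).1 hL
  have hum : CompMeas fun l n => h l n / wfun d τ l := hm.div_wfun
  have hus : ∀ᵐ l ∂freqMeasure, Summable fun n => ‖h l n / wfun d τ l‖ ^ 2 := by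
    filter_upwards [hL.2.1] with l hl using summable_sq_div _ hl
  have hBs : ∀ᵐ l ∂freqMeasure, Summable fun n => ‖Bfun d τ T a l n‖ ^ 2 :=
    Eventually.of_forall C.sqB
  have hsub := C.tmul_sub_ae hBs hus
  have hyH := fun i => hA.isH2 C.hTh (tmul_compMeas C.hTh hum) i
  have hylt := hA.sqInt_lt C.hTh (tmul_compMeas C.hTh hum)
  have hBH : ∀ i, IsH2 fun l => tmul Th (Bfun d τ T a) l i := tmul_vecSeries_isH2 C.hTh C.hb
  have hBlt := sqInt_tmul_vecSeries_lt C.hTh C.hb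
  have hi : ∀ i, (fun l => tmul Th (Bfun d τ T a) l i - tmul Th (fun l n => h l n / wfun d τ l) l i)
      =ᵐ[freqMeasure] fun l => tmul Th (fun l n => Bfun d τ T a l n - h l n / wfun d τ l) l i :=
    fun i => by filter_upwards [hsub] with l hl using (hl i).symm
  rw [C.mse_eq_rho (v := fun l n => Bfun d τ T a l n - h l n / wfun d τ l) (measB.sub hum) hm]
  · congr 1
    refine tsum_congr fun i => tsum_congr fun m => ?_
    rw [← coef_congr (hi i), coef_sub (integrable_of_memLp_freq (hBH i).1)
      (integrable_of_memLp_freq (hyH i).1)]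
  · filter_upwards [hus] with l hl using summable_sq_sub (C.sqB l) hl
  · filter_upwards [ae_wfun_ne d C.hτ] with l hl n
    field_simp
    ring
  · exact fun i => ((hBH i).sub (hyH i)).congr (hi i)
  · rw [sqInt_congr hsub]
    exact (sqInt_sub_le (tmul_compMeas C.hTh measB)).trans_lt (ENNReal.add_lt_top.2
      ⟨ENNReal.mul_lt_top (by norm_num) hBlt, ENNReal.mul_lt_top (by norm_num) hylt⟩)

/-- The error of h = wB computed twice. Here v = 0, so no signal error is left and the noise
contributes the energy of ΩᵀB; on the other side the excess over `rho` is the whole norm of ψ̄C. The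
right-hand side does not involve the signal density. -/
theorem rho_add_psiCNormSq (C : Ctx d τ T a f g Om Th Ps) :
    rho d τ T a g Om Ps + psiCNormSq d τ T a Om Ps =
      ENNReal.ofReal (1 / (2 * Real.pi)) * sqInt (tmul Om (Bfun d τ T a)) := by
  have h1 := C.mse_eq_rho (v := fun _ _ => 0) (h := fun l n => wfun d τ l * Bfun d τ T a l n)
    (fun _ => aemeasurable_const) measB.wfun_mul (Eventually.of_forall fun _ => by simp)
    (Eventually.of_forall fun l n => by simp) (fun i => by simpa [tmul] using IsH2.zero)
    (by simp [sqInt, tmul])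
  have h2 := C.normSq_g_wfun_mul (h := fun l n => wfun d τ l * Bfun d τ T a l n)
    (Eventually.of_forall C.sqB) (Eventually.of_forall fun l n => rfl)
  rw [mse, h2] at h1
  have h3 : normSq f (fun l k => wfun d τ l * Bfun d τ T a l k - wfun d τ l * Bfun d τ T a l k) = 0 := by
    simp [normSq, quad]
  rw [h3, zero_add] at h1
  rw [h1, psiCNormSq, ENNReal.tsum_comm]
  congr 1
  refine tsum_congr fun i => tsum_congr fun m => ?_
  simp [tmul, coef]

theorem rho_add_psiCNormSq_lt (C : Ctx d τ T a f g Om Th Ps) :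
    rho d τ T a g Om Ps + psiCNormSq d τ T a Om Ps < ∞ := by
  rw [C.rho_add_psiCNormSq]
  exact ENNReal.mul_lt_top (by simp) C.sqInt_OmB_lt

theorem div_wfun_poly_ae (C : Ctx d τ T a f g Om Th Ps) (q : (ℕ × ℕ) →₀ ℂ) (i : Idx M) :
    (fun l => tmul Th (fun l n => poly d τ q l n / wfun d τ l) l i) =ᵐ[freqMeasure]
      fun l => pTh Th q l i := by
  filter_upwards [ae_wfun_ne d C.hτ] with l hl
  rw [← tmul_pvec]
  unfold tmul
  refine tsum_congr fun n => ?_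
  change Th l n i * (poly d τ q l n / wfun d τ l) = _
  rw [poly_eq, mul_div_cancel_left₀ _ hl]

/-- The infimum is reached in the limit without solving Θᵀv = c. The sequence ψ̄C is truncated to a
trigonometric polynomial t, and ΘᵀB − t, being a limit of functions Θᵀp, is approximated by one of
them. -/
theorem exists_poly_mse_le (C : Ctx d τ T a f g Om Th Ps) {ε : ℝ≥0∞} (hε : 0 < ε) :
    ∃ q, mse d τ T a (poly d τ q) f g ≤ rho d τ T a g Om Ps + ε := by
  have hps : ∑' i, ∑' m : ℕ, ‖psiC d τ T a Om Ps m i‖ₑ ^ 2 < ∞ := by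
    rw [ENNReal.tsum_comm]
    exact lt_of_le_of_lt le_add_self C.rho_add_psiCNormSq_lt
  have h4 : (0 : ℝ≥0∞) < ε / 4 := ENNReal.div_pos hε.ne' (by norm_num)
  obtain ⟨s, hs⟩ := exists_finset_tail (fun i m => psiC d τ T a Om Ps m i) hps h4
  set t := trigvec s (fun i m => psiC d τ T a Om Ps m i) with ht
  have htm : CompMeas t := trigvec_compMeas _ _
  have htH : ∀ i, IsH2 fun l => t l i := trigvec_isH2 _ _
  have hBm := tmul_compMeas C.hTh (measB (d := d) (τ := τ) (T := T) (a := a))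
  have hBH : ∀ i, IsH2 fun l => tmul Th (Bfun d τ T a) l i := tmul_vecSeries_isH2 C.hTh C.hb
  have hA : Approx Th fun l i => tmul Th (Bfun d τ T a) l i - t l i := by
    have := Approx.add C.hTh hBm C.approx_B ((approx_trigvec C.hTh s
      (fun i m => psiC d τ T a Om Ps m i)).const_mul (-1))
    simpa [sub_eq_add_neg] using this
  obtain ⟨q, hq⟩ := hA (min (ε / 4) 1) (by simpa using h4.ne')
  refine ⟨q, ?_⟩
  rw [C.mse_of_mem_L20 (poly_mem_L20 d τ _ q)]
  gcongr
  have hpH := pTh_isH2 C.hTh q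
  have h5 : ∀ i (m : ℕ), ‖coef (fun l => tmul Th (Bfun d τ T a) l i) (m : ℤ) -
        coef (fun l => tmul Th (fun l n => poly d τ q l n / wfun d τ l) l i) (m : ℤ) -
        psiC d τ T a Om Ps m i‖ₑ ^ 2 ≤
      2 * ‖coef (fun l => tmul Th (Bfun d τ T a) l i - t l i - pTh Th q l i) (m : ℤ)‖ₑ ^ 2 +
      2 * ‖(if (i, m) ∈ s then psiC d τ T a Om Ps m i else 0) - psiC d τ T a Om Ps m i‖ₑ ^ 2 := by
    intro i m
    have e1 : coef (fun l => tmul Th (Bfun d τ T a) l i - t l i - pTh Th q l i) (m : ℤ) =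
        coef (fun l => tmul Th (Bfun d τ T a) l i) (m : ℤ) - coef (fun l => t l i) (m : ℤ) -
          coef (fun l => pTh Th q l i) (m : ℤ) := by
      rw [coef_sub (F := fun l => tmul Th (Bfun d τ T a) l i - t l i)
        (integrable_of_memLp_freq ((hBH i).sub (htH i)).1) (integrable_of_memLp_freq (hpH i).1)]
      congr 1
      exact coef_sub (F := fun l => tmul Th (Bfun d τ T a) l i)
        (integrable_of_memLp_freq (hBH i).1) (integrable_of_memLp_freq (htH i).1) _
    rw [coef_congr (C.div_wfun_poly_ae q i), e1, ht, coef_trigvec_nat]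
    refine le_trans (le_of_eq ?_) (enorm_add_sq_le _ _)
    congr 2; ring
  refine (ENNReal.tsum_le_tsum fun i => ENNReal.tsum_le_tsum fun m => h5 i m).trans ?_
  simp_rw [ENNReal.tsum_add, ENNReal.tsum_mul_left]
  have hD : CompMeas fun l i => tmul Th (Bfun d τ T a) l i - t l i - pTh Th q l i :=
    (hBm.sub htm).sub (pTh_compMeas C.hTh q)
  have h6 := parseval_split hD (hq.trans (lt_of_le_of_lt (min_le_right _ _) (by simp)))
  have h7 : ∑' i, ∑' m : ℕ,
      ‖coef (fun l => tmul Th (Bfun d τ T a) l i - t l i - pTh Th q l i) (m : ℤ)‖ₑ ^ 2 ≤ ε / 4 := by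
    refine le_trans (le_trans le_self_add h6.symm.le) ?_
    have hpi : ENNReal.ofReal (1 / (2 * Real.pi)) ≤ 1 := by
      rw [ENNReal.ofReal_le_one, div_le_one (by positivity)]
      nlinarith [Real.pi_gt_three]
    calc _ ≤ 1 * (ε / 4) := by gcongr; exact hq.le.trans (min_le_left _ _)
      _ = ε / 4 := one_mul _
  calc _ ≤ 2 * (ε / 4) + 2 * (ε / 4) := by gcongr
    _ = ε := by
        rw [← two_mul, ← mul_assoc]; norm_num
        exact ENNReal.mul_div_cancel (by norm_num) (by norm_num)

theorem rho_le_mse (C : Ctx d τ T a f g Om Th Ps) {h : ℝ → ℕ → ℂ}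
    (hL : h ∈ L20 d τ (fun l => f l + g l)) : rho d τ T a g Om Ps ≤ mse d τ T a h f g := by
  rw [C.mse_of_mem_L20 hL]
  exact le_self_add

theorem optMse_eq (C : Ctx d τ T a f g Om Th Ps) :
    optMse d τ T a f g = rho d τ T a g Om Ps := by
  refine le_antisymm ?_ (le_iInf₂ fun h hL => C.rho_le_mse hL)
  refine le_of_forall_pos_le_add fun ε hε => ?_
  obtain ⟨q, hq⟩ := C.exists_poly_mse_le hε
  exact (iInf₂_le _ (poly_mem_L20 d τ _ q)).trans hq

theorem optMse_add_psiCNormSq (C : Ctx d τ T a f g Om Th Ps) :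
    optMse d τ T a f g + psiCNormSq d τ T a Om Ps =
      ENNReal.ofReal (1 / (2 * Real.pi)) * sqInt (tmul Om (Bfun d τ T a)) := by
  rw [C.optMse_eq, C.rho_add_psiCNormSq]

/-- The least error and the norm of ψ̄C have the same sum for both densities; the sum is finite, so
the smaller norm may be cancelled. -/
theorem optMse_le_of_psiCNormSq_le {f' : ℝ → Matrix ℕ ℕ ℂ} {Th' : ℝ → Matrix ℕ (Idx M) ℂ}
    {Ps' : ℝ → Matrix (Idx M) ℕ ℂ} (C : Ctx d τ T a f g Om Th Ps) (C' : Ctx d τ T a f' g Om Th' Ps')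
    (h : psiCNormSq d τ T a Om Ps ≤ psiCNormSq d τ T a Om Ps') :
    optMse d τ T a f' g ≤ optMse d τ T a f g := by
  have h1 := C.optMse_add_psiCNormSq.trans C'.optMse_add_psiCNormSq.symm
  have hfin : psiCNormSq d τ T a Om Ps ≠ ∞ :=
    (lt_of_le_of_lt le_add_self C.rho_add_psiCNormSq_lt).ne
  refine (ENNReal.add_le_add_iff_right hfin).1 ?_
  rw [h1]
  gcongr

end Ctx

/-! ### Bounded Hermitian matrices -/

/-- Hermitian matrices of bounded operators in `ℓ²`. -/
structure BoundedHermitian (K : Matrix ℕ ℕ ℂ) : Prop where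
  herm : ∀ k n, conj (K k n) = K n k
  row : ∀ k, Summable fun n => ‖K k n‖ ^ 2
  apply : ∀ x : ℕ → ℂ, (Summable fun n => ‖x n‖ ^ 2) → Summable fun k => ‖∑' n, K k n * x n‖ ^ 2

theorem BoundedHermitian.col {K : Matrix ℕ ℕ ℂ} (h : BoundedHermitian K) (k : ℕ) :
    Summable fun n => ‖K n k‖ ^ 2 := by
  refine (h.row k).congr fun n => ?_
  rw [← h.herm k n]; simp

theorem BoundedHermitian.rankOne {α : ℕ → ℂ} (hα : Summable fun k => ‖α k‖ ^ 2) :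
    BoundedHermitian (Matrix.of fun k n => α k * conj (α n)) where
  herm k n := by simp [mul_comm]
  row k := by simpa [mul_pow] using hα.mul_left (‖α k‖ ^ 2)
  apply x hx := by
    have : ∀ k, ∑' n, (Matrix.of fun k n => α k * conj (α n)) k n * x n =
        (∑' n, conj (α n) * x n) * α k := fun k => by
      simp only [Matrix.of_apply, mul_assoc, tsum_mul_left]
      ring
    simp_rw [this]
    exact summable_sq_mul _ hα

theorem BoundedHermitian.diagonal {α : ℕ → ℝ} {C : ℝ} (hα : ∀ k, |α k| ≤ C) :
    BoundedHermitian (Matrix.diagonal fun k => ((α k : ℝ) : ℂ)) where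
  herm k n := by
    rcases eq_or_ne k n with rfl | h
    · simp
    · simp [h, h.symm]
  row k := summable_of_hasFiniteSupport ((Set.finite_singleton k).subset fun n hn => by
    by_contra h
    exact hn (by simp [Matrix.diagonal_apply_ne _ (Ne.symm h)]))
  apply x hx := by
    have : ∀ k, ∑' n, (Matrix.diagonal fun k => ((α k : ℝ) : ℂ)) k n * x n = α k * x k :=
      fun k => by
        rw [tsum_eq_single k fun n hn => by simp [Matrix.diagonal_apply_ne _ hn.symm]]
        simp
    simp_rw [this]
    refine Summable.of_nonneg_of_le (fun _ => by positivity) (fun k => ?_) (hx.mul_left (C ^ 2))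
    rw [norm_mul, mul_pow, Complex.norm_real]
    exact mul_le_mul_of_nonneg_right (pow_le_pow_left₀ (norm_nonneg _) (hα k) 2) (by positivity)

/-! ### Positive-definite matrices with bounded quadratic form -/

section PosDef

variable {B : Matrix ℕ ℕ ℂ} {C : ℝ}

theorem finsupp_form_eq (B : Matrix ℕ ℕ ℂ) (s : Finset ℕ) (y : ℕ → ℂ) :
    let z := ∑ i ∈ s, Finsupp.single i (y i)
    (z.sum fun i xi => z.sum fun j xj => star xi * B i j * xj) =
      ∑ i ∈ s, ∑ j ∈ s, star (y i) * B i j * y j ∧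
    (z.sum fun _ xi => ‖xi‖ ^ 2) = ∑ i ∈ s, ‖y i‖ ^ 2 := by
  intro z
  have hz : ∀ i, z i = if i ∈ s then y i else 0 := fun i => by
    simp [z, Finsupp.finsetSum_apply, Finsupp.single_apply]
  have hsupp : z.support ⊆ s := fun i hi => by
    by_contra h
    simp [hz, h] at hi
  constructor
  · rw [Finsupp.sum_of_support_subset _ hsupp _ (by simp)]
    refine Finset.sum_congr rfl fun i hi => ?_
    rw [Finsupp.sum_of_support_subset _ hsupp _ (by simp)]
    refine Finset.sum_congr rfl fun j hj => ?_
    simp [hz, hi, hj]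
  · rw [Finsupp.sum_of_support_subset _ hsupp _ (by simp)]
    exact Finset.sum_congr rfl fun i hi => by simp [hz, hi]

/-- The Gram-type matrix of `y` and `x` under the form of `B` is a positive 2×2 matrix. Its minor is
the Cauchy–Schwarz inequality, and `hC` bounds its diagonal. -/
theorem sum_conj_mul_mul_sq_le (hB : B.PosDef) (hC : ∀ x : ℕ →₀ ℂ,
      (x.sum fun i xi => x.sum fun j xj => star xi * B i j * xj).re ≤ C * x.sum fun _ xi => ‖xi‖ ^ 2)
    (s : Finset ℕ) (x y : ℕ → ℂ) :
    ‖∑ i ∈ s, ∑ j ∈ s, star (y i) * B i j * x j‖ ^ 2 ≤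
      (C * ∑ i ∈ s, ‖y i‖ ^ 2) * (C * ∑ i ∈ s, ‖x i‖ ^ 2) := by
  let X : Matrix s (Fin 2) ℂ := Matrix.of fun i a => if a = 0 then y i else x i
  have hP := ((hB.posSemidef.submatrix (fun i : s => (i : ℕ))).conjTranspose_mul_mul_same X)
  have key : ∀ a b, (X.conjTranspose * B.submatrix (fun i : s => (i : ℕ)) (fun i : s => (i : ℕ)) * X) a b =
      ∑ i ∈ s, ∑ j ∈ s, star (if a = 0 then y i else x i) * B i j * (if b = 0 then y j else x j) := by
    intro a b
    simp only [Matrix.mul_apply, Matrix.conjTranspose_apply, Matrix.submatrix_apply, X,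
      Matrix.of_apply, Finset.sum_mul]
    rw [Finset.sum_comm]
    rw [← Finset.sum_coe_sort s]
    refine Finset.sum_congr rfl fun i _ => ?_
    rw [← Finset.sum_coe_sort s]
  have h := posSemidef_norm_sq_le hP 0 1
  have b0 := hC (∑ i ∈ s, Finsupp.single i (y i))
  have b1 := hC (∑ i ∈ s, Finsupp.single i (x i))
  rw [(finsupp_form_eq B s y).1, (finsupp_form_eq B s y).2] at b0
  rw [(finsupp_form_eq B s x).1, (finsupp_form_eq B s x).2] at b1
  have p0 := (posSemidef_diag_re hP 0).2
  have p1 := (posSemidef_diag_re hP 1).2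
  rw [key] at h p0 p1
  rw [key, key] at h
  simp only [if_true, one_ne_zero, if_false] at h p0 p1
  exact h.trans (mul_le_mul b0 b1 p1 (p0.trans b0))

/-- With y = Bx, truncated to `s`, the form equals R = ‖y‖² and the Cauchy–Schwarz bound becomes R²
≤ C² R ‖x‖². The bound of the form is thus a bound of the operator. -/
theorem sum_norm_apply_sq_le (hB : B.PosDef) (hC : ∀ x : ℕ →₀ ℂ,
      (x.sum fun i xi => x.sum fun j xj => star xi * B i j * xj).re ≤ C * x.sum fun _ xi => ‖xi‖ ^ 2)
    (s : Finset ℕ) (x : ℕ → ℂ) :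
    ∑ i ∈ s, ‖∑ j ∈ s, B i j * x j‖ ^ 2 ≤ C ^ 2 * ∑ i ∈ s, ‖x i‖ ^ 2 := by
  set R := ∑ i ∈ s, ‖∑ j ∈ s, B i j * x j‖ ^ 2 with hR
  have hR0 : 0 ≤ R := Finset.sum_nonneg fun _ _ => by positivity
  have h := sum_conj_mul_mul_sq_le hB hC s x (fun i => ∑ j ∈ s, B i j * x j)
  have e : ∑ i ∈ s, ∑ j ∈ s, star (∑ j ∈ s, B i j * x j) * B i j * x j = ((R : ℝ) : ℂ) := by
    rw [hR]; push_cast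
    refine Finset.sum_congr rfl fun i _ => ?_
    simp_rw [mul_assoc]
    rw [← Finset.mul_sum]
    exact Complex.conj_mul' _
  rw [e, Complex.norm_real, Real.norm_of_nonneg hR0] at h
  rcases hR0.eq_or_lt with h0 | h0
  · rw [← h0]; exact mul_nonneg (sq_nonneg _) (Finset.sum_nonneg fun _ _ => by positivity)
  · have : R * R ≤ R * (C ^ 2 * ∑ i ∈ s, ‖x i‖ ^ 2) := by
      rw [← hR] at h; nlinarith
    exact le_of_mul_le_mul_left this h0

theorem boundedHermitian_of_posDef (hB : B.PosDef) (hC : ∀ x : ℕ →₀ ℂ,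
      (x.sum fun i xi => x.sum fun j xj => star xi * B i j * xj).re ≤ C * x.sum fun _ xi => ‖xi‖ ^ 2) :
    BoundedHermitian B := by
  have herm : ∀ k n, conj (B k n) = B n k := fun k n => hB.isHermitian.apply n k
  have col : ∀ k, Summable fun n => ‖B n k‖ ^ 2 := fun k => by
    refine summable_of_sum_le (c := C ^ 2) (fun _ => by positivity) fun s => ?_
    have h := sum_norm_apply_sq_le hB hC (insert k s) (Pi.single k 1)
    have e1 : ∀ i, ∑ j ∈ insert k s, B i j * (Pi.single k 1 : ℕ → ℂ) j = B i k := fun i => by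
      rw [Finset.sum_eq_single k] <;> simp +contextual
    have e2 : ∑ i ∈ insert k s, ‖(Pi.single k 1 : ℕ → ℂ) i‖ ^ 2 = 1 := by
      rw [Finset.sum_eq_single k] <;> simp +contextual
    simp_rw [e1] at h
    rw [e2, mul_one] at h
    exact (Finset.sum_le_sum_of_subset_of_nonneg (Finset.subset_insert k s)
      fun _ _ _ => by positivity).trans h
  have row : ∀ k, Summable fun n => ‖B k n‖ ^ 2 := fun k =>
    (col k).congr fun n => by rw [← herm k n]; simp
  refine ⟨herm, row, fun x hx => ?_⟩
  refine summable_of_sum_le (c := C ^ 2 * ∑' i, ‖x i‖ ^ 2) (fun _ => by positivity) fun t => ?_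
  -- The finite set `t` of rows stays fixed while the set `s ⊇ t` of summed columns exhausts ℕ.
  have ht : Tendsto (fun s : Finset ℕ => ∑ i ∈ t, ‖∑ j ∈ s, B i j * x j‖ ^ 2) atTop
      (𝓝 (∑ i ∈ t, ‖∑' j, B i j * x j‖ ^ 2)) :=
    tendsto_finsetSum _ fun i _ => ((summable_mul_of_sq' (row i) hx).hasSum.norm).pow 2
  refine le_of_tendsto ht ?_
  filter_upwards [eventually_ge_atTop t] with s hs
  refine (Finset.sum_le_sum_of_subset_of_nonneg hs fun _ _ _ => by positivity).trans
    ((sum_norm_apply_sq_le hB hC s x).trans ?_)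
  exact mul_le_mul_of_nonneg_left (hx.sum_le_tsum s fun _ _ => by positivity) (sq_nonneg _)

/-- For Hermitian B the transpose is the entrywise conjugate, so Bᵀx is the conjugate of Bx̄. -/
theorem BoundedHermitian.smul_transpose {B : Matrix ℕ ℕ ℂ} (h : BoundedHermitian B) (r : ℝ) :
    BoundedHermitian ((r : ℂ) • B.transpose) where
  herm k n := by simp [h.herm]
  row k := by simpa using summable_sq_mul (r : ℂ) (h.col k)
  apply x hx := by
    have : ∀ k, ∑' n, ((r : ℂ) • B.transpose) k n * x n =
        r * conj (∑' n, B k n * conj (x n)) := fun k => by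
      rw [Complex.conj_tsum, ← tsum_mul_left]
      refine tsum_congr fun n => ?_
      simp [h.herm, mul_assoc]
    simp_rw [this]
    exact summable_sq_mul _ (summable_sq_star (h.apply _ (summable_sq_star hx)))

end PosDef

theorem D0Data.IsMultiplier.boundedHermitian {D : D0Data} (hD : D.Valid) {K : Matrix ℕ ℕ ℂ}
    (hK : D.IsMultiplier K) : BoundedHermitian K := by
  cases D with
  | moment P => obtain ⟨α, hα, rfl⟩ := hK; exact .rankOne hα
  | trace p =>
    obtain ⟨α, rfl⟩ := hK
    have := BoundedHermitian.diagonal (α := fun _ => α ^ 2) (C := |α ^ 2|) fun _ => le_rfl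
    rwa [Matrix.smul_one_eq_diagonal]
  | diagonal p =>
    obtain ⟨α, ⟨C, hC⟩, rfl⟩ := hK
    refine .diagonal (C := C ^ 2) fun k => ?_
    rw [abs_pow]
    exact pow_le_pow_left₀ (abs_nonneg _) (hC k) 2
  | scalar B p =>
    obtain ⟨α, rfl⟩ := hK
    obtain ⟨hB, C, hC⟩ := hD
    exact (boundedHermitian_of_posDef hB hC).smul_transpose _

/-! ### The equation of the class at a fixed frequency -/

/-- Interchange of summation in `pᵀ Aᵀ s`. -/
theorem tsum_mul_tsum_comm {ι κ : Type*} {A : ι → κ → ℂ}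
    (hA : Summable fun p : ι × κ => ‖A p.1 p.2‖ ^ 2) {p : κ → ℂ} (hp : Summable fun i => ‖p i‖ ^ 2)
    {s : ι → ℂ} (hs : Summable fun i => ‖s i‖ ^ 2) :
    ∑' i, p i * ∑' k, A k i * s k = ∑' k, (∑' i, A k i * p i) * s k := by
  have h1 : Summable fun q : ι × κ => ‖s q.1 * p q.2‖ ^ 2 := by
    simp only [norm_mul, mul_pow]
    exact hs.mul_of_nonneg hp (fun _ => by positivity) (fun _ => by positivity)
  have h2 : Summable fun q : ι × κ => A q.1 q.2 * (s q.1 * p q.2) := summable_mul_of_sq' hA h1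
  have h3 := Summable.tsum_comm (f := fun k i => A k i * (s k * p i)) h2
  calc ∑' i, p i * ∑' k, A k i * s k = ∑' i, ∑' k, A k i * (s k * p i) := by
        refine tsum_congr fun i => ?_
        rw [← tsum_mul_left]
        exact tsum_congr fun k => by ring
    _ = _ := by
        rw [h3]
        refine tsum_congr fun k => ?_
        rw [← tsum_mul_right]
        exact tsum_congr fun i => by ring

section FixedFrequency

variable {κ : Type*} {Th T0 : ℕ → κ → ℂ} {Ps : κ → ℕ → ℂ} {w : ℂ} {c : κ → ℂ} {K : Matrix ℕ ℕ ℂ}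

/-- The multiplier equation with an invertible factor. -/
theorem multiplier_eq_of_inverse [DecidableEq κ] (hK : BoundedHermitian K) (hw : w ≠ 0)
    (hTh : Summable fun p : ℕ × κ => ‖Th p.1 p.2‖ ^ 2) (h0 : ∀ n i, Th n i = w * T0 n i)
    (hcol : ∀ n, Summable fun i => ‖Ps i n‖ ^ 2)
    (hinv : ∀ n m, ∑' i, Th n i * Ps i m = if n = m then 1 else 0)
    (heq : ∀ i j, c i * conj (c j) = ∑' k, T0 k i * ∑' n, K k n * conj (T0 n j)) :
    (Summable fun n => ‖∑' i, Ps i n * c i‖ ^ 2) ∧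
    (∀ i, ∑' n, Th n i * ∑' j, Ps j n * c j = c i) ∧
    ∀ n m, K n m = (‖w‖ ^ 2 : ℝ) * ((∑' i, Ps i n * c i) * conj (∑' i, Ps i m * c i)) := by
  have hT0 : Summable fun p : ℕ × κ => ‖T0 p.1 p.2‖ ^ 2 := by
    refine (summable_sq_mul w⁻¹ hTh).congr fun p => ?_
    rw [h0, inv_mul_cancel_left₀ hw]
  set s : κ → ℕ → ℂ := fun j k => ∑' n, K k n * conj (T0 n j) with hs
  have hsS : ∀ j, Summable fun k => ‖s j k‖ ^ 2 := fun j =>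
    hK.apply _ (summable_sq_star (summable_col hT0 j))
  have hinv0 : ∀ n m, ∑' i, T0 n i * Ps i m = if n = m then w⁻¹ else 0 := fun n m => by
    have := hinv n m
    simp_rw [h0, mul_assoc, tsum_mul_left] at this
    split_ifs at this ⊢ with h
    · exact eq_inv_of_mul_eq_one_right this
    · exact (mul_eq_zero.1 this).resolve_left hw
  -- The class equation multiplied by Ψ in the index `i`: the relation ΘΨ = E removes the left
  -- factor Θ⁰, so that each column of K times the conjugate of Θ⁰ is a multiple of Ψᵀc.
  have hsv : ∀ j n, s j n = w * conj (c j) * ∑' i, Ps i n * c i := fun j n => by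
    have h := tsum_mul_tsum_comm hT0 (hcol n) (hsS j)
    have e1 : ∑' i, Ps i n * ∑' k, T0 k i * s j k = conj (c j) * ∑' i, Ps i n * c i := by
      rw [← tsum_mul_left]
      refine tsum_congr fun i => ?_
      rw [← heq i j]; ring
    have e2 : ∑' k, (∑' i, T0 k i * Ps i n) * s j k = w⁻¹ * s j n := by
      rw [tsum_eq_single n fun k hk => by rw [hinv0, if_neg hk, zero_mul]]
      rw [hinv0, if_pos rfl]
    rw [e1, e2] at h
    rw [mul_assoc, h, mul_inv_cancel_left₀ hw]
  -- The same cancellation on the right, with conjugates. The two factors w and w̄ combine to |w|².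
  have hKv : ∀ n m, K n m = (‖w‖ ^ 2 : ℝ) *
      ((∑' i, Ps i n * c i) * conj (∑' i, Ps i m * c i)) := fun n m => by
    have h := tsum_mul_tsum_comm (A := fun k i => conj (T0 k i)) (by simpa using hT0)
      (p := fun i => conj (Ps i m)) (summable_sq_star (hcol m)) (hK.row n)
    have e1 : ∑' i, conj (Ps i m) * ∑' k, conj (T0 k i) * K n k =
        w * (∑' i, Ps i n * c i) * conj (∑' i, Ps i m * c i) := by
      rw [Complex.conj_tsum, ← tsum_mul_left]
      refine tsum_congr fun i => ?_
      have : ∑' k, conj (T0 k i) * K n k = s i n := tsum_congr fun k => mul_comm _ _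
      rw [this, hsv, map_mul]; ring
    have e2 : ∑' k, (∑' i, conj (T0 k i) * conj (Ps i m)) * K n k = conj w⁻¹ * K n m := by
      have : ∀ k, ∑' i, conj (T0 k i) * conj (Ps i m) = conj (if k = m then w⁻¹ else 0) :=
        fun k => by rw [← hinv0, Complex.conj_tsum]; simp
      simp_rw [this]
      rw [tsum_eq_single m fun k hk => by rw [if_neg hk]; simp]
      rw [if_pos rfl]
    rw [e1, e2] at h
    have hw' : conj w ≠ 0 := by simpa using hw
    rw [map_inv₀] at h
    have h2 : K n m = conj w * (w * (∑' i, Ps i n * c i) * conj (∑' i, Ps i m * c i)) := by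
      rw [h, mul_inv_cancel_left₀ hw']
    rw [h2]
    have h3 : ((‖w‖ ^ 2 : ℝ) : ℂ) = conj w * w := by rw [Complex.conj_mul']; push_cast; rfl
    rw [h3]; ring
  -- If some c_j ≠ 0, then Ψᵀc is a multiple of the column `s j`, which is square summable because K
  -- is bounded. Its image under Θᵀ is then read off from the class equation.
  by_cases hc : ∀ j, c j = 0
  · exact ⟨by simp [hc], by simp [hc], hKv⟩
  · push Not at hc
    obtain ⟨j, hj⟩ := hc
    have hj' : conj (c j) ≠ 0 := by simpa using hj
    have hv : ∀ n, ∑' i, Ps i n * c i = (w * conj (c j))⁻¹ * s j n := fun n => by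
      rw [hsv, inv_mul_cancel_left₀ (mul_ne_zero hw hj')]
    refine ⟨?_, fun i => ?_, hKv⟩
    · simp_rw [hv]
      exact summable_sq_mul _ (hsS j)
    · simp_rw [hv, h0]
      have : ∀ n, w * T0 n i * ((w * conj (c j))⁻¹ * s j n) =
          (conj (c j))⁻¹ * (T0 n i * s j n) := fun n => by
        field_simp
      simp_rw [this, tsum_mul_left]
      rw [← heq i j]
      field_simp

/-- For finitely many innovations ΨΘ = E gives ΘᵀΨᵀ = E, by exchanging a finite sum with a series.
For M = ∞ the class equation takes the place of this exchange. -/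
theorem apply_of_leftInverse [Fintype κ] [DecidableEq κ]
    (hTh : Summable fun p : ℕ × κ => ‖Th p.1 p.2‖ ^ 2)
    (hrow : ∀ i, Summable fun n => ‖Ps i n‖ ^ 2)
    (hinv : ∀ i j, ∑' n, Ps i n * Th n j = if i = j then 1 else 0) (c : κ → ℂ) :
    (Summable fun n => ‖∑' i, Ps i n * c i‖ ^ 2) ∧
    ∀ i, ∑' n, Th n i * ∑' j, Ps j n * c j = c i := by
  have e : ∀ n, ∑' i, Ps i n * c i = (∑ i, c i • toL2 (Ps i) (hrow i) : L2seq ℕ) n := fun n => by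
    rw [tsum_fintype, lp.coeFn_sum, Finset.sum_apply]
    exact Finset.sum_congr rfl fun i _ => mul_comm _ _
  refine ⟨?_, fun i => ?_⟩
  · simp_rw [e]; exact L2seq.summable _
  · simp_rw [tsum_fintype, Finset.mul_sum]
    rw [Summable.tsum_finsetSum fun j _ => ?_]
    · rw [Finset.sum_eq_single i]
      · have : ∀ n, Th n i * (Ps i n * c i) = c i * (Ps i n * Th n i) := fun n => by ring
        simp_rw [this, tsum_mul_left, hinv]; simp
      · intro j _ hj
        have : ∀ n, Th n i * (Ps j n * c j) = c j * (Ps j n * Th n i) := fun n => by ring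
        simp_rw [this, tsum_mul_left, hinv, if_neg hj, mul_zero]
      · simp
    · exact summable_mul_of_sq' (summable_col hTh i)
        ((summable_sq_mul (c j) (hrow j)).congr fun n => by rw [mul_comm])

end FixedFrequency

/-- If `O` factors through `S'` with both maps onto the same finite-dimensional space, the kernels
coincide. -/
theorem ker_le_of_surjective {E G : Type*} [AddCommGroup E] [Module ℂ E] [AddCommGroup G]
    [Module ℂ G] [FiniteDimensional ℂ G] {S O : E →ₗ[ℂ] G} (hO : Function.Surjective O)
    (hS : Function.Surjective S) (h : ∀ x, S x = 0 → O x = 0) {x : E} (hx : O x = 0) : S x = 0 := by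
  obtain ⟨R, hR⟩ := S.exists_rightInverse_of_surjective (LinearMap.range_eq_top.2 hS)
  have hR' : ∀ y, S (R y) = y := fun y => congrArg (fun φ : G →ₗ[ℂ] G => φ y) hR
  -- `O` depends only on the image under `S`, so O = (O R) S with a linear right inverse R of S. The
  -- map O R is onto a finite-dimensional space, hence injective.
  have hfac : ∀ x, O (R (S x)) = O x := fun x => by
    rw [← sub_eq_zero, ← map_sub]
    exact h _ (by rw [map_sub, hR', sub_self])
  have hsurj : Function.Surjective (O ∘ₗ R) := fun y => by
    obtain ⟨x, rfl⟩ := hO y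
    exact ⟨S x, hfac x⟩
  have hinj := LinearMap.injective_iff_surjective.2 hsurj
  refine hinj ?_
  rw [map_zero]
  exact (hfac x).trans hx

/-! ### Factors of finite rank at a fixed frequency -/

section FixedFrequency

variable {κ : Type*} {Th Th' Om T0 : ℕ → κ → ℂ} {Ps Ps' : κ → ℕ → ℂ} {w : ℂ} {W : ℝ} {c : κ → ℂ}
  {K f₀ f g : Matrix ℕ ℕ ℂ}

theorem surjective_of_unit [Fintype κ] [DecidableEq κ] {E : Type*} [NormedAddCommGroup E]
    [InnerProductSpace ℂ E] (S : E →L[ℂ] L2seq κ)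
    (h : ∀ i, ∃ x, S x = unit i) : Function.Surjective S := by
  choose x hx using h
  intro y
  refine ⟨∑ i, y i • x i, ?_⟩
  rw [map_sum]
  simp_rw [map_smul, hx]
  exact (tsum_fintype _).symm.trans (hasSum_unit y).tsum_eq

instance L2seq.finiteDimensional [Finite κ] : FiniteDimensional ℂ (L2seq κ) :=
  Module.Finite.of_injective
    ({ toFun := fun x => x, map_add' := fun _ _ => rfl, map_smul' := fun _ _ => rfl } :
      L2seq κ →ₗ[ℂ] (κ → ℂ)) fun _ _ h => lp.ext h

theorem hsOp_row_eq_unit [DecidableEq κ] (hTh : Summable fun p : ℕ × κ => ‖Th p.1 p.2‖ ^ 2)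
    (hrow : ∀ i, Summable fun n => ‖Ps i n‖ ^ 2)
    (hinv : ∀ i j, ∑' n, Ps i n * Th n j = if i = j then 1 else 0) (i : κ) :
    hsOp Th hTh (toL2 (Ps i) (hrow i)) = unit i := by
  refine lp.ext (funext fun j => ?_)
  rw [hsOp_apply, unit_apply]
  simp_rw [toL2_apply, mul_comm (Th _ j)]
  rw [hinv]
  simp [eq_comm]

/-- The multiplier equation for a factor of finite rank. -/
theorem multiplier_quad_of_finite [Fintype κ] [DecidableEq κ] (H : PointData W f₀ g Th Om)
    (H' : PointData W f g Th' Om) (hw : ‖w‖ ^ 2 = W) (h0 : ∀ n i, Th n i = w * T0 n i)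
    (hrow : ∀ i, Summable fun n => ‖Ps i n‖ ^ 2)
    (hinv : ∀ i j, ∑' n, Ps i n * Th n j = if i = j then 1 else 0)
    (hrow' : ∀ i, Summable fun n => ‖Ps' i n‖ ^ 2)
    (hinv' : ∀ i j, ∑' n, Ps' i n * Th' n j = if i = j then 1 else 0)
    (hO : Function.Surjective (hsOp Om H.omsum)) (hK : BoundedHermitian K)
    (heq : ∀ i j, c i * conj (c j) = ∑' k, T0 k i * ∑' n, K k n * conj (T0 n j)) :
    W * quad f (fun n => ∑' i, Ps i n * c i) = (∑' k, ∑' n, K n k * f n k).re := by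
  set S := hsOp Th H.thsum with hSdef
  set S' := hsOp Th' H'.thsum with hSdef'
  set O := hsOp Om H.omsum with hOdef
  set ψ : κ → L2seq ℕ := fun i => toL2 (Ps i) (hrow i) with hψ
  have hSψ : ∀ i, S (ψ i) = unit i := hsOp_row_eq_unit H.thsum hrow hinv
  have hS' : Function.Surjective S' :=
    surjective_of_unit S' fun i => ⟨_, hsOp_row_eq_unit H'.thsum hrow' hinv' i⟩
  have hOS : ∀ x, S x = 0 → O x = 0 := fun x hx => by
    have := H.norm_le x
    rw [← hSdef, ← hOdef, hx, norm_zero] at this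
    exact norm_le_zero_iff.1 this
  have hOS' : ∀ x, S' x = 0 → O x = 0 := fun x hx => by
    have := H'.norm_le x
    rw [← hSdef', hx, norm_zero] at this
    exact norm_le_zero_iff.1 this
  -- Domination gives ker S ⊂ ker O and ker S' ⊂ ker O. Both `O` and `S'` are onto the same
  -- finite-dimensional space, so ker O ⊂ ker S' as well.
  have hSS' : ∀ x, S x = 0 → S' x = 0 := fun x hx =>
    ker_le_of_surjective (S := (S' : L2seq ℕ →ₗ[ℂ] L2seq κ)) (O := (O : L2seq ℕ →ₗ[ℂ] L2seq κ))
      hO hS' hOS' (hOS x hx)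
  -- The unit vector and its expansion in the `ψ i` have the same image under `S`; the inclusions of
  -- kernels transfer this to `S'` and `O`.
  have hr : ∀ n, S (unit n - ∑ i, Th n i • ψ i) = 0 := fun n => by
    rw [map_sub, map_sum, sub_eq_zero]
    simp_rw [map_smul, hSψ]
    have := hasSum_unit (S (unit n))
    rw [← this.tsum_eq, tsum_fintype]
    exact Finset.sum_congr rfl fun i _ => by rw [hSdef, hsOp_unit]
  have hS'e : ∀ n, S' (unit n) = ∑ i, Th n i • S' (ψ i) := fun n => by
    have := hSS' _ (hr n)
    rw [map_sub, map_sum, sub_eq_zero] at this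
    simpa only [map_smul] using this
  have hOe : ∀ n, O (unit n) = ∑ i, Th n i • O (ψ i) := fun n => by
    have := hOS _ (hr n)
    rw [map_sub, map_sum, sub_eq_zero] at this
    simpa only [map_smul] using this
  -- The compression of W f to the vectors `ψ i`. The expansions just found give W f = Θ X Θ*,
  -- although Θ is the factor belonging to the other density.
  set X : κ → κ → ℂ := fun i j => inner ℂ (S' (ψ j)) (S' (ψ i)) - inner ℂ (O (ψ j)) (O (ψ i)) with hX
  have form : ∀ x y : κ → ℂ, inner ℂ (∑ j, y j • S' (ψ j)) (∑ i, x i • S' (ψ i)) -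
      inner ℂ (∑ j, y j • O (ψ j)) (∑ i, x i • O (ψ i)) =
      ∑ i, ∑ j, x i * conj (y j) * X i j := fun x y => by
    simp_rw [sum_inner, inner_sum, inner_smul_left, inner_smul_right]
    rw [Finset.sum_comm, Finset.sum_comm (f := fun j i => conj (y j) * (x i * inner ℂ (O (ψ j)) (O (ψ i)))), ← Finset.sum_sub_distrib]
    refine Finset.sum_congr rfl fun i _ => ?_
    rw [← Finset.sum_sub_distrib]
    refine Finset.sum_congr rfl fun j _ => ?_
    rw [hX]; ring
  have hf : ∀ n k, (W : ℂ) * f n k = ∑ i, ∑ j, Th n i * conj (Th k j) * X i j := fun n k => by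
    rw [← form, ← hS'e, ← hS'e, ← hOe, ← hOe, hSdef', hOdef, hsOp_inner_unit, hsOp_inner_unit,
      ← H'.thfac, ← H'.omfac]
    ring
  -- the quadratic form
  have hv : (fun n => ∑' i, Ps i n * c i) = ((∑ i, c i • ψ i : L2seq ℕ) : ℕ → ℂ) := by
    funext n
    rw [tsum_fintype, lp.coeFn_sum, Finset.sum_apply]
    exact Finset.sum_congr rfl fun i _ => mul_comm _ _
  have hq : W * quad f (fun n => ∑' i, Ps i n * c i) =
      (∑ i, ∑ j, c i * conj (c j) * X i j).re := by
    rw [hv, H'.quad_f, ← form, ← inner_self_eq_norm_sq (𝕜 := ℂ), ← inner_self_eq_norm_sq (𝕜 := ℂ)]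
    rw [← hSdef', ← hOdef, map_sum, map_sum]
    simp_rw [map_smul]
    simp
  rw [hq]
  congr 1
  -- The conjugated class equation, with K Hermitian and w w̄ = W.
  have hT : ∀ i j, ∑' k, conj (Th k j) * ∑' n, K n k * Th n i = W * (c i * conj (c j)) := by
    intro i j
    have h1 := congrArg conj (heq j i)
    rw [map_mul, Complex.conj_conj, Complex.conj_tsum] at h1
    rw [mul_comm (c i), h1, ← hw, ← tsum_mul_left]
    refine tsum_congr fun k => ?_
    rw [map_mul, Complex.conj_tsum, ← tsum_mul_left, ← tsum_mul_left, ← tsum_mul_left]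
    refine tsum_congr fun n => ?_
    rw [map_mul, Complex.conj_conj, hK.herm, h0, h0, map_mul]
    have h3 : ((‖w‖ ^ 2 : ℝ) : ℂ) = conj w * w := by rw [Complex.conj_mul']; push_cast; rfl
    rw [h3]; ring
  have hThS := H.thsum
  have s1 : ∀ i k, Summable fun n => K n k * Th n i := fun i k =>
    summable_mul_of_sq' (hK.col k) (summable_col hThS i)
  have s2 : ∀ i, Summable fun k => ‖∑' n, K n k * Th n i‖ ^ 2 := fun i => by
    have := hK.apply _ (summable_sq_star (summable_col hThS i))
    refine this.congr fun k => ?_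
    rw [← RCLike.norm_conj, Complex.conj_tsum]
    simp [hK.herm]
  have s3 : ∀ i j, Summable fun k => conj (Th k j) * ∑' n, K n k * Th n i := fun i j =>
    summable_mul_of_sq' (summable_sq_star (summable_col hThS j)) (s2 i)
  have main : (W : ℂ) * ∑' k, ∑' n, K n k * f n k =
      W * ∑ i, ∑ j, c i * conj (c j) * X i j := by
    rw [← tsum_mul_left]
    calc ∑' k, (W : ℂ) * ∑' n, K n k * f n k
        = ∑' k, ∑ i, ∑ j, X i j * (conj (Th k j) * ∑' n, K n k * Th n i) := by
          refine tsum_congr fun k => ?_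
          rw [← tsum_mul_left]
          have : ∀ n, (W : ℂ) * (K n k * f n k) =
              ∑ i, ∑ j, X i j * conj (Th k j) * (K n k * Th n i) := fun n => by
            rw [mul_left_comm, hf, Finset.mul_sum]
            refine Finset.sum_congr rfl fun i _ => ?_
            rw [Finset.mul_sum]
            exact Finset.sum_congr rfl fun j _ => by ring
          simp_rw [this]
          rw [Summable.tsum_finsetSum fun i _ => summable_sum fun j _ => (s1 i k).mul_left _]
          refine Finset.sum_congr rfl fun i _ => ?_
          rw [Summable.tsum_finsetSum fun j _ => (s1 i k).mul_left _]
          refine Finset.sum_congr rfl fun j _ => ?_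
          rw [tsum_mul_left, mul_assoc]
      _ = ∑ i, ∑ j, X i j * (W * (c i * conj (c j))) := by
          rw [Summable.tsum_finsetSum fun i _ => summable_sum fun j _ => (s3 i j).mul_left _]
          refine Finset.sum_congr rfl fun i _ => ?_
          rw [Summable.tsum_finsetSum fun j _ => (s3 i j).mul_left _]
          refine Finset.sum_congr rfl fun j _ => ?_
          rw [tsum_mul_left, hT]
      _ = _ := by
          rw [Finset.mul_sum]
          refine Finset.sum_congr rfl fun i _ => ?_
          rw [Finset.mul_sum]
          exact Finset.sum_congr rfl fun j _ => by ring
  exact (mul_left_cancel₀ (by exact_mod_cast H.W_pos.ne') main).symm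

theorem multiplier_quad_of_rankOne {v : ℕ → ℂ} (hf : f.PosSemidef)
    (hs : Summable fun k => (f k k).re) (hv : Summable fun n => ‖v n‖ ^ 2)
    (hK : ∀ n m, K n m = (W : ℂ) * (v n * conj (v m))) :
    W * quad f v = (∑' k, ∑' n, K n k * f n k).re := by
  have h1 := quad_summable hf hs hv
  have h2 : Summable fun p : ℕ × ℕ => v p.2 * f p.2 p.1 * conj (v p.1) :=
    (Equiv.prodComm ℕ ℕ).summable_iff.2 h1
  have e : ∑' k, ∑' n, K n k * f n k = W * ∑' p : ℕ × ℕ, v p.1 * f p.1 p.2 * conj (v p.2) := by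
    rw [← (Equiv.prodComm ℕ ℕ).tsum_eq, ← tsum_mul_left]
    refine Eq.trans ?_ (h2.mul_left (W : ℂ)).tsum_prod.symm
    refine tsum_congr fun k => tsum_congr fun n => ?_
    rw [hK]; ring
  rw [e, Complex.re_ofReal_mul, quad]

end FixedFrequency

theorem finite_idx {M : ℕ∞} (hM : M ≠ ⊤) : Finite (Idx M) := by
  lift M to ℕ using hM
  refine Finite.of_injective (β := Fin M) (fun m => ⟨m.1, by exact_mod_cast m.2⟩) fun a b h => ?_
  simpa [Subtype.ext_iff] using h

/-- The transposed factor of a canonical factorization of finite rank is onto a.e. -/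
theorem IsCanonicalFactor.ae_surjective {M : ℕ∞} [Finite (Idx M)] {S : ℝ → Matrix ℕ ℕ ℂ}
    {Th : ℝ → Matrix ℕ (Idx M) ℂ} (H : IsCanonicalFactor S Th) :
    ∀ᵐ l ∂freqMeasure, ∀ hs : Summable fun p : ℕ × Idx M => ‖Th l p.1 p.2‖ ^ 2,
      Function.Surjective (hsOp (Th l) hs) := by
  have := Fintype.ofFinite (Idx M)
  have key : ∀ i₀ : Idx M, ∀ᵐ l ∂freqMeasure,
      ∀ hs : Summable fun p : ℕ × Idx M => ‖Th l p.1 p.2‖ ^ 2, ∃ x, hsOp (Th l) hs x = unit i₀ := by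
    intro i₀
    -- Errors with finite sum: the pointwise errors are then summable a.e., so the approximations
    -- converge a.e. without passing to a subsequence.
    obtain ⟨ε, hε, hε'⟩ := ENNReal.exists_pos_sum_of_countable (ε := 1) (by simp) ℕ
    have hex : ∀ N, ∃ q : (ℕ × ℕ) →₀ ℂ,
        ∫⁻ l, ∑' i, ‖pTh Th q l i - (if i = i₀ then 1 else 0)‖ₑ ^ 2 ∂freqMeasure < ε N :=
      fun N => H.innovation i₀ (ε N) (by exact_mod_cast hε N)
    choose q hq using hex
    have hδ : CompMeas fun (_ : ℝ) (i : Idx M) => if i = i₀ then (1 : ℂ) else 0 :=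
      fun _ => aemeasurable_const
    have hm : ∀ N, AEMeasurable (fun l => ∑' i, ‖pTh Th (q N) l i -
        (if i = i₀ then 1 else 0)‖ₑ ^ 2) freqMeasure := fun N =>
      CompMeas.tsum_meas (u := fun l i => pTh Th (q N) l i - (if i = i₀ then 1 else 0))
        ((pTh_compMeas H (q N)).sub hδ)
    have hlt : ∫⁻ l, ∑' N, ∑' i, ‖pTh Th (q N) l i - (if i = i₀ then 1 else 0)‖ₑ ^ 2
        ∂freqMeasure ≠ ∞ := by
      rw [lintegral_tsum hm]
      exact ((ENNReal.tsum_le_tsum fun N => (hq N).le).trans_lt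
        (hε'.trans ENNReal.one_lt_top)).ne
    filter_upwards [ae_lt_top' (AEMeasurable.tsum hm) hlt] with l hl hs
    have h0 := ENNReal.tendsto_atTop_zero_of_tsum_ne_top hl.ne
    have e : ∀ N, ∑' i, ‖pTh Th (q N) l i - (if i = i₀ then 1 else 0)‖ₑ ^ 2 =
        ENNReal.ofReal (‖hsOp (Th l) hs (toL2 _ (pvec_summable (q N) l)) - unit i₀‖ ^ 2) := fun N => by
      rw [L2seq.enorm_sq]
      refine tsum_congr fun i => ?_
      rw [lp.coeFn_sub, Pi.sub_apply, hsOp_toL2, tmul_pvec, unit_apply]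
    simp_rw [e] at h0
    have h1 := (ENNReal.tendsto_toReal ENNReal.zero_ne_top).comp h0
    have h2 : Tendsto (fun N => ‖hsOp (Th l) hs (toL2 _ (pvec_summable (q N) l)) - unit i₀‖)
        atTop (𝓝 0) := by
      have h3 := (Real.continuous_sqrt.tendsto _).comp h1
      simpa [Function.comp_def, ENNReal.toReal_ofReal, Real.sqrt_sq] using h3
    have h4 := tendsto_iff_norm_sub_tendsto_zero.2 h2
    -- The range lies in a finite-dimensional space, hence is closed and contains the limit `unit
    -- i₀`.
    have hcl : IsClosed ((LinearMap.range (hsOp (Th l) hs : L2seq ℕ →ₗ[ℂ] L2seq (Idx M)) :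
        Submodule ℂ (L2seq (Idx M))) : Set (L2seq (Idx M))) :=
      Submodule.closed_of_finiteDimensional _
    exact hcl.mem_of_tendsto h4 (Eventually.of_forall fun N => ⟨_, rfl⟩)
  filter_upwards [ae_all_iff.2 key] with l hl hs
  exact surjective_of_unit _ fun i => hl i hs

/-! ### The characteristic built from a multiplier -/

/-- A solution of the equation of the class. -/
structure Multiplier (d τ : ℕ) (T : ℝ) (a : ℝ → ℂ) {M : ℕ∞} (f₀ g : ℝ → Matrix ℕ ℕ ℂ)
    (Om Th : ℝ → Matrix ℕ (Idx M) ℂ) (Ps : ℝ → Matrix (Idx M) ℕ ℂ) (w : ℝ → ℂ)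
    (T0 : ℝ → Matrix ℕ (Idx M) ℂ) (c : ℝ → Idx M → ℂ) (K : Matrix ℕ ℕ ℂ) : Prop where
  ctx : Ctx d τ T a f₀ g Om Th Ps
  min : MinimalityCondition Th Ps
  wsq_eq : ∀ᵐ l ∂freqMeasure, ‖w l‖ ^ 2 = wsq d τ l
  th_eq : ∀ᵐ l ∂freqMeasure, Th l = w l • T0 l
  isH2 : ∀ i, IsH2 fun l => c l i
  coef_eq : ∀ (i : Idx M) (m : ℕ), coef (fun l => c l i) (m : ℤ) = psiC d τ T a Om Ps m i
  bdd : BoundedHermitian K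
  eqn : ∀ᵐ l ∂freqMeasure, ∀ i j,
      c l i * conj (c l j) = ∑' k, T0 l k i * ∑' n, K k n * conj (T0 l n j)

/-- `Ψᵀ c`. -/
def psTc {M : ℕ∞} (Ps : ℝ → Matrix (Idx M) ℕ ℂ) (c : ℝ → Idx M → ℂ) (l : ℝ) (n : ℕ) : ℂ :=
  ∑' i, Ps l i n * c l i

namespace Multiplier

variable {d τ : ℕ} {T : ℝ} {a : ℝ → ℂ} {M : ℕ∞} {f₀ f g : ℝ → Matrix ℕ ℕ ℂ}
  {Om Th Th' : ℝ → Matrix ℕ (Idx M) ℂ} {Ps Ps' : ℝ → Matrix (Idx M) ℕ ℂ} {w : ℝ → ℂ}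
  {T0 : ℝ → Matrix ℕ (Idx M) ℂ} {c : ℝ → Idx M → ℂ} {K : Matrix ℕ ℕ ℂ}

theorem cMeas (X : Multiplier d τ T a f₀ g Om Th Ps w T0 c K) : CompMeas c :=
  fun i => (X.isH2 i).1.1.aemeasurable

theorem vMeas (X : Multiplier d τ T a f₀ g Om Th Ps w T0 c K) : CompMeas (psTc Ps c) :=
  fun n => AEMeasurable.tsum fun i => (X.ctx.psMeas i n).mul (X.cMeas i)

/-- Only the components of c are assumed to be square integrable. The total energy is finite because
by Parseval it is the norm of ψ̄C. -/
theorem sqInt_c_lt (X : Multiplier d τ T a f₀ g Om Th Ps w T0 c K) : sqInt c < ∞ := by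
  have h : ENNReal.ofReal (1 / (2 * Real.pi)) * sqInt c = psiCNormSq d τ T a Om Ps := by
    rw [sqInt_eq_tsum X.cMeas, ← ENNReal.tsum_mul_left, psiCNormSq, ENNReal.tsum_comm]
    refine tsum_congr fun i => ?_
    rw [tsum_coef_enorm_sq (X.isH2 i).1, tsum_of_nat_of_neg_add_one
      (f := fun k : ℤ => ‖coef (fun l => c l i) k‖ₑ ^ 2) ENNReal.summable ENNReal.summable]
    have : ∀ m : ℕ, ‖coef (fun l => c l i) (-((m : ℤ) + 1))‖ₑ ^ 2 = 0 := fun m => by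
      rw [(X.isH2 i).2 _ (by omega)]; simp
    simp_rw [this, tsum_zero, add_zero, X.coef_eq]
  have h2 : ENNReal.ofReal (1 / (2 * Real.pi)) * sqInt c < ∞ :=
    h ▸ lt_of_le_of_lt le_add_self X.ctx.rho_add_psiCNormSq_lt
  by_contra h3
  rw [not_lt, top_le_iff] at h3
  rw [h3, ENNReal.mul_top c0_pos.ne'] at h2
  exact lt_irrefl _ h2

theorem ae_cols (X : Multiplier d τ T a f₀ g Om Th Ps w T0 c K) :
    ∀ᵐ l ∂freqMeasure, ∀ n, Summable fun i => ‖Ps l i n‖ ^ 2 :=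
  ae_all_iff.2 fun n => ae_summable_of_sqInt (u := fun l i => Ps l i n)
    (fun i => X.ctx.psMeas i n) (X.min.integrable n)

theorem ae_w_ne (X : Multiplier d τ T a f₀ g Om Th Ps w T0 c K) :
    ∀ᵐ l ∂freqMeasure, w l ≠ 0 := by
  filter_upwards [X.wsq_eq, ae_wsq_pos d X.ctx.hτ] with l h1 h2 h3
  rw [← h1, h3] at h2
  simp at h2

/-- The infinite case uses ΘΨ = E together with the class equation; the finite case only uses ΨΘ =
E. -/
theorem ae_solution (X : Multiplier d τ T a f₀ g Om Th Ps w T0 c K) :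
    ∀ᵐ l ∂freqMeasure, (Summable fun n => ‖psTc Ps c l n‖ ^ 2) ∧
      ∀ i, tmul Th (psTc Ps c) l i = c l i := by
  by_cases hM : M = ⊤
  · filter_upwards [X.ae_cols, X.ae_w_ne, X.th_eq, X.eqn, X.min.inverse hM, X.ctx.ae_data]
      with l h1 h2 h3 h4 h5 h6
    have := multiplier_eq_of_inverse X.bdd h2 h6.thsum (fun n i => by rw [h3]; rfl) h1 h5 h4
    exact ⟨this.1, this.2.1⟩
  · have := finite_idx hM
    have := Fintype.ofFinite (Idx M)
    filter_upwards [X.ctx.ae_rows, X.ctx.hpair.leftInv, X.ctx.ae_data] with l h1 h2 h3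
    exact apply_of_leftInverse h3.thsum h1 h2 (c l)

/-- The multiplier is tied to the factor of f₀, yet the identity holds for every density with a
factor pair. For M = ∞ because K = W v v* with v = Ψᵀc; for finite M because the ranks agree, the
surjectivity of Ωᵀ coming from the canonicity of Ω. -/
theorem ae_quad (X : Multiplier d τ T a f₀ g Om Th Ps w T0 c K)
    (C' : Ctx d τ T a f g Om Th' Ps') : ∀ᵐ l ∂freqMeasure,
      wsq d τ l * quad (f l) (psTc Ps c l) = (∑' k, ∑' n, K n k * f l n k).re := by
  by_cases hM : M = ⊤
  · filter_upwards [X.ae_cols, X.ae_w_ne, X.th_eq, X.eqn, X.min.inverse hM, X.ctx.ae_data,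
      C'.ae_data, X.wsq_eq] with l h1 h2 h3 h4 h5 h6 h7 h8
    have := multiplier_eq_of_inverse X.bdd h2 h6.thsum (fun n i => by rw [h3]; rfl) h1 h5 h4
    rw [h8] at this
    exact multiplier_quad_of_rankOne h7.fpos h7.fsum this.1 this.2.2
  · have := finite_idx hM
    have := Fintype.ofFinite (Idx M)
    filter_upwards [X.ctx.ae_rows, X.ctx.hpair.leftInv, X.ctx.ae_data, C'.ae_rows,
      C'.hpair.leftInv, C'.ae_data, X.th_eq, X.eqn, X.wsq_eq, X.ctx.hOm.ae_surjective]
      with l h1 h2 h3 h4 h5 h6 h7 h8 h9 h10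
    exact multiplier_quad_of_finite h3 h6 h9 (fun n i => by rw [h7]; rfl) h1 h2 h4 h5
      (h10 _) X.bdd h8

theorem char_compMeas (X : Multiplier d τ T a f₀ g Om Th Ps w T0 c K) :
    CompMeas (charFormula d τ T a Ps c) := fun n =>
  (measurable_wfun d τ).aemeasurable.mul ((Ctx.measB n).sub (X.vMeas n))

theorem char_summable (X : Multiplier d τ T a f₀ g Om Th Ps w T0 c K) :
    ∀ᵐ l ∂freqMeasure, Summable fun n => ‖charFormula d τ T a Ps c l n‖ ^ 2 := by
  filter_upwards [X.ae_solution] with l h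
  exact summable_sq_mul _ (summable_sq_sub (X.ctx.sqB l) h.1)

/-- Θᵀ(h⁰/w) = ΘᵀB − c, and both terms are limits of functions of the past. -/
theorem char_mem (X : Multiplier d τ T a f₀ g Om Th Ps w T0 c K) :
    charFormula d τ T a Ps c ∈ L20 d τ (fun l => f₀ l + g l) := by
  rw [X.ctx.mem_L20_iff X.char_compMeas X.char_summable]
  have hc : Approx Th c := approx_of_isH2 X.ctx.hTh X.cMeas X.sqInt_c_lt X.isH2
  have hBm : CompMeas (tmul Th (Bfun d τ T a)) := tmul_compMeas X.ctx.hTh Ctx.measB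
  refine (X.ctx.approx_B.add X.ctx.hTh hBm (hc.const_mul (-1))).congr ?_
  filter_upwards [X.ae_solution, ae_wfun_ne d X.ctx.hτ, X.ctx.tmul_sub_ae
    (Eventually.of_forall X.ctx.sqB) (X.ae_solution.mono fun l h => h.1)] with l h1 h2 h3 i
  have e : ∀ n, charFormula d τ T a Ps c l n / wfun d τ l =
      Bfun d τ T a l n - psTc Ps c l n := fun n => by
    rw [charFormula, mul_div_cancel_left₀ _ h2]; rfl
  have e2 : tmul Th (fun l n => charFormula d τ T a Ps c l n / wfun d τ l) l i =
      tmul Th (fun l n => Bfun d τ T a l n - psTc Ps c l n) l i := by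
    unfold tmul
    exact tsum_congr fun n => congrArg (Th l n i * ·) (e n)
  rw [e2, h3, h1.2]; ring

theorem mse_char (X : Multiplier d τ T a f₀ g Om Th Ps w T0 c K) :
    mse d τ T a (charFormula d τ T a Ps c) f₀ g = optMse d τ T a f₀ g := by
  have he : ∀ᵐ l ∂freqMeasure, ∀ i, tmul Th (psTc Ps c) l i = c l i :=
    X.ae_solution.mono fun l h => h.2
  have he' : ∀ i, (fun l => tmul Th (psTc Ps c) l i) =ᵐ[freqMeasure] fun l => c l i :=
    fun i => he.mono fun l h => h i
  rw [X.ctx.mse_eq_rho X.vMeas X.char_compMeas (X.ae_solution.mono fun l h => h.1)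
    (Eventually.of_forall fun l n => rfl) (fun i => (X.isH2 i).congr (he' i).symm)
    ((sqInt_congr he).trans_lt X.sqInt_c_lt), X.ctx.optMse_eq]
  have : ∀ i, ∀ m : ℕ, ‖coef (fun l => tmul Th (psTc Ps c) l i) (m : ℤ) -
      psiC d τ T a Om Ps m i‖ₑ ^ 2 = 0 := fun i m => by
    rw [coef_congr (he' i), X.coef_eq, sub_self]; simp
  simp_rw [this]
  simp

/-- Since wB − h⁰ = wΨᵀc, the signal error is the integral of the multiplier pairing, and the noise
error does not involve `f`. -/
theorem mse_char_eq (X : Multiplier d τ T a f₀ g Om Th Ps w T0 c K)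
    (C' : Ctx d τ T a f g Om Th' Ps') : mse d τ T a (charFormula d τ T a Ps c) f g =
      ENNReal.ofReal (1 / (2 * Real.pi)) *
        ∫⁻ l, ENNReal.ofReal (∑' k, ∑' n, K n k * f l n k).re ∂freqMeasure +
      normSq g (charFormula d τ T a Ps c) := by
  rw [mse, normSq]
  congr 2
  refine lintegral_congr_ae ?_
  filter_upwards [X.ae_quad C'] with l h
  rw [← h, ← norm_wfun_sq, ← quad_const_mul]
  congr 2
  funext n
  rw [charFormula, psTc]; ring

theorem ae_nonneg (X : Multiplier d τ T a f₀ g Om Th Ps w T0 c K)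
    (C' : Ctx d τ T a f g Om Th' Ps') :
    ∀ᵐ l ∂freqMeasure, 0 ≤ (∑' k, ∑' n, K n k * f l n k).re := by
  filter_upwards [X.ae_quad C', C'.ae_data] with l h h2
  rw [← h]
  exact mul_nonneg (wsq_nonneg d τ l) (quad_nonneg h2.fpos _)

end Multiplier

/-! ### The multiplier functional is constant on the classes -/

section Classes

variable {d τ : ℕ} {f : ℝ → Matrix ℕ ℕ ℂ}

theorem integral_eq_of_average {E : Type*} [NormedAddCommGroup E] [NormedSpace ℝ E] {x y : E}
    (h : (1 / (2 * Real.pi)) • x = y) : x = (2 * Real.pi) • y := by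
  rw [← h, smul_smul, mul_one_div_cancel (by positivity), one_smul]

theorem integrable_tsum_of_summable_integral_norm {α ι : Type*} [MeasurableSpace α]
    {μ : Measure α} [Countable ι] {F : ι → α → ℂ} (hF : ∀ i, Integrable (F i) μ)
    (hs : Summable fun i => ∫ x, ‖F i x‖ ∂μ) : Integrable (fun x => ∑' i, F i x) μ := by
  refine ⟨(AEMeasurable.tsum fun i => (hF i).1.aemeasurable).aestronglyMeasurable, ?_⟩
  refine lt_of_le_of_lt (lintegral_mono fun x => enorm_tsum_le_tsum_enorm) ?_
  rw [lintegral_tsum fun i => (hF i).1.enorm]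
  have : ∀ i, ∫⁻ x, ‖F i x‖ₑ ∂μ = ENNReal.ofReal (∫ x, ‖F i x‖ ∂μ) := fun i =>
    (ofReal_integral_norm_eq_lintegral_enorm (hF i)).symm
  simp_rw [this]
  exact hs.tsum_ofReal_lt_top

theorem trace_lintegral {p α : ℝ} (hf : IsSpectralDensity d τ f)
    (hc : (D0Data.trace p).Constraint f) :
    ∫⁻ l, ENNReal.ofReal (∑' k, ∑' n, (((α ^ 2 : ℝ) : ℂ) • (1 : Matrix ℕ ℕ ℂ)) n k * f l n k).re
      ∂freqMeasure = ENNReal.ofReal (α ^ 2 * ((2 * Real.pi) • p)) := by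
  obtain ⟨hi, hp⟩ := hc
  rw [← integral_eq_of_average (x := ∫ l, ∑' k, (f l k k).re ∂freqMeasure) hp,
    ← integral_const_mul, ofReal_integral_eq_lintegral_ofReal (hi.const_mul _)]
  · refine lintegral_congr_ae ?_
    filter_upwards [hf.kernel, hf.pos] with l h1 h2
    have e : ∀ k, ∑' n, (((α ^ 2 : ℝ) : ℂ) • (1 : Matrix ℕ ℕ ℂ)) n k * f l n k =
        ((α ^ 2 * (f l k k).re : ℝ) : ℂ) := fun k => by
      rw [tsum_eq_single k fun n hn => by simp [Matrix.one_apply_ne hn]]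
      rw [(posSemidef_diag_re h2 k).1]; simp
    simp_rw [e]
    rw [← Complex.ofReal_tsum, Complex.ofReal_re, tsum_mul_left]
  · filter_upwards [hf.pos] with l h2
    exact mul_nonneg (sq_nonneg _) (tsum_nonneg fun k => (posSemidef_diag_re h2 k).2)

theorem diagonal_lintegral {p α : ℕ → ℝ} {C : ℝ} (hα : ∀ k, |α k| ≤ C)
    (hf : IsSpectralDensity d τ f) (hc : (D0Data.diagonal p).Constraint f) :
    ∫⁻ l, ENNReal.ofReal (∑' k, ∑' n, (Matrix.diagonal fun k => ((α k ^ 2 : ℝ) : ℂ)) n k *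
      f l n k).re ∂freqMeasure = ∑' k, ENNReal.ofReal (α k ^ 2 * ((2 * Real.pi) • p k)) := by
  have e : ∀ k, ENNReal.ofReal (α k ^ 2 * ((2 * Real.pi) • p k)) =
      ∫⁻ l, ENNReal.ofReal (α k ^ 2 * (f l k k).re) ∂freqMeasure := fun k => by
    rw [← integral_eq_of_average (x := ∫ l, (f l k k).re ∂freqMeasure) (hc k).2,
      ← integral_const_mul, ofReal_integral_eq_lintegral_ofReal ((hc k).1.const_mul _)]
    filter_upwards [hf.pos] with l h2
    exact mul_nonneg (sq_nonneg _) (posSemidef_diag_re h2 k).2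
  simp_rw [e]
  rw [← lintegral_tsum fun k => ((hc k).1.1.aemeasurable.const_mul _).ennreal_ofReal]
  refine lintegral_congr_ae ?_
  filter_upwards [hf.kernel, hf.pos] with l h1 h2
  have e : ∀ k, ∑' n, (Matrix.diagonal fun k => ((α k ^ 2 : ℝ) : ℂ)) n k * f l n k =
      ((α k ^ 2 * (f l k k).re : ℝ) : ℂ) := fun k => by
    rw [tsum_eq_single k fun n hn => by simp [Matrix.diagonal_apply_ne _ hn]]
    rw [(posSemidef_diag_re h2 k).1]; simp
  simp_rw [e]
  have h0 : ∀ k, 0 ≤ α k ^ 2 * (f l k k).re := fun k =>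
    mul_nonneg (sq_nonneg _) (posSemidef_diag_re h2 k).2
  rw [← Complex.ofReal_tsum, Complex.ofReal_re, ENNReal.ofReal_tsum_of_nonneg h0]
  refine Summable.of_nonneg_of_le h0 (fun k => ?_) (h1.mul_left (C ^ 2))
  refine mul_le_mul_of_nonneg_right ?_ (posSemidef_diag_re h2 k).2
  rw [← sq_abs]
  exact pow_le_pow_left₀ (abs_nonneg _) (hα k) 2

/-- Nonnegativity of the pairing is taken as a hypothesis: it follows from its representation as a
quadratic form in `Multiplier.ae_nonneg`. -/
theorem scalar_lintegral {B : Matrix ℕ ℕ ℂ} {p α : ℝ} (hc : (D0Data.scalar B p).Constraint f)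
    (h0 : ∀ᵐ l ∂freqMeasure,
      0 ≤ (∑' k, ∑' n, (((α ^ 2 : ℝ) : ℂ) • B.transpose) n k * f l n k).re) :
    ∫⁻ l, ENNReal.ofReal (∑' k, ∑' n, (((α ^ 2 : ℝ) : ℂ) • B.transpose) n k * f l n k).re
      ∂freqMeasure = ENNReal.ofReal (α ^ 2 * ((2 * Real.pi) • p)) := by
  obtain ⟨hi, hp⟩ := hc
  have e : ∀ l, (∑' k, ∑' n, (((α ^ 2 : ℝ) : ℂ) • B.transpose) n k * f l n k).re =
      α ^ 2 * (∑' k, ∑' n, B k n * f l n k).re := fun l => by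
    simp only [Matrix.smul_apply, Matrix.transpose_apply, smul_eq_mul, mul_assoc, tsum_mul_left]
    rw [Complex.re_ofReal_mul]
  simp_rw [e] at h0 ⊢
  rw [← integral_eq_of_average (x := ∫ l, (∑' k, ∑' n, B k n * f l n k).re ∂freqMeasure) hp,
    ← integral_const_mul, ofReal_integral_eq_lintegral_ofReal (hi.const_mul _) h0]

/-- The form αᵀ f ᾱ is integrated term by term. The trace-class condition on P makes the double
series of integrals absolutely convergent. -/
theorem moment_lintegral {P : Matrix ℕ ℕ ℂ} (hP : Summable fun k => (P k k).re) {α : ℕ → ℂ}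
    (hα : Summable fun k => ‖α k‖ ^ 2) (hf : IsSpectralDensity d τ f)
    (hc : (D0Data.moment P).Constraint f) :
    ∫⁻ l, ENNReal.ofReal (∑' k, ∑' n, (Matrix.of fun k n => α k * conj (α n)) n k * f l n k).re
      ∂freqMeasure = ENNReal.ofReal
        (∑' q : ℕ × ℕ, α q.1 * ((2 * Real.pi) • P q.1 q.2) * conj (α q.2)).re := by
  have hint : ∀ k n, ∫ l, f l k n ∂freqMeasure = (2 * Real.pi) • P k n := fun k n =>
    integral_eq_of_average (by
      rw [← (hc k n).2, Complex.real_smul])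
  have hre : ∀ k, ∫ l, (f l k k).re ∂freqMeasure = (2 * Real.pi) * (P k k).re := fun k => by
    have := hint k k
    have h2 : ∫ l, (f l k k).re ∂freqMeasure = (∫ l, f l k k ∂freqMeasure).re :=
      integral_re (hc k k).1
    rw [h2, this]
    simp
  -- The arithmetic–geometric mean is applied crosswise, |α_n|² f_kk + |α_k|² f_nn, so that each
  -- term factors into sequences summable in different indices.
  have hbound : ∀ q : ℕ × ℕ, ∫ l, ‖α q.1 * f l q.1 q.2 * conj (α q.2)‖ ∂freqMeasure ≤
      (2 * Real.pi) * (‖α q.2‖ ^ 2 * (P q.1 q.1).re + ‖α q.1‖ ^ 2 * (P q.2 q.2).re) := fun q => by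
    have hi1 : Integrable (fun l => (f l q.1 q.1).re) freqMeasure := (hc q.1 q.1).1.re
    have hi2 : Integrable (fun l => (f l q.2 q.2).re) freqMeasure := (hc q.2 q.2).1.re
    calc _ ≤ ∫ l, (‖α q.2‖ ^ 2 * (f l q.1 q.1).re + ‖α q.1‖ ^ 2 * (f l q.2 q.2).re) ∂freqMeasure := by
          refine integral_mono_ae ((((hc q.1 q.2).1.const_mul _).mul_const _).norm)
            ((hi1.const_mul _).add (hi2.const_mul _)) ?_
          filter_upwards [hf.pos] with l h2
          have h3 := posSemidef_norm_le h2 q.1 q.2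
          have h4 := (posSemidef_diag_re h2 q.1).2
          have h5 := (posSemidef_diag_re h2 q.2).2
          rw [norm_mul, norm_mul, RCLike.norm_conj]
          have h6 := Real.sq_sqrt h4
          have h7 := Real.sq_sqrt h5
          set x := Real.sqrt (f l q.1 q.1).re
          set y := Real.sqrt (f l q.2 q.2).re
          have hx : 0 ≤ x := Real.sqrt_nonneg _
          have hy : 0 ≤ y := Real.sqrt_nonneg _
          have h8 : ‖α q.1‖ * ‖f l q.1 q.2‖ * ‖α q.2‖ ≤ (‖α q.2‖ * x) * (‖α q.1‖ * y) := by
            calc _ ≤ ‖α q.1‖ * (x * y) * ‖α q.2‖ := by gcongr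
              _ = _ := by ring
          refine h8.trans ?_
          show _ ≤ ‖α q.2‖ ^ 2 * (f l q.1 q.1).re + ‖α q.1‖ ^ 2 * (f l q.2 q.2).re
          rw [← h6, ← h7, ← mul_pow, ← mul_pow]
          nlinarith [sq_nonneg (‖α q.2‖ * x - ‖α q.1‖ * y), sq_nonneg (‖α q.2‖ * x),
            sq_nonneg (‖α q.1‖ * y)]
      _ = _ := by
          rw [integral_add (hi1.const_mul _) (hi2.const_mul _), integral_const_mul,
            integral_const_mul]
          rw [hre, hre]
          ring
  have hPn : ∀ k, 0 ≤ (P k k).re := fun k => by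
    have h1 : 0 ≤ ∫ l, (f l k k).re ∂freqMeasure := integral_nonneg_of_ae (by
      filter_upwards [hf.pos] with l h2 using (posSemidef_diag_re h2 k).2)
    rw [hre] at h1
    exact nonneg_of_mul_nonneg_right h1 (by positivity)
  have hsum : Summable fun q : ℕ × ℕ => ∫ l, ‖α q.1 * f l q.1 q.2 * conj (α q.2)‖ ∂freqMeasure := by
    refine Summable.of_nonneg_of_le (fun q => integral_nonneg fun _ => norm_nonneg _) hbound ?_
    refine Summable.mul_left _ (Summable.add ?_ ?_)
    · exact (hP.mul_of_nonneg hα hPn fun _ => by positivity).congr fun q => mul_comm _ _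
    · exact hα.mul_of_nonneg hP (fun _ => by positivity) hPn
  have hI : ∀ q : ℕ × ℕ, Integrable (fun l => α q.1 * f l q.1 q.2 * conj (α q.2)) freqMeasure :=
    fun q => ((hc q.1 q.2).1.const_mul _).mul_const _
  have h1 := hasSum_integral_of_summable_integral_norm hI hsum
  have e : ∀ q : ℕ × ℕ, ∫ l, α q.1 * f l q.1 q.2 * conj (α q.2) ∂freqMeasure =
      α q.1 * ((2 * Real.pi) • P q.1 q.2) * conj (α q.2) := fun q => by
    rw [integral_mul_const, integral_const_mul, hint]
  simp_rw [e] at h1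
  rw [h1.tsum_eq]
  have hint2 : Integrable (fun l => ∑' q : ℕ × ℕ, α q.1 * f l q.1 q.2 * conj (α q.2)) freqMeasure :=
    integrable_tsum_of_summable_integral_norm hI hsum
  have h2 : (∫ l, ∑' q : ℕ × ℕ, α q.1 * f l q.1 q.2 * conj (α q.2) ∂freqMeasure).re =
      ∫ l, quad (f l) α ∂freqMeasure := (integral_re hint2).symm
  have hint3 : Integrable (fun l => quad (f l) α) freqMeasure := hint2.re
  rw [h2, ofReal_integral_eq_lintegral_ofReal hint3]
  · refine lintegral_congr_ae ?_
    filter_upwards [hf.kernel, hf.pos] with l h3 h4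
    have h5 := multiplier_quad_of_rankOne (W := 1) (v := α)
      (K := Matrix.of fun k n => α k * conj (α n)) h4 h3 hα (fun n m => by simp)
    rw [← h5, one_mul]
  · filter_upwards [hf.pos] with l h3 using quad_nonneg h3 α

/-- Any two densities of a class have the same integral against a multiplier of the class. -/
theorem D0Data.lintegral_multiplier_eq {D : D0Data} (hD : D.Valid) {K : Matrix ℕ ℕ ℂ}
    (hK : D.IsMultiplier K) {f f' : ℝ → Matrix ℕ ℕ ℂ} (hf : IsSpectralDensity d τ f)
    (hf' : IsSpectralDensity d τ f') (hc : D.Constraint f) (hc' : D.Constraint f')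
    (h0 : ∀ᵐ l ∂freqMeasure, 0 ≤ (∑' k, ∑' n, K n k * f l n k).re)
    (h0' : ∀ᵐ l ∂freqMeasure, 0 ≤ (∑' k, ∑' n, K n k * f' l n k).re) :
    ∫⁻ l, ENNReal.ofReal (∑' k, ∑' n, K n k * f l n k).re ∂freqMeasure =
      ∫⁻ l, ENNReal.ofReal (∑' k, ∑' n, K n k * f' l n k).re ∂freqMeasure := by
  cases D with
  | moment P =>
    obtain ⟨α, hα, rfl⟩ := hK
    rw [moment_lintegral hD.2 hα hf hc, moment_lintegral hD.2 hα hf' hc']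
  | trace p =>
    obtain ⟨α, rfl⟩ := hK
    rw [trace_lintegral hf hc, trace_lintegral hf' hc']
  | diagonal p =>
    obtain ⟨α, ⟨C, hC⟩, rfl⟩ := hK
    rw [diagonal_lintegral hC hf hc, diagonal_lintegral hC hf' hc']
  | scalar B p =>
    obtain ⟨α, rfl⟩ := hK
    rw [scalar_lintegral hc h0, scalar_lintegral hc' h0']

end Classes

/-- Equalizer argument: the error of h⁰ is the same number Δ(f⁰,g) for every density of the class,
and this number bounds the error of any competitor at f⁰ from below. -/
theorem Multiplier.minimax {d τ : ℕ} {T : ℝ} {a : ℝ → ℂ} {M : ℕ∞} {f₀ g : ℝ → Matrix ℕ ℕ ℂ}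
    {Om Th : ℝ → Matrix ℕ (Idx M) ℂ} {Ps : ℝ → Matrix (Idx M) ℕ ℂ} {w : ℝ → ℂ}
    {T0 : ℝ → Matrix ℕ (Idx M) ℂ} {c : ℝ → Idx M → ℂ} {K : Matrix ℕ ℕ ℂ}
    (X : Multiplier d τ T a f₀ g Om Th Ps w T0 c K) {D : D0Data} (hD : D.Valid)
    (hK : D.IsMultiplier K) (hf₀ : D.Constraint f₀)
    (hch : charFormula d τ T a Ps c ∈ charClass d τ (D.admissible M d τ g) g) :
    IsMinimaxCharacteristic d τ T a (D.admissible M d τ g) g (charFormula d τ T a Ps c) := by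
  have hadm : f₀ ∈ D.admissible M d τ g := ⟨X.ctx.hf, hf₀, Th, Ps, X.ctx.hpair⟩
  refine ⟨hch, fun h hh => ?_⟩
  have hle : ∀ f ∈ D.admissible M d τ g,
      mse d τ T a (charFormula d τ T a Ps c) f g = optMse d τ T a f₀ g := by
    rintro f ⟨hf, hfc, Th', Ps', hpair'⟩
    have C' : Ctx d τ T a f g Om Th' Ps' :=
      ⟨X.ctx.hτ, X.ctx.hb, hf, X.ctx.hg, X.ctx.hOm, X.ctx.hreg, hpair'⟩
    rw [← X.mse_char, X.mse_char_eq C', X.mse_char_eq X.ctx,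
      D.lintegral_multiplier_eq hD hK hf X.ctx.hf hfc hf₀ (X.ae_nonneg C') (X.ae_nonneg X.ctx)]
  have hL : h ∈ L20 d τ (fun l => f₀ l + g l) := by
    have := Set.mem_iInter₂.1 hh f₀ hadm
    exact this
  refine (iSup₂_le fun f hf => (hle f hf).le).trans ?_
  rw [X.ctx.optMse_eq]
  exact (X.ctx.rho_le_mse hL).trans (le_iSup₂ (f := fun f _ => mse d τ T a h f g) f₀ hadm)

/-! ### Fourier expansion of blocks of length `T` -/

/-- The negated frequencies run through 0, −1, 1, −2, …, the standard enumeration of ℤ. Sums over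
harmonics thereby become reindexed Fourier sums. -/
theorem neg_freq_eq (k : ℕ) : -freq k = Equiv.intEquivNat.symm k := by
  rw [Equiv.eq_symm_apply]
  obtain ⟨m, rfl | rfl⟩ := Nat.even_or_odd' k
  · have h1 : (2 * m + 1) / 2 = m := by omega
    have h2 : -freq (2 * m) = Int.ofNat m := by
      rw [freq, h1, Odd.neg_one_pow ⟨m, rfl⟩]; simp
    rw [h2]; rfl
  · have h1 : (2 * m + 1 + 1) / 2 = m + 1 := by omega
    have h2 : -freq (2 * m + 1) = Int.negSucc m := by
      rw [freq, h1, Even.neg_one_pow ⟨m + 1, by ring⟩, Int.negSucc_eq]; simp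
    rw [h2]; rfl

theorem freq_injective : Function.Injective freq := fun a b h => by
  have h2 : -freq a = -freq b := by rw [h]
  rwa [neg_freq_eq, neg_freq_eq, Equiv.apply_eq_iff_eq] at h2

/-- The orthonormal harmonics of `(0, T]`. -/
def harm (T : ℝ) (k : ℕ) (v : ℝ) : ℂ :=
  ((1 / Real.sqrt T : ℝ) : ℂ) * Complex.exp (2 * Real.pi * Complex.I * (freq k : ℂ) * (v : ℂ) / (T : ℂ))

/-- Lebesgue measure on `(0, T]`. -/
def blockMeasure (T : ℝ) : Measure ℝ := volume.restrict (Set.Ioc 0 T)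

instance (T : ℝ) : IsFiniteMeasure (blockMeasure T) := by
  unfold blockMeasure; infer_instance

/-- Fourier coefficients with respect to the harmonics. -/
def harmCoef (T : ℝ) (k : ℕ) (φ : ℝ → ℂ) : ℂ := ∫ v, φ v * harm T k v ∂blockMeasure T

section Block

variable {T : ℝ} {φ ψ : ℝ → ℂ} {E : Type*} [NormedAddCommGroup E] [NormedSpace ℂ E]

theorem continuous_harm (T : ℝ) (k : ℕ) : Continuous (harm T k) := by
  unfold harm; fun_prop

theorem norm_harm (T : ℝ) (k : ℕ) (v : ℝ) : ‖harm T k v‖ = 1 / Real.sqrt T := by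
  rw [harm, norm_mul, Complex.norm_real, Real.norm_of_nonneg (by positivity),
    show 2 * Real.pi * Complex.I * (freq k : ℂ) * (v : ℂ) / (T : ℂ) =
      ((2 * Real.pi * freq k * v / T : ℝ) : ℂ) * Complex.I by push_cast; ring,
    Complex.norm_exp_ofReal_mul_I, mul_one]

theorem conj_harm (T : ℝ) (k : ℕ) (v : ℝ) : conj (harm T k v) =
    ((1 / Real.sqrt T : ℝ) : ℂ) *
      Complex.exp (-(2 * Real.pi * Complex.I * (freq k : ℂ) * (v : ℂ) / (T : ℂ))) := by
  rw [harm, map_mul, Complex.conj_ofReal, ← Complex.exp_conj]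
  congr 2
  simp only [map_div₀, map_mul, Complex.conj_ofReal, Complex.conj_I, map_intCast, map_ofNat]
  ring

theorem memLp_mul_harm (hφ : MemLp φ 2 (blockMeasure T)) (k : ℕ) :
    MemLp (fun v => φ v * harm T k v) 2 (blockMeasure T) := by
  refine (hφ.const_mul ((1 / Real.sqrt T : ℝ) : ℂ)).of_le
    (hφ.1.mul (continuous_harm T k).aestronglyMeasurable) ?_
  exact Eventually.of_forall fun v => by
    rw [norm_mul, norm_mul, norm_harm, Complex.norm_real, Real.norm_of_nonneg (by positivity),
      mul_comm]

theorem memLp_conj_harm (T : ℝ) (k : ℕ) :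
    MemLp (fun v => conj (harm T k v)) 2 (blockMeasure T) := by
  refine MemLp.of_bound (Complex.continuous_conj.comp (continuous_harm T k)).aestronglyMeasurable
    (1 / Real.sqrt T) (Eventually.of_forall fun v => ?_)
  rw [RCLike.norm_conj, norm_harm]

theorem harmCoef_sub (hφ : MemLp φ 2 (blockMeasure T)) (hψ : MemLp ψ 2 (blockMeasure T)) (k : ℕ) :
    harmCoef T k (fun v => φ v - ψ v) = harmCoef T k φ - harmCoef T k ψ := by
  unfold harmCoef
  rw [← integral_sub ((memLp_mul_harm hφ k).integrable (by norm_num))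
    ((memLp_mul_harm hψ k).integrable (by norm_num))]
  simp_rw [sub_mul]

theorem harmCoef_conj_harm (hT : 0 < T) (k n : ℕ) :
    harmCoef T k (fun v => conj (harm T n v)) = if k = n then 1 else 0 := by
  have hT' : (T : ℂ) ≠ 0 := by exact_mod_cast hT.ne'
  have e : ∀ v : ℝ, conj (harm T n v) * harm T k v =
      (1 / T : ℂ) * Complex.exp ((2 * Real.pi * Complex.I * ((freq k - freq n : ℤ) : ℂ) / T) * v) := by
    intro v
    rw [conj_harm, harm, mul_mul_mul_comm, ← Complex.exp_add, ← Complex.ofReal_mul, div_mul_div_comm,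
      Real.mul_self_sqrt hT.le]
    push_cast
    congr 2
    · norm_num
    · ring
  unfold harmCoef blockMeasure
  simp_rw [e]
  rw [integral_const_mul, ← intervalIntegral.integral_of_le hT.le]
  split_ifs with h
  · subst h
    simp [hT']
  · have hc : (2 * Real.pi * Complex.I * ((freq k - freq n : ℤ) : ℂ) / T : ℂ) ≠ 0 := by
      have h1 : ((freq k - freq n : ℤ) : ℂ) ≠ 0 := by
        rw [Int.cast_ne_zero, sub_ne_zero]
        exact fun h2 => h (freq_injective h2)
      have h2 : (Real.pi : ℂ) ≠ 0 := by exact_mod_cast Real.pi_ne_zero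
      exact div_ne_zero (mul_ne_zero (by simp [h2]) h1) hT'
    rw [integral_exp_mul_complex hc]
    have : (2 * Real.pi * Complex.I * ((freq k - freq n : ℤ) : ℂ) / T : ℂ) * T =
        ((freq k - freq n : ℤ) : ℂ) * (2 * Real.pi * Complex.I) := by
      field_simp
    rw [this, Complex.exp_int_mul_two_pi_mul_I]
    simp

/-- Pairing with the unconjugated harmonic gives the Fourier coefficient at −`freq k`. The factor T
compensates the normalization T⁻¹ of Fourier coefficients against T^{-1/2} here. -/
theorem hasSum_harmCoef_sq (hT : 0 < T) (hφ : MemLp φ 2 (blockMeasure T)) :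
    HasSum (fun k => ‖harmCoef T k φ‖ ^ 2) (∫ v, ‖φ v‖ ^ 2 ∂blockMeasure T) := by
  have h := (hasSum_sq_fourierCoeffOn hT hφ).mul_left T
  rw [sub_zero, smul_eq_mul, mul_inv_cancel_left₀ hT.ne', intervalIntegral.integral_of_le hT.le,
    ← Equiv.intEquivNat.symm.hasSum_iff] at h
  refine h.congr_fun fun k => ?_
  show _ = T * ‖fourierCoeffOn hT φ (Equiv.intEquivNat.symm k)‖ ^ 2
  rw [← neg_freq_eq, fourierCoeffOn_eq_integral, harmCoef, blockMeasure,
    intervalIntegral.integral_of_le hT.le, norm_smul, mul_pow, sub_zero, neg_neg]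
  have e : ∫ v in Set.Ioc 0 T, φ v * harm T k v = ((1 / Real.sqrt T : ℝ) : ℂ) *
      ∫ v in Set.Ioc 0 T, (fourier (freq k) (v : AddCircle T)) • φ v := by
    rw [← integral_const_mul]
    refine integral_congr_ae (Eventually.of_forall fun v => ?_)
    simp only [fourier_coe_apply, harm, smul_eq_mul]
    ring
  rw [e, norm_mul, mul_pow, Complex.norm_real, Real.norm_of_nonneg (by positivity),
    Real.norm_of_nonneg (by positivity), ← mul_assoc]
  congr 1
  rw [div_pow, div_pow, Real.sq_sqrt hT.le]
  field_simp

/-- Partial sums of the Fourier series. -/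
def harmSum (T : ℝ) (φ : ℝ → ℂ) (s : Finset ℕ) (v : ℝ) : ℂ :=
  ∑ k ∈ s, harmCoef T k φ * conj (harm T k v)

theorem memLp_harmSum (T : ℝ) (φ : ℝ → ℂ) (s : Finset ℕ) :
    MemLp (harmSum T φ s) 2 (blockMeasure T) :=
  memLp_finsetSum s fun k _ => (memLp_conj_harm T k).const_mul _

theorem harmCoef_harmSum (hT : 0 < T) (φ : ℝ → ℂ) (s : Finset ℕ) (n : ℕ) :
    harmCoef T n (harmSum T φ s) = if n ∈ s then harmCoef T n φ else 0 := by
  have e : harmCoef T n (harmSum T φ s) =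
      ∑ k ∈ s, harmCoef T k φ * harmCoef T n (fun v => conj (harm T k v)) := by
    unfold harmSum
    conv_lhs => unfold harmCoef
    simp_rw [Finset.sum_mul]
    rw [integral_finsetSum]
    · refine Finset.sum_congr rfl fun k _ => ?_
      simp_rw [mul_assoc]
      rw [integral_const_mul]
      rfl
    · intro k _
      simp_rw [mul_assoc]
      exact ((memLp_mul_harm (memLp_conj_harm T k) n).integrable (by norm_num)).const_mul _
  rw [e]
  simp_rw [harmCoef_conj_harm hT]
  simp

theorem integral_sq_harmSum_le (hT : 0 < T) (hφ : MemLp φ 2 (blockMeasure T)) (s : Finset ℕ) :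
    ∫ v, ‖harmSum T φ s v‖ ^ 2 ∂blockMeasure T ≤ ∫ v, ‖φ v‖ ^ 2 ∂blockMeasure T := by
  refine hasSum_le (fun k => ?_) (hasSum_harmCoef_sq hT (memLp_harmSum T φ s))
    (hasSum_harmCoef_sq hT hφ)
  rw [harmCoef_harmSum hT]
  split_ifs <;> simp

/-- Parseval for the remainder: subtracting a partial sum deletes exactly the coefficients in `s`.
-/
theorem tendsto_integral_sq_sub_harmSum (hT : 0 < T) (hφ : MemLp φ 2 (blockMeasure T)) :
    Tendsto (fun s => ∫ v, ‖φ v - harmSum T φ s v‖ ^ 2 ∂blockMeasure T) atTop (𝓝 0) := by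
  have h := hasSum_harmCoef_sq hT hφ
  have e : ∀ s, ∫ v, ‖φ v - harmSum T φ s v‖ ^ 2 ∂blockMeasure T =
      ∫ v, ‖φ v‖ ^ 2 ∂blockMeasure T - ∑ k ∈ s, ‖harmCoef T k φ‖ ^ 2 := fun s => by
    have h1 := hasSum_harmCoef_sq hT (hφ.sub (memLp_harmSum T φ s))
    have h2 : HasSum (fun k => ‖harmCoef T k φ‖ ^ 2 - if k ∈ s then ‖harmCoef T k φ‖ ^ 2 else 0)
        (∫ v, ‖φ v‖ ^ 2 ∂blockMeasure T - ∑ k ∈ s, ‖harmCoef T k φ‖ ^ 2) := by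
      refine h.sub ?_
      have := hasSum_sum_of_ne_finset_zero (L := .unconditional ℕ)
        (f := fun k => if k ∈ s then ‖harmCoef T k φ‖ ^ 2 else 0) (s := s) (fun k hk => if_neg hk)
      rwa [Finset.sum_congr rfl fun k hk => if_pos hk] at this
    refine h1.unique (h2.congr_fun fun k => ?_)
    have h3 := harmCoef_sub hφ (memLp_harmSum T φ s) k
    rw [harmCoef_harmSum hT] at h3
    refine (congrArg (fun z : ℂ => ‖z‖ ^ 2) h3).trans ?_
    split_ifs <;> simp
  simp_rw [e]
  have := (tendsto_const_nhds (x := ∫ v, ‖φ v‖ ^ 2 ∂blockMeasure T)).sub h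
  rwa [sub_self] at this

theorem integral_norm_mul_norm_le {α F G : Type*} [MeasurableSpace α] {μ : Measure α}
    [NormedAddCommGroup F] [NormedAddCommGroup G] {x : α → F} {y : α → G}
    (hx : MemLp x 2 μ) (hy : MemLp y 2 μ) :
    ∫ v, ‖x v‖ * ‖y v‖ ∂μ ≤ Real.sqrt (∫ v, ‖x v‖ ^ 2 ∂μ) * Real.sqrt (∫ v, ‖y v‖ ^ 2 ∂μ) := by
  have h := integral_mul_le_Lp_mul_Lq_of_nonneg Real.HolderConjugate.two_two (μ := μ)
    (f := fun v => ‖x v‖) (g := fun v => ‖y v‖) (Eventually.of_forall fun v => norm_nonneg _)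
    (Eventually.of_forall fun v => norm_nonneg _) (by simpa using hx.norm) (by simpa using hy.norm)
  simpa [Real.sqrt_eq_rpow] using h

theorem norm_integral_smul_le {y : ℝ → E} {μ : Measure ℝ} (hφ : MemLp φ 2 μ) (hy : MemLp y 2 μ) :
    ‖∫ v, φ v • y v ∂μ‖ ≤ Real.sqrt (∫ v, ‖φ v‖ ^ 2 ∂μ) * Real.sqrt (∫ v, ‖y v‖ ^ 2 ∂μ) := by
  refine (norm_integral_le_integral_norm _).trans ?_
  simp_rw [norm_smul]
  exact integral_norm_mul_norm_le hφ hy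

theorem integrable_smul_of_memLp {y : ℝ → E} {μ : Measure ℝ} (hφ : MemLp φ 2 μ)
    (hy : MemLp y 2 μ) : Integrable (fun v => φ v • y v) μ :=
  memLp_one_iff_integrable.1 (hy.smul hφ)

theorem integral_harmSum_smul (φ : ℝ → ℂ) {y : ℝ → E} (hy : MemLp y 2 (blockMeasure T))
    (s : Finset ℕ) : ∫ v, harmSum T φ s v • y v ∂blockMeasure T =
      ∑ k ∈ s, harmCoef T k φ • ∫ v, conj (harm T k v) • y v ∂blockMeasure T := by
  unfold harmSum
  simp_rw [Finset.sum_smul]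
  rw [integral_finsetSum]
  · refine Finset.sum_congr rfl fun k _ => ?_
    simp_rw [mul_smul]
    rw [integral_smul]
  · intro k _
    exact integrable_smul_of_memLp ((memLp_conj_harm T k).const_mul _) hy

/-- Parseval's identity for the pairing of a scalar and a vector function. -/
theorem hasSum_harmCoef_smul (hT : 0 < T) (hφ : MemLp φ 2 (blockMeasure T)) {y : ℝ → E}
    (hy : MemLp y 2 (blockMeasure T)) :
    HasSum (fun k => harmCoef T k φ • ∫ v, conj (harm T k v) • y v ∂blockMeasure T)
      (∫ v, φ v • y v ∂blockMeasure T) := by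
  rw [HasSum, tendsto_iff_norm_sub_tendsto_zero]
  have h1 := ((Real.continuous_sqrt.tendsto _).comp
    (tendsto_integral_sq_sub_harmSum hT hφ)).mul_const (Real.sqrt (∫ v, ‖y v‖ ^ 2 ∂blockMeasure T))
  rw [Real.sqrt_zero, zero_mul] at h1
  refine squeeze_zero (fun _ => norm_nonneg _) (fun s => ?_) h1
  have hD := hφ.sub (memLp_harmSum T φ s)
  have h2 := norm_integral_smul_le hD hy
  have e : ∫ v, (φ v - harmSum T φ s v) • y v ∂blockMeasure T =
      ∫ v, φ v • y v ∂blockMeasure T -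
        ∑ k ∈ s, harmCoef T k φ • ∫ v, conj (harm T k v) • y v ∂blockMeasure T := by
    rw [← integral_harmSum_smul φ hy s]
    simp_rw [sub_smul]
    exact integral_sub (integrable_smul_of_memLp hφ hy)
      (integrable_smul_of_memLp (memLp_harmSum T φ s) hy)
  rw [norm_sub_rev, ← e]
  exact h2

theorem norm_sum_harmCoef_smul_le (hT : 0 < T) (hφ : MemLp φ 2 (blockMeasure T)) {y : ℝ → E}
    (hy : MemLp y 2 (blockMeasure T)) (s : Finset ℕ) :
    ‖∑ k ∈ s, harmCoef T k φ • ∫ v, conj (harm T k v) • y v ∂blockMeasure T‖ ≤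
      Real.sqrt (∫ v, ‖φ v‖ ^ 2 ∂blockMeasure T) *
        Real.sqrt (∫ v, ‖y v‖ ^ 2 ∂blockMeasure T) := by
  rw [← integral_harmSum_smul φ hy s]
  refine (norm_integral_smul_le (memLp_harmSum T φ s) hy).trans ?_
  exact mul_le_mul_of_nonneg_right (Real.sqrt_le_sqrt (integral_sq_harmSum_le hT hφ s))
    (Real.sqrt_nonneg _)

end Block

/-! ### The weight function -/

theorem measurePreserving_add_Ioc (a b c : ℝ) :
    MeasurePreserving (fun v : ℝ => v + c) (volume.restrict (Set.Ioc a b))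
      (volume.restrict (Set.Ioc (a + c) (b + c))) := by
  have h := (measurePreserving_add_right volume c).restrict_preimage
    (measurableSet_Ioc (a := a + c) (b := b + c))
  rwa [Set.preimage_add_const_Ioc, add_sub_cancel_right, add_sub_cancel_right] at h

theorem memLp_shift_indicator {a : ℝ → ℂ} (ha : ∀ R : ℝ, MemLp a 2 (volume.restrict (Set.Icc 0 R)))
    (R c : ℝ) : MemLp ((Set.Ici c).indicator fun t => a (t - c)) 2
      (volume.restrict (Set.Icc 0 R)) := by
  rw [memLp_indicator_iff_restrict measurableSet_Ici, Measure.restrict_restrict measurableSet_Ici]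
  have h := (measurePreserving_sub_right volume c).restrict_preimage
    (measurableSet_Icc (a := (0 : ℝ)) (b := R - c))
  rw [Set.preimage_sub_const_Icc, zero_add, sub_add_cancel] at h
  refine ((ha (R - c)).comp_measurePreserving h).mono_measure (Measure.restrict_mono ?_ le_rfl)
  exact fun t ht => ⟨ht.1, ht.2.2⟩

/-- On [0, R] the sum with a variable number of terms is a fixed finite sum of shifts, each cut off
to the left of its starting point τTl. The cut-off matters because `a` is controlled only on the
half-line. -/
theorem memLp_bfun {d τ : ℕ} {T : ℝ} {a : ℝ → ℂ} (hτ : 1 ≤ τ) (hT : 0 < T)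
    (ha : ∀ R : ℝ, MemLp a 2 (volume.restrict (Set.Icc 0 R))) (R : ℝ) :
    MemLp (bfun d τ T a) 2 (volume.restrict (Set.Icc 0 R)) := by
  have hτT : 0 < (τ : ℝ) * T := mul_pos (by exact_mod_cast hτ) hT
  have h : MemLp (fun t => ∑ l ∈ Finset.range (⌊R / (τ * T)⌋₊ + 1), dcoef d l *
      (Set.Ici (τ * T * l)).indicator (fun t => a (t - τ * T * l)) t) 2
      (volume.restrict (Set.Icc 0 R)) :=
    memLp_finsetSum _ fun l _ => (memLp_shift_indicator ha R (τ * T * l)).const_mul _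
  refine (memLp_congr_ae ?_).1 h
  refine (ae_restrict_iff' measurableSet_Icc).2 (Eventually.of_forall fun t ht => ?_)
  have h1 : ∀ l : ℕ, (τ : ℝ) * T * l ≤ t ↔ l < ⌊t / (τ * T)⌋₊ + 1 := fun l => by
    rw [Nat.lt_succ_iff, Nat.le_floor_iff (div_nonneg ht.1 hτT.le), le_div_iff₀ hτT, mul_comm]
  have hsub : Finset.range (⌊t / (τ * T)⌋₊ + 1) ⊆ Finset.range (⌊R / (τ * T)⌋₊ + 1) :=
    Finset.range_subset_range.2 (Nat.succ_le_succ (Nat.floor_mono (by gcongr; exact ht.2)))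
  simp only [bfun]
  rw [← Finset.sum_subset hsub fun l _ hl => ?_]
  · refine Finset.sum_congr rfl fun l hl => ?_
    rw [Set.indicator_of_mem (by exact (h1 l).2 (Finset.mem_range.1 hl)), mul_comm]
  · rw [Set.indicator_of_notMem (s := Set.Ici _) (fun h2 => hl (Finset.mem_range.2 ((h1 l).1 h2))), mul_zero]

theorem measurePreserving_block (T : ℝ) (j : ℕ) :
    MeasurePreserving (fun v : ℝ => v + j * T) (blockMeasure T)
      (volume.restrict (Set.Ioc ((j : ℝ) * T) ((j + 1 : ℕ) * T))) := by
  have := measurePreserving_add_Ioc 0 T (j * T)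
  rw [zero_add, show T + (j : ℝ) * T = ((j + 1 : ℕ) : ℝ) * T by push_cast; ring] at this
  exact this

theorem memLp_bfun_block {d τ : ℕ} {T : ℝ} {a : ℝ → ℂ} (hτ : 1 ≤ τ) (hT : 0 < T)
    (ha : ∀ R : ℝ, MemLp a 2 (volume.restrict (Set.Icc 0 R))) (j : ℕ) :
    MemLp (fun v => bfun d τ T a (v + j * T)) 2 (blockMeasure T) := by
  have h := (memLp_bfun (d := d) hτ hT ha ((j + 1 : ℕ) * T)).mono_measure (Measure.restrict_mono
    (show Set.Ioc ((j : ℝ) * T) ((j + 1 : ℕ) * T) ⊆ Set.Icc 0 ((j + 1 : ℕ) * T) from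
      fun t ht => ⟨(mul_nonneg (Nat.cast_nonneg j) hT.le).trans ht.1.le, ht.2⟩) le_rfl)
  exact h.comp_measurePreserving (measurePreserving_block T j)

theorem bvec_eq (d τ : ℕ) {T : ℝ} (hT : 0 < T) (a : ℝ → ℂ) (j k : ℕ) :
    bvec d τ T a j k = harmCoef T k fun v => bfun d τ T a (v + j * T) := by
  rw [bvec, harmCoef, blockMeasure, intervalIntegral.integral_of_le hT.le, ← integral_const_mul]
  refine integral_congr_ae (Eventually.of_forall fun v => ?_)
  simp only [harm]
  ring

theorem bnorm_eq {d τ : ℕ} {T : ℝ} {a : ℝ → ℂ} (hτ : 1 ≤ τ) (hT : 0 < T)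
    (ha : ∀ R : ℝ, MemLp a 2 (volume.restrict (Set.Icc 0 R))) (j : ℕ) :
    bnorm d τ T a j = Real.sqrt (∫ v, ‖bfun d τ T a (v + j * T)‖ ^ 2 ∂blockMeasure T) := by
  rw [bnorm, ← (hasSum_harmCoef_sq hT (memLp_bfun_block hτ hT ha j)).tsum_eq]
  simp_rw [bvec_eq d τ hT]

theorem WeightCondition.summableCoeffs {d τ : ℕ} {T : ℝ} {a : ℝ → ℂ}
    (ha : WeightCondition d τ T a) (hτ : 1 ≤ τ) (hT : 0 < T) : SummableCoeffs (bvec d τ T a) where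
  sq j := by
    simp_rw [bvec_eq d τ hT]
    exact (hasSum_harmCoef_sq hT (memLp_bfun_block hτ hT ha.locL2 j)).summable
  norms := ha.summ

/-! ### Block expansion of the functional -/

section PeriodicNorm

variable {H : Type*} [NormedAddCommGroup H]

/-- Locally square integrable functions with periodic norm. -/
structure PeriodicNorm (T : ℝ) (x : ℝ → H) : Prop where
  locL2 : ∀ R : ℝ, MemLp x 2 (volume.restrict (Set.Icc (-R) R))
  norm_add : ∀ t, ‖x (t + T)‖ = ‖x t‖

namespace PeriodicNorm

variable {T : ℝ} {x : ℝ → H}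

theorem norm_int (hx : PeriodicNorm T x) (z : ℤ) (t : ℝ) : ‖x (z * T + t)‖ = ‖x t‖ := by
  induction z using Int.induction_on with
  | zero => simp
  | succ n ih =>
    rw [← ih, ← hx.norm_add (((n : ℤ) : ℝ) * T + t)]
    push_cast
    ring_nf
  | pred n ih =>
    rw [← ih, ← hx.norm_add (((-(n : ℤ) - 1 : ℤ) : ℝ) * T + t)]
    push_cast
    ring_nf

theorem memLp_block (hx : PeriodicNorm T x) (c : ℝ) :
    MemLp (fun v => x (c - v)) 2 (blockMeasure T) := by
  have h := (Measure.measurePreserving_sub_left volume c).restrict_preimage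
    (measurableSet_Icc (a := -(|c| + T)) (b := |c| + T))
  refine ((hx.locL2 (|c| + T)).comp_measurePreserving h).mono_measure
    (Measure.restrict_mono (fun v hv => ?_) le_rfl)
  have h1 := neg_abs_le c
  have h2 := le_abs_self c
  have h3 := hv.1
  have h4 := hv.2
  exact ⟨by linarith, by linarith⟩

theorem integral_norm_sq_block (hx : PeriodicNorm T x) (z : ℤ) :
    ∫ v, ‖x (z * T - v)‖ ^ 2 ∂blockMeasure T = ∫ v, ‖x (-v)‖ ^ 2 ∂blockMeasure T := by
  simp_rw [sub_eq_add_neg, hx.norm_int]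

variable [InnerProductSpace ℂ H]

/-- The Fourier coefficients of the blocks. -/
def blockCoef (T : ℝ) (x : ℝ → H) (k : ℕ) (z : ℤ) : H :=
  ∫ v, conj (harm T k v) • x (z * T - v) ∂blockMeasure T

/-- Periodicity of the norm gives all blocks of `x` the same L² norm, so the block integrals are
bounded by a constant times the norms of the blocks of `b`. -/
theorem hasSum_block (hx : PeriodicNorm T x) (hT : 0 < T) {b : ℝ → ℂ}
    (hb : ∀ j : ℕ, MemLp (fun v => b (v + j * T)) 2 (blockMeasure T))
    (hs : Summable fun j : ℕ => Real.sqrt (∫ v, ‖b (v + j * T)‖ ^ 2 ∂blockMeasure T)) :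
    HasSum (fun j : ℕ => ∫ v, b (v + j * T) • x ((-(j : ℤ) : ℤ) * T - v) ∂blockMeasure T)
      (∫ t in Set.Ioi (0 : ℝ), b t • x (-t)) := by
  set s : ℕ → Set ℝ := fun j => Set.Ioc ((j : ℝ) * T) ((j + 1 : ℕ) * T) with hsdef
  have hmono : Monotone fun j : ℕ => (j : ℝ) * T := fun i j hij => by
    simp only
    gcongr
  have hU : ⋃ j, s j = Set.Ioi 0 := by
    have h := iUnion_Ioc_map_succ_eq_Ioi (α := ℕ) (f := fun j : ℕ => (j : ℝ) * T)
      (fun j => hmono bot_le) (by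
        rintro ⟨R, hR⟩
        obtain ⟨n, hn⟩ := exists_nat_gt (R / T)
        have := hR ⟨n, rfl⟩
        rw [div_lt_iff₀ hT] at hn
        exact absurd this (not_le.2 hn))
    simpa [hsdef] using h
  have hemb : ∀ j : ℕ, MeasurableEmbedding fun v : ℝ => v + j * T := fun j =>
    (MeasurableEquiv.addRight ((j : ℝ) * T)).measurableEmbedding
  have e : ∀ (j : ℕ) (v : ℝ), -(v + j * T) = ((-(j : ℤ) : ℤ) : ℝ) * T - v := fun j v => by
    push_cast; ring
  have hint : ∀ j, IntegrableOn (fun t => b t • x (-t)) (s j) := fun j => by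
    refine ((measurePreserving_block T j).integrable_comp_emb (hemb j)).1 ?_
    simp only [Function.comp_def, e]
    exact integrable_smul_of_memLp (hb j) (hx.memLp_block _)
  have hsum : Summable fun j => ∫ t in s j, ‖b t • x (-t)‖ := by
    refine Summable.of_nonneg_of_le (fun j => integral_nonneg fun _ => norm_nonneg _) (fun j => ?_)
      (hs.mul_right (Real.sqrt (∫ v, ‖x (-v)‖ ^ 2 ∂blockMeasure T)))
    rw [← (measurePreserving_block T j).integral_comp (hemb j)]
    simp only [e, norm_smul]
    refine (integral_norm_mul_norm_le (hb j) (hx.memLp_block _)).trans_eq ?_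
    rw [hx.integral_norm_sq_block]
  have h := hasSum_integral_iUnion (fun j => measurableSet_Ioc) hmono.pairwise_disjoint_on_Ioc_succ
    (integrableOn_iUnion_of_summable_integral_norm hint hsum)
  change HasSum (fun j => ∫ t in s j, b t • x (-t)) (∫ t in ⋃ j, s j, b t • x (-t)) at h
  rw [hU] at h
  refine h.congr_fun fun j => ?_
  rw [← (measurePreserving_block T j).integral_comp (hemb j)]
  simp only [e]

/-- Square partial sums converge to the functional. -/
theorem tendsto_squareSum [CompleteSpace H] (hx : PeriodicNorm T x) (hT : 0 < T) {b : ℝ → ℂ}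
    (hb : ∀ j : ℕ, MemLp (fun v => b (v + j * T)) 2 (blockMeasure T))
    (hs : Summable fun j : ℕ => Real.sqrt (∫ v, ‖b (v + j * T)‖ ^ 2 ∂blockMeasure T)) :
    Tendsto (fun N : ℕ => ∑ j ∈ Finset.range N, ∑ k ∈ Finset.range N,
      harmCoef T k (fun v => b (v + j * T)) • blockCoef T x k (-(j : ℤ))) atTop
      (𝓝 (∫ t in Set.Ioi (0 : ℝ), b t • x (-t))) := by
  rw [← (hx.hasSum_block hT hb hs).tsum_eq]
  set C := Real.sqrt (∫ v, ‖x (-v)‖ ^ 2 ∂blockMeasure T) with hC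
  have hbd : Summable fun j : ℕ =>
      Real.sqrt (∫ v, ‖b (v + j * T)‖ ^ 2 ∂blockMeasure T) * C := hs.mul_right C
  -- Both truncations depend on the same N. For fixed j the inner sums converge by Parseval's
  -- identity, and Bessel's inequality bounds them uniformly in N.
  have h := tendsto_tsum_of_dominated_convergence (𝓕 := atTop)
    (f := fun (N : ℕ) (j : ℕ) => if j ∈ Finset.range N then ∑ k ∈ Finset.range N,
      harmCoef T k (fun v => b (v + j * T)) • blockCoef T x k (-(j : ℤ)) else 0)
    (g := fun j : ℕ => ∫ v, b (v + j * T) • x ((-(j : ℤ) : ℤ) * T - v) ∂blockMeasure T)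
    (bound := fun j : ℕ => Real.sqrt (∫ v, ‖b (v + j * T)‖ ^ 2 ∂blockMeasure T) * C)
    hbd (fun j => ?_) (Eventually.of_forall fun N j => ?_)
  · refine h.congr fun N => ?_
    rw [tsum_eq_sum (s := Finset.range N) fun j hj => if_neg hj]
    exact Finset.sum_congr rfl fun j hj => if_pos hj
  · have h1 := (hasSum_harmCoef_smul hT (hb j) (hx.memLp_block
      (((-(j : ℤ) : ℤ) : ℝ) * T))).tendsto_sum_nat
    refine h1.congr' ?_
    filter_upwards [eventually_gt_atTop j] with N hN
    rw [if_pos (Finset.mem_range.2 hN)]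
    rfl
  · split_ifs
    · rw [hC, ← hx.integral_norm_sq_block (-(j : ℤ))]
      exact norm_sum_harmCoef_smul_le hT (hb j) (hx.memLp_block _) _
    · rw [norm_zero]; positivity

end PeriodicNorm

variable [InnerProductSpace ℂ H]

theorem gen_eq_blockCoef (d τ : ℕ) {T : ℝ} (hT : 0 < T) (ξ : ℝ → H) (k : ℕ) (j : ℤ) :
    gen d τ T ξ k j = PeriodicNorm.blockCoef T (incr d (τ * T) ξ) k j := by
  rw [gen, PeriodicNorm.blockCoef, blockMeasure, intervalIntegral.integral_of_le hT.le,
    ← integral_smul]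
  refine integral_congr_ae (Eventually.of_forall fun v => ?_)
  simp only
  rw [conj_harm, mul_smul]

/-- Both Bochner integrals are taken out of the inner product, and the integrand vanishes pointwise.
-/
theorem inner_gen_eq_zero [CompleteSpace H] {d τ : ℕ} {T : ℝ} (hT : 0 < T) {ξ η : ℝ → H}
    (hu : Uncorrelated d T ξ η) (hξ : PeriodicNorm T (incr d (τ * T) ξ))
    (hη : PeriodicNorm T (incr d (τ * T) η)) (k n : ℕ) (j m : ℤ) :
    inner ℂ (gen d τ T η k j) (gen d τ T ξ n m) = 0 := by
  have hI : ∀ {ζ : ℝ → H}, PeriodicNorm T (incr d (τ * T) ζ) → ∀ k (j : ℤ),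
      Integrable (fun v => conj (harm T k v) • incr d (τ * T) ζ (j * T - v)) (blockMeasure T) :=
    fun hζ k j => integrable_smul_of_memLp (memLp_conj_harm T k) (hζ.memLp_block _)
  have h0 : ∀ t s, inner ℂ (incr d (τ * T) η t) (incr d (τ * T) ξ s) = 0 := fun t s => by
    simpa using hu τ τ t s
  rw [gen_eq_blockCoef d τ hT, gen_eq_blockCoef d τ hT, PeriodicNorm.blockCoef,
    PeriodicNorm.blockCoef, ← integral_inner (hI hξ n m)]
  refine integral_eq_zero_of_ae (Eventually.of_forall fun s => ?_)
  simp only [inner_smul_right]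
  rw [← inner_conj_symm, ← integral_inner (hI hη k j)]
  have : ∀ t, inner ℂ (incr d (τ * T) ξ (m * T - s))
      (conj (harm T k t) • incr d (τ * T) η (j * T - t)) = 0 := fun t => by
    rw [inner_smul_right, ← inner_conj_symm, h0]; simp
  simp [this]

end PeriodicNorm

/-- Only the covariance at equal times and equal steps is needed. -/
theorem IsPeriodicIncr.periodicNorm {Ω : Type*} [MeasurableSpace Ω] {P : Measure Ω} {d : ℕ} {T : ℝ}
    {ξ : ℝ → Lp ℂ 2 P} (h : IsPeriodicIncr P d T ξ) (τ : ℕ) :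
    PeriodicNorm T (incr d (τ * T) ξ) where
  locL2 R := by simpa using h.locL2 τ R
  norm_add t := by
    have h1 := h.cov τ τ t t
    simp only [Int.cast_natCast] at h1
    rw [inner_self_eq_norm_sq_to_K, inner_self_eq_norm_sq_to_K] at h1
    have h2 : ‖incr d (τ * T) ξ (t + T)‖ ^ 2 = ‖incr d (τ * T) ξ t‖ ^ 2 := by exact_mod_cast h1
    exact (sq_eq_sq₀ (norm_nonneg _) (norm_nonneg _)).1 h2

/-! ### The spectral isometry -/

theorem integrable_wsq_mul {d τ : ℕ} {f : ℝ → Matrix ℕ ℕ ℂ} (hf : IsSpectralDensity d τ f)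
    (k n : ℕ) : Integrable (fun l => (wsq d τ l : ℂ) * f l k n) freqMeasure := by
  refine hf.integrable.mono' ((Complex.measurable_ofReal.comp (measurable_wsq d τ)).aemeasurable.mul
    (hf.meas k n)).aestronglyMeasurable ?_
  filter_upwards [hf.pos, hf.kernel] with l h1 h2
  rw [norm_mul, Complex.norm_real, Real.norm_of_nonneg (wsq_nonneg d τ l)]
  refine mul_le_mul_of_nonneg_left ?_ (wsq_nonneg d τ l)
  have h0 := fun k => (posSemidef_diag_re h1 k).2
  have hle := fun k => h2.le_tsum k fun j _ => h0 j
  refine (posSemidef_norm_le h1 k n).trans ?_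
  calc _ ≤ Real.sqrt (∑' k, (f l k k).re) * Real.sqrt (∑' k, (f l k k).re) :=
        mul_le_mul (Real.sqrt_le_sqrt (hle k)) (Real.sqrt_le_sqrt (hle n)) (Real.sqrt_nonneg _)
          (Real.sqrt_nonneg _)
    _ = _ := Real.mul_self_sqrt (tsum_nonneg h0)

/-- The vector polynomial `pvec q` as an element of `ℓ²`, linear in `q`. -/
def pvecL2 (l : ℝ) : ((ℕ × ℕ) →₀ ℂ) →ₗ[ℂ] L2seq ℕ :=
  Finsupp.linearCombination ℂ fun p => Complex.exp (-(Complex.I * l * p.2)) • unit p.1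

theorem pvecL2_apply (l : ℝ) (q : (ℕ × ℕ) →₀ ℂ) : (pvecL2 l q : ℕ → ℂ) = pvec q l := by
  funext k
  rw [pvecL2, Finsupp.linearCombination_apply, Finsupp.sum, lp.coeFn_sum, Finset.sum_apply, pvec,
    Finsupp.sum]
  refine Finset.sum_congr rfl fun p _ => ?_
  simp only [lp.coeFn_smul, Pi.smul_apply, unit_apply, smul_eq_mul]
  by_cases h : p.1 = k
  · simp [h]
  · simp [h, Ne.symm h]

theorem norm_pvecL2_le (l : ℝ) (q : (ℕ × ℕ) →₀ ℂ) : ‖pvecL2 l q‖ ≤ ∑ p ∈ q.support, ‖q p‖ := by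
  rw [pvecL2, Finsupp.linearCombination_apply, Finsupp.sum]
  refine norm_sum_le_of_le _ fun p _ => ?_
  rw [norm_smul, norm_smul, norm_exp_neg_I_mul, L2seq.norm_unit, mul_one, mul_one]

theorem quad_pvec_eq (F : Matrix ℕ ℕ ℂ) (q : (ℕ × ℕ) →₀ ℂ) (l : ℝ) :
    quad F (pvec q l) = (∑ p ∈ q.support, ∑ r ∈ q.support,
      conj (q p) * q r * (Complex.exp (Complex.I * ((p.2 : ℂ) - r.2) * l) * F r.1 p.1)).re := by
  rw [quad]
  congr 1
  have e : ∀ x : ℕ × ℕ, pvec q l x.1 * F x.1 x.2 * conj (pvec q l x.2) =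
      ∑ p ∈ q.support, ∑ r ∈ q.support, if x = (r.1, p.1) then
        conj (q p) * q r * (Complex.exp (Complex.I * ((p.2 : ℂ) - r.2) * l) * F r.1 p.1) else 0 := by
    intro x
    rw [pvec, pvec, Finsupp.sum, Finsupp.sum, map_sum, Finset.mul_sum]
    refine Finset.sum_congr rfl fun p _ => ?_
    rw [Finset.sum_mul, Finset.sum_mul]
    refine Finset.sum_congr rfl fun r _ => ?_
    by_cases h1 : r.1 = x.1
    · by_cases h2 : p.1 = x.2
      · rw [if_pos h1, if_pos h2, if_pos (by rw [h1, h2]), map_mul, ← Complex.exp_conj, ← h1, ← h2]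
        have : Complex.exp (Complex.I * ((p.2 : ℂ) - r.2) * l) =
            Complex.exp (-(Complex.I * l * r.2)) * Complex.exp (conj (-(Complex.I * l * p.2))) := by
          rw [← Complex.exp_add]
          congr 1
          simp only [map_neg, map_mul, Complex.conj_I, Complex.conj_ofReal, map_natCast]
          ring
        rw [this]; ring
      · rw [if_neg h2, if_neg (show ¬x = (r.1, p.1) from fun h => h2 (by rw [h]))]; simp
    · rw [if_neg h1, if_neg (show ¬x = (r.1, p.1) from fun h => h1 (by rw [h]))]; simp
  simp_rw [e]
  have hs : ∀ (y : ℕ × ℕ) (z : ℂ), HasSum (fun x : ℕ × ℕ => if x = y then z else 0) z := fun y z =>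
    hasSum_ite_eq y z
  refine HasSum.tsum_eq ?_
  exact hasSum_sum fun p _ => hasSum_sum fun r _ => hs _ _

section Isometry

variable {H : Type*} [NormedAddCommGroup H] [InnerProductSpace ℂ H]

/-- Finite linear combinations of the components of the generated sequence with indices
`-m ≤ 0`. -/
def genComb (d τ : ℕ) (T : ℝ) (ξ : ℝ → H) : ((ℕ × ℕ) →₀ ℂ) →ₗ[ℂ] H :=
  Finsupp.linearCombination ℂ fun p => gen d τ T ξ p.1 (-(p.2 : ℤ))

variable {d τ : ℕ} {T : ℝ} {ξ η : ℝ → H} {f g : ℝ → Matrix ℕ ℕ ℂ}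

theorem quad_poly (d τ : ℕ) (F : Matrix ℕ ℕ ℂ) (q : (ℕ × ℕ) →₀ ℂ) (l : ℝ) :
    quad F (poly d τ q l) = wsq d τ l * quad F (pvec q l) := by
  rw [← norm_wfun_sq, ← quad_const_mul]
  congr 1
  funext k
  exact poly_eq d τ q l k

/-- Both sides expand into the same double sum. The index `m` stands for time −m, so the lag between
`r` and `p` is `p.2 − r.2`, and the conjugated coefficient is the one of `p`. -/
theorem norm_genComb_sq (hf : IsSpectralDensity d τ f) (h : HasSpectralDensity d τ T ξ f)
    (q : (ℕ × ℕ) →₀ ℂ) :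
    ENNReal.ofReal (‖genComb d τ T ξ q‖ ^ 2) = normSq f (poly d τ q) := by
  have hi : ∀ p r : ℕ × ℕ, Integrable (fun l : ℝ => conj (q p) * q r *
      (Complex.exp (Complex.I * ((p.2 : ℂ) - r.2) * l) * ((wsq d τ l : ℂ) * f l r.1 p.1)))
      freqMeasure := fun p r => by
    refine Integrable.const_mul ?_ _
    have h1 := integrable_mul_exp (integrable_wsq_mul hf r.1 p.1) ((p.2 : ℤ) - r.2)
    refine h1.congr (Eventually.of_forall fun l => ?_)
    simp only
    rw [mul_comm]
    congr 2
    push_cast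
    ring
  have hI : Integrable (fun l : ℝ => ∑ p ∈ q.support, ∑ r ∈ q.support, conj (q p) * q r *
      (Complex.exp (Complex.I * ((p.2 : ℂ) - r.2) * l) * ((wsq d τ l : ℂ) * f l r.1 p.1)))
      freqMeasure := integrable_finsetSum _ fun p _ => integrable_finsetSum _ fun r _ => hi p r
  have hq : ∀ l, quad (f l) (poly d τ q l) = (∑ p ∈ q.support, ∑ r ∈ q.support, conj (q p) * q r *
      (Complex.exp (Complex.I * ((p.2 : ℂ) - r.2) * l) * ((wsq d τ l : ℂ) * f l r.1 p.1))).re := by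
    intro l
    rw [quad_poly, quad_pvec_eq, ← Complex.re_ofReal_mul, Finset.mul_sum]
    congr 1
    refine Finset.sum_congr rfl fun p _ => ?_
    rw [Finset.mul_sum]
    exact Finset.sum_congr rfl fun r _ => by ring
  have hnorm : ‖genComb d τ T ξ q‖ ^ 2 =
      1 / (2 * Real.pi) * ∫ l, quad (f l) (poly d τ q l) ∂freqMeasure := by
    have h1 : ∫ l, quad (f l) (poly d τ q l) ∂freqMeasure =
        (∫ l, ∑ p ∈ q.support, ∑ r ∈ q.support, conj (q p) * q r *
          (Complex.exp (Complex.I * ((p.2 : ℂ) - r.2) * l) * ((wsq d τ l : ℂ) * f l r.1 p.1))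
          ∂freqMeasure).re := by
      simp_rw [hq]
      exact integral_re hI
    rw [h1, ← inner_self_eq_norm_sq (𝕜 := ℂ), ← Complex.re_ofReal_mul]
    change Complex.re _ = Complex.re _
    congr 1
    rw [genComb, Finsupp.linearCombination_apply, Finsupp.sum, integral_finsetSum _
      fun p _ => integrable_finsetSum _ fun r _ => hi p r, sum_inner, Finset.mul_sum]
    refine Finset.sum_congr rfl fun p _ => ?_
    rw [integral_finsetSum _ fun r _ => hi p r, inner_sum, Finset.mul_sum]
    refine Finset.sum_congr rfl fun r _ => ?_
    rw [inner_smul_left, inner_smul_right, h, integral_const_mul]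
    simp_rw [mul_assoc]
    have : ∀ x : ℝ, Complex.I * ((((-(r.2 : ℤ) : ℤ) : ℂ) - ((-(p.2 : ℤ) : ℤ) : ℂ)) * (x : ℂ)) =
        Complex.I * (((p.2 : ℂ) - r.2) * x) := fun x => by push_cast; ring
    simp_rw [this]
    ring
  have hI' : Integrable (fun l => quad (f l) (poly d τ q l)) freqMeasure := by
    simp_rw [hq]
    exact hI.re
  rw [hnorm, ENNReal.ofReal_mul (by positivity), normSq, ofReal_integral_eq_lintegral_ofReal hI']
  filter_upwards [hf.pos] with l hl using quad_nonneg hl _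

end Isometry

theorem ofReal_norm_sub_sq_of_orthogonal {H : Type*} [NormedAddCommGroup H]
    [InnerProductSpace ℂ H] {x y : H} (h : inner ℂ y x = 0) :
    ENNReal.ofReal (‖x - y‖ ^ 2) = ENNReal.ofReal (‖x‖ ^ 2) + ENNReal.ofReal (‖y‖ ^ 2) := by
  rw [← ENNReal.ofReal_add (by positivity) (by positivity)]
  congr 1
  have h' : inner ℂ x y = 0 := by rw [← inner_conj_symm, h]; simp
  have := norm_sub_sq (𝕜 := ℂ) x y
  rw [h'] at this
  simpa using this

/-! ### Square truncations of the coefficients of B -/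

theorem norm_sum_smul_unit_le (x : L2seq ℕ) (N : ℕ) :
    ‖∑ k ∈ Finset.range N, x k • (unit k : L2seq ℕ)‖ ≤ ‖x‖ := by
  refine le_of_sq_le_sq ?_ (norm_nonneg _)
  rw [L2seq.norm_sq, L2seq.norm_sq]
  refine Summable.tsum_le_tsum (fun n => ?_) (L2seq.summable _) x.summable
  have e : (∑ k ∈ Finset.range N, x k • (unit k : L2seq ℕ)) n =
      if n ∈ Finset.range N then x n else 0 := by
    rw [lp.coeFn_sum, Finset.sum_apply]
    simp only [lp.coeFn_smul, Pi.smul_apply, unit_apply, smul_eq_mul, mul_ite, mul_one, mul_zero]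
    rw [Finset.sum_ite_eq]
  rw [e]
  split_ifs <;> simp

/-- The square truncation of a sequence of coefficient vectors. -/
def squareTrunc (b : ℕ → ℕ → ℂ) (N : ℕ) : (ℕ × ℕ) →₀ ℂ :=
  ∑ j ∈ Finset.range N, ∑ k ∈ Finset.range N, Finsupp.single (k, j) (b j k)

theorem linearCombination_squareTrunc {V : Type*} [AddCommGroup V] [Module ℂ V]
    (v : ℕ × ℕ → V) (b : ℕ → ℕ → ℂ) (N : ℕ) :
    Finsupp.linearCombination ℂ v (squareTrunc b N) =
      ∑ j ∈ Finset.range N, ∑ k ∈ Finset.range N, b j k • v (k, j) := by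
  simp [squareTrunc, map_sum]

section

variable {b : ℕ → ℕ → ℂ}

theorem pvecL2_squareTrunc (hb : SummableCoeffs b) (l : ℝ) (N : ℕ) :
    pvecL2 l (squareTrunc b N) = ∑ j ∈ Finset.range N, Complex.exp (-(Complex.I * l * j)) •
      ∑ k ∈ Finset.range N, hb.vec j k • (unit k : L2seq ℕ) := by
  rw [pvecL2, linearCombination_squareTrunc]
  refine Finset.sum_congr rfl fun j _ => ?_
  rw [Finset.smul_sum]
  exact Finset.sum_congr rfl fun k _ => smul_comm _ _ _

theorem norm_pvecL2_squareTrunc_le (hb : SummableCoeffs b) (l : ℝ) (N : ℕ) :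
    ‖pvecL2 l (squareTrunc b N)‖ ≤ ∑' j, ‖hb.vec j‖ := by
  rw [pvecL2_squareTrunc hb]
  refine (norm_sum_le_of_le _ fun j _ => ?_).trans
    (hb.summable_norm_vec.sum_le_tsum (Finset.range N) fun _ _ => norm_nonneg _)
  rw [norm_smul, norm_exp_neg_I_mul, one_mul]
  exact norm_sum_smul_unit_le _ _

theorem tendsto_pvecL2_squareTrunc (hb : SummableCoeffs b) (l : ℝ) :
    Tendsto (fun N => pvecL2 l (squareTrunc b N)) atTop
      (𝓝 (toL2 (vecSeries b l) (hb.summable_sq l))) := by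
  rw [hb.toL2_eq]
  have h := tendsto_tsum_of_dominated_convergence (𝓕 := atTop)
    (f := fun (N : ℕ) (j : ℕ) => if j ∈ Finset.range N then
      Complex.exp (-(Complex.I * l * j)) • ∑ k ∈ Finset.range N, hb.vec j k • (unit k : L2seq ℕ)
      else 0)
    (g := fun j : ℕ => Complex.exp (-(Complex.I * l * j)) • hb.vec j)
    (bound := fun j : ℕ => ‖hb.vec j‖) hb.summable_norm_vec (fun j => ?_)
    (Eventually.of_forall fun N j => ?_)
  · refine h.congr fun N => ?_
    rw [pvecL2_squareTrunc hb, tsum_eq_sum (s := Finset.range N) fun j hj => if_neg hj]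
    exact Finset.sum_congr rfl fun j hj => if_pos hj
  · have h1 := (hasSum_unit (hb.vec j)).tendsto_sum_nat.const_smul
      (Complex.exp (-(Complex.I * l * j)))
    refine h1.congr' ?_
    filter_upwards [eventually_gt_atTop j] with N hN
    rw [if_pos (Finset.mem_range.2 hN)]
  · split_ifs
    · rw [norm_smul, norm_exp_neg_I_mul, one_mul]
      exact norm_sum_smul_unit_le _ _
    · rw [norm_zero]; positivity

end

/-! ### Mean-square errors of finite combinations of observations -/

section

variable {d τ : ℕ} {T : ℝ} {a : ℝ → ℂ} {M : ℕ∞} {f g : ℝ → Matrix ℕ ℕ ℂ}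
  {Om Th : ℝ → Matrix ℕ (Idx M) ℂ} {Ps : ℝ → Matrix (Idx M) ℕ ℂ}

theorem Ctx.tendsto_normSq_squareTrunc (C : Ctx d τ T a f g Om Th Ps) (q : (ℕ × ℕ) →₀ ℂ) :
    Tendsto (fun N => normSq f (poly d τ (squareTrunc (bvec d τ T a) N - q))) atTop
      (𝓝 (normSq f fun l k => wfun d τ l * Bfun d τ T a l k - poly d τ q l k)) := by
  set R := ∑' j, ‖C.hb.vec j‖ + ∑ p ∈ q.support, ‖q p‖ with hR
  have hRn : ∀ l N, ‖pvecL2 l (squareTrunc (bvec d τ T a) N - q)‖ ≤ R := fun l N => by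
    rw [map_sub]
    exact (norm_sub_le _ _).trans
      (add_le_add (norm_pvecL2_squareTrunc_le C.hb l N) (norm_pvecL2_le l q))
  unfold normSq
  refine ENNReal.Tendsto.const_mul ?_ (Or.inr (by simp))
  -- The truncations are bounded in ℓ² uniformly in N and the frequency, so R² W Tr f is an
  -- integrable majorant.
  refine tendsto_lintegral_of_dominated_convergence'
    (fun l => ENNReal.ofReal (R ^ 2 * (wsq d τ l * ∑' k, (f l k k).re)))
    (fun N => ofReal_quad_meas C.hf.meas (poly_compMeas d τ _)) (fun N => ?_) ?_ ?_
  · filter_upwards [C.ae_data] with l h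
    refine ENNReal.ofReal_le_ofReal ?_
    rw [quad_poly, mul_left_comm]
    refine mul_le_mul_of_nonneg_left ?_ (wsq_nonneg d τ l)
    refine (quad_le h.fpos h.fsum (pvec_summable _ l)).trans ?_
    refine mul_le_mul_of_nonneg_right ?_ (tsum_nonneg fun k => (posSemidef_diag_re h.fpos k).2)
    have h2 := L2seq.norm_sq (pvecL2 l (squareTrunc (bvec d τ T a) N - q))
    rw [pvecL2_apply] at h2
    rw [← h2]
    exact pow_le_pow_left₀ (norm_nonneg _) (hRn l N) 2
  · exact (C.hf.integrable.const_mul (R ^ 2)).lintegral_lt_top.ne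
  · filter_upwards [C.ae_data] with l h
    refine (ENNReal.continuous_ofReal.tendsto _).comp ?_
    have hx : Tendsto (fun N => pvecL2 l (squareTrunc (bvec d τ T a) N - q)) atTop
        (𝓝 (toL2 (vecSeries (bvec d τ T a) l) (C.hb.summable_sq l) - pvecL2 l q)) := by
      simp_rw [map_sub]
      exact (tendsto_pvecL2_squareTrunc C.hb l).sub tendsto_const_nhds
    -- Continuity on ℓ² comes from writing the form as ‖Sx‖² − ‖Ox‖² with bounded operators.
    have hcont : Continuous fun x : L2seq ℕ => wsq d τ l * quad (f l) x := by
      simp_rw [h.quad_f]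
      fun_prop
    have h3 := (hcont.tendsto _).comp hx
    have e : quad (f l) (fun k => wfun d τ l * Bfun d τ T a l k - poly d τ q l k) =
        wsq d τ l * quad (f l) (toL2 (vecSeries (bvec d τ T a) l) (C.hb.summable_sq l) -
          pvecL2 l q : L2seq ℕ) := by
      rw [← norm_wfun_sq, ← quad_const_mul]
      congr 1
      funext k
      rw [lp.coeFn_sub, Pi.sub_apply, pvecL2_apply, toL2_apply, poly_eq, mul_sub]
      rfl
    rw [e]
    refine h3.congr fun N => ?_
    simp only [Function.comp_apply]
    rw [pvecL2_apply, quad_poly]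

variable {H : Type*} [NormedAddCommGroup H] [InnerProductSpace ℂ H] [CompleteSpace H]
  {ξ η : ℝ → H}

/-- The hypotheses on the signal and the noise used in the time domain. -/
structure TimeDomain (d τ : ℕ) (T : ℝ) (a : ℝ → ℂ) (ξ η : ℝ → H) (f g : ℝ → Matrix ℕ ℕ ℂ) :
    Prop where
  hτ : 1 ≤ τ
  hT : 0 < T
  weight : WeightCondition d τ T a
  signal : PeriodicNorm T (incr d (τ * T) ξ)
  noise : PeriodicNorm T (incr d (τ * T) η)
  uncorrelated : Uncorrelated d T ξ η
  signalDensity : HasSpectralDensity d τ T ξ f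
  noiseDensity : HasSpectralDensity d τ T η g

namespace TimeDomain

theorem tendsto_genComb (D : TimeDomain d τ T a ξ η f g) :
    Tendsto (fun N => genComb d τ T ξ (squareTrunc (bvec d τ T a) N)) atTop
      (𝓝 (functionalA d τ T a ξ)) := by
  have h := D.signal.tendsto_squareSum D.hT
    (b := bfun d τ T a) (memLp_bfun_block D.hτ D.hT D.weight.locL2)
    (D.weight.summ.congr fun j => bnorm_eq D.hτ D.hT D.weight.locL2 j)
  refine h.congr fun N => ?_
  rw [genComb, linearCombination_squareTrunc]
  refine Finset.sum_congr rfl fun j _ => Finset.sum_congr rfl fun k _ => ?_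
  rw [bvec_eq d τ D.hT, gen_eq_blockCoef d τ D.hT]

theorem inner_genComb (D : TimeDomain d τ T a ξ η f g) (q r : (ℕ × ℕ) →₀ ℂ) :
    inner ℂ (genComb d τ T η q) (genComb d τ T ξ r) = 0 := by
  rw [genComb, genComb, Finsupp.linearCombination_apply, Finsupp.linearCombination_apply,
    Finsupp.sum, Finsupp.sum, sum_inner]
  refine Finset.sum_eq_zero fun p _ => ?_
  rw [inner_sum]
  refine Finset.sum_eq_zero fun r _ => ?_
  rw [inner_smul_left, inner_smul_right, inner_gen_eq_zero D.hT D.uncorrelated D.signal D.noise]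
  simp

theorem inner_functionalA (D : TimeDomain d τ T a ξ η f g) (q : (ℕ × ℕ) →₀ ℂ) :
    inner ℂ (genComb d τ T η q) (functionalA d τ T a ξ) = 0 := by
  have h := (tendsto_const_nhds (x := genComb d τ T η q)).inner (𝕜 := ℂ) D.tendsto_genComb
  simp_rw [D.inner_genComb] at h
  exact (tendsto_nhds_unique h tendsto_const_nhds)

/-- The observed combination. -/
def obsComb (d τ : ℕ) (T : ℝ) (ξ η : ℝ → H) : ((ℕ × ℕ) →₀ ℂ) →ₗ[ℂ] H :=
  genComb d τ T ξ + genComb d τ T η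

/-- The error splits into a signal part and an orthogonal noise part. The noise part is an isometry;
the signal part is one for each truncation of Aξ, and both sides pass to the limit. -/
theorem norm_sq_functionalA_sub (D : TimeDomain d τ T a ξ η f g) (C : Ctx d τ T a f g Om Th Ps)
    (q : (ℕ × ℕ) →₀ ℂ) : ENNReal.ofReal (‖functionalA d τ T a ξ - obsComb d τ T ξ η q‖ ^ 2) =
      mse d τ T a (poly d τ q) f g := by
  have e : functionalA d τ T a ξ - obsComb d τ T ξ η q =
      (functionalA d τ T a ξ - genComb d τ T ξ q) - genComb d τ T η q := by
    rw [obsComb, LinearMap.add_apply, sub_add_eq_sub_sub]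
  rw [e, ofReal_norm_sub_sq_of_orthogonal (by
    rw [inner_sub_right, D.inner_functionalA, D.inner_genComb, sub_zero]), mse,
    norm_genComb_sq C.hg D.noiseDensity]
  congr 1
  have h1 : Tendsto (fun N => ENNReal.ofReal
      (‖genComb d τ T ξ (squareTrunc (bvec d τ T a) N) - genComb d τ T ξ q‖ ^ 2)) atTop
      (𝓝 (ENNReal.ofReal (‖functionalA d τ T a ξ - genComb d τ T ξ q‖ ^ 2))) :=
    (ENNReal.continuous_ofReal.tendsto _).comp
      (((D.tendsto_genComb.sub tendsto_const_nhds).norm).pow 2)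
  refine tendsto_nhds_unique h1 ?_
  simp_rw [← map_sub, norm_genComb_sq C.hf D.signalDensity]
  exact C.tendsto_normSq_squareTrunc q

end TimeDomain

end

/-! ### Distance to the observations and the optimal estimate -/

section

variable {d τ : ℕ} {T : ℝ} {a : ℝ → ℂ} {M : ℕ∞} {f g : ℝ → Matrix ℕ ℕ ℂ}
  {Om Th : ℝ → Matrix ℕ (Idx M) ℂ} {Ps : ℝ → Matrix (Idx M) ℕ ℂ}

/-- The error of a polynomial characteristic in terms of its distance from an optimal one. -/
theorem Ctx.mse_poly_le (C : Ctx d τ T a f g Om Th Ps) {h : ℝ → ℕ → ℂ}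
    (hL : h ∈ L20 d τ (fun l => f l + g l)) (hopt : mse d τ T a h f g = rho d τ T a g Om Ps)
    (q : (ℕ × ℕ) →₀ ℂ) : mse d τ T a (poly d τ q) f g ≤ rho d τ T a g Om Ps +
      normSq (fun l => f l + g l) fun l k => h l k - poly d τ q l k := by
  have hm : CompMeas h := hL.1
  have hum : CompMeas fun l n => h l n / wfun d τ l := hm.div_wfun
  have hA := (C.mem_L20_iff hm hL.2.1).1 hL
  have hyH := hA.isH2 C.hTh (tmul_compMeas C.hTh hum)
  have hylt := hA.sqInt_lt C.hTh (tmul_compMeas C.hTh hum)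
  have hrho : rho d τ T a g Om Ps ≠ ∞ :=
    ((le_add_right le_rfl).trans_lt C.rho_add_psiCNormSq_lt).ne
  -- Optimality makes the excess over `rho` vanish, which determines all coefficients of Θᵀ(h/w)
  -- with nonnegative index.
  have h0 : ∀ (i : Idx M) (m : ℕ), coef (fun l => tmul Th (Bfun d τ T a) l i) (m : ℤ) -
      psiC d τ T a Om Ps m i =
        coef (fun l => tmul Th (fun l n => h l n / wfun d τ l) l i) (m : ℤ) := by
    have h1 := C.mse_of_mem_L20 hL
    rw [hopt] at h1
    have h2 := (ENNReal.add_right_inj hrho).1 ((add_zero _).trans h1)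
    intro i m
    have h3 := ENNReal.tsum_eq_zero.1 (ENNReal.tsum_eq_zero.1 h2.symm i) m
    have h4 := enorm_eq_zero.1 (pow_eq_zero_iff (two_ne_zero) |>.1 h3)
    linear_combination h4
  have hd : CompMeas fun l i => tmul Th (fun l n => h l n / wfun d τ l) l i - pTh Th q l i :=
    (tmul_compMeas C.hTh hum).sub (pTh_compMeas C.hTh q)
  have hdlt : sqInt (fun l i => tmul Th (fun l n => h l n / wfun d τ l) l i - pTh Th q l i) < ∞ :=
    (sqInt_sub_le (tmul_compMeas C.hTh hum)).trans_lt (ENNReal.add_lt_top.2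
      ⟨ENNReal.mul_lt_top (by norm_num) hylt,
        ENNReal.mul_lt_top (by norm_num) (sqInt_pTh_lt C.hTh q)⟩)
  rw [C.mse_of_mem_L20 (poly_mem_L20 d τ _ q), C.normSq_sub_poly hL.2.1, parseval_split hd hdlt]
  -- The excess of the polynomial is the nonnegative-index part of the Parseval sum for Θᵀ(h/w − p).
  refine add_le_add_right (le_trans (le_of_eq ?_) (le_add_right le_rfl)) _
  refine tsum_congr fun i => tsum_congr fun m => ?_
  rw [coef_congr (C.div_wfun_poly_ae q i), coef_sub (integrable_of_memLp_freq (hyH i).1)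
    (integrable_of_memLp_freq (pTh_isH2 C.hTh q i).1), ← h0]
  congr 2
  ring

variable {H : Type*} [NormedAddCommGroup H] [InnerProductSpace ℂ H]
  {ξ η : ℝ → H}

theorem obsComb_apply (q : (ℕ × ℕ) →₀ ℂ) : TimeDomain.obsComb d τ T ξ η q = q.sum fun p z =>
    z • (gen d τ T ξ p.1 (-(p.2 : ℤ)) + gen d τ T η p.1 (-(p.2 : ℤ))) := by
  rw [TimeDomain.obsComb, LinearMap.add_apply, genComb, genComb, Finsupp.linearCombination_apply,
    Finsupp.linearCombination_apply, ← Finsupp.sum_add]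
  simp_rw [smul_add]

theorem range_obsComb : LinearMap.range (TimeDomain.obsComb d τ T ξ η) =
    Submodule.span ℂ {x | ∃ (k : ℕ) (j : ℤ), j ≤ 0 ∧
      x = gen d τ T ξ k j + gen d τ T η k j} := by
  have h : TimeDomain.obsComb d τ T ξ η = Finsupp.linearCombination ℂ fun p : ℕ × ℕ =>
      gen d τ T ξ p.1 (-(p.2 : ℤ)) + gen d τ T η p.1 (-(p.2 : ℤ)) := by
    ext1 p
    ext
    simp [TimeDomain.obsComb, genComb]
  rw [h, Finsupp.range_linearCombination]
  congr 1
  ext x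
  constructor
  · rintro ⟨p, rfl⟩
    exact ⟨p.1, _, by simp, rfl⟩
  · rintro ⟨k, j, hj, rfl⟩
    obtain ⟨m, rfl⟩ := Int.exists_eq_neg_ofNat hj
    exact ⟨(k, m), rfl⟩

theorem obsComb_mem (q : (ℕ × ℕ) →₀ ℂ) :
    TimeDomain.obsComb d τ T ξ η q ∈ obsSpace d τ T ξ η := by
  refine Submodule.le_topologicalClosure _ ?_
  rw [← range_obsComb]
  exact ⟨q, rfl⟩

variable [CompleteSpace H]

namespace TimeDomain

/-- The least mean-square error in the time and in the spectral domain. -/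
theorem infDist_sq (D : TimeDomain d τ T a ξ η f g) (C : Ctx d τ T a f g Om Th Ps) :
    ENNReal.ofReal (Metric.infDist (functionalA d τ T a ξ) (obsSpace d τ T ξ η) ^ 2) =
      rho d τ T a g Om Ps := by
  have hne : (Set.range (obsComb d τ T ξ η)).Nonempty := Set.range_nonempty _
  have hset : ((obsSpace d τ T ξ η : Submodule ℂ H) : Set H) =
      closure (Set.range (obsComb d τ T ξ η)) := by
    rw [obsSpace, Submodule.topologicalClosure_coe, ← range_obsComb]
    rfl
  rw [hset, Metric.infDist_closure]
  set r := Metric.infDist (functionalA d τ T a ξ) (Set.range (obsComb d τ T ξ η)) with hr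
  have hr0 : 0 ≤ r := Metric.infDist_nonneg
  refine le_antisymm ?_ ?_
  · refine ENNReal.le_of_forall_pos_le_add fun ε hε _ => ?_
    obtain ⟨q, hq⟩ := C.exists_poly_mse_le (ε := ε) (by exact_mod_cast hε)
    refine le_trans ?_ hq
    rw [← D.norm_sq_functionalA_sub C q]
    refine ENNReal.ofReal_le_ofReal (pow_le_pow_left₀ hr0 ?_ 2)
    rw [← dist_eq_norm]
    exact Metric.infDist_le_dist_of_mem ⟨q, rfl⟩
  -- The distance may not be attained by a finite combination: one within r + δ has error at least
  -- `rho`, and then δ tends to 0.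
  · have ht : Tendsto (fun δ : ℝ => ENNReal.ofReal ((r + δ) ^ 2)) (𝓝[>] 0)
        (𝓝 (ENNReal.ofReal (r ^ 2))) := by
      have hc : Continuous fun δ : ℝ => ENNReal.ofReal ((r + δ) ^ 2) :=
        ENNReal.continuous_ofReal.comp (by fun_prop)
      have := hc.tendsto 0
      rw [add_zero] at this
      exact this.mono_left nhdsWithin_le_nhds
    refine ge_of_tendsto ht ?_
    filter_upwards [self_mem_nhdsWithin] with δ hδ
    obtain ⟨_, ⟨q, rfl⟩, hq⟩ := (Metric.infDist_lt_iff hne).1 (lt_add_of_pos_right r hδ)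
    refine (C.rho_le_mse (poly_mem_L20 d τ _ q)).trans ?_
    rw [← D.norm_sq_functionalA_sub C q, ← dist_eq_norm]
    exact ENNReal.ofReal_le_ofReal (pow_le_pow_left₀ dist_nonneg hq.le 2)

/-- The optimal estimate has any optimal characteristic as its spectral characteristic. -/
theorem exists_projection (D : TimeDomain d τ T a ξ η f g) (C : Ctx d τ T a f g Om Th Ps)
    {h : ℝ → ℕ → ℂ} (hL : h ∈ L20 d τ (fun l => f l + g l))
    (hopt : mse d τ T a h f g = rho d τ T a g Om Ps) :
    ∃ x ∈ obsSpace d τ T ξ η,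
      (∀ y ∈ obsSpace d τ T ξ η, inner ℂ y (functionalA d τ T a ξ - x) = 0) ∧
      HasSpectralCharacteristic d τ T ξ η (fun l => f l + g l) x h := by
  have hcl : IsClosed ((obsSpace d τ T ξ η : Submodule ℂ H) : Set H) :=
    Submodule.isClosed_topologicalClosure _
  have : CompleteSpace (obsSpace d τ T ξ η) := hcl.completeSpace_coe
  set A := functionalA d τ T a ξ
  set x := (obsSpace d τ T ξ η).starProjection A with hx
  have hxm : x ∈ obsSpace d τ T ξ η := Submodule.starProjection_apply_mem _ _
  have hort : ∀ y ∈ obsSpace d τ T ξ η, inner ℂ y (A - x) = 0 := fun y hy => by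
    rw [← inner_conj_symm, Submodule.starProjection_inner_eq_zero A y hy, map_zero]
  refine ⟨x, hxm, hort, hL, ?_⟩
  have hrho : rho d τ T a g Om Ps ≠ ∞ :=
    ((le_add_right le_rfl).trans_lt C.rho_add_psiCNormSq_lt).ne
  have hge : rho d τ T a g Om Ps ≤ ENNReal.ofReal (‖A - x‖ ^ 2) := by
    rw [← D.infDist_sq C, ← dist_eq_norm]
    exact ENNReal.ofReal_le_ofReal
      (pow_le_pow_left₀ Metric.infDist_nonneg (Metric.infDist_le_dist_of_mem hxm) 2)
  -- Pythagoras: the squared error of a finite combination is ‖A − x‖², which is at least `rho`,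
  -- plus its squared distance from x. It exceeds `rho` by at most the spectral distance of its
  -- polynomial from `h`, so the distance from x is controlled by that spectral distance.
  have hdist : ∀ q, ENNReal.ofReal (‖obsComb d τ T ξ η q - x‖ ^ 2) ≤
      normSq (fun l => f l + g l) fun l k => h l k - poly d τ q l k := fun q => by
    have h1 := C.mse_poly_le hL hopt q
    have h2 := ofReal_norm_sub_sq_of_orthogonal
      (hort _ ((obsSpace d τ T ξ η).sub_mem (obsComb_mem q) hxm))
    rw [sub_sub_sub_cancel_right, D.norm_sq_functionalA_sub C] at h2
    rw [h2] at h1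
    exact (ENNReal.add_le_add_iff_left hrho).1 ((add_le_add_left hge _).trans h1)
  choose q hq using fun N : ℕ => hL.2.2 (((N : ℝ≥0∞) + 1)⁻¹) (by simp)
  have hlim : Tendsto (fun N : ℕ => ((N : ℝ≥0∞) + 1)⁻¹) atTop (𝓝 0) := by
    have h1 := ENNReal.tendsto_inv_nat_nhds_zero.comp (tendsto_add_atTop_nat 1)
    refine h1.congr fun N => ?_
    simp
  have hq0 : Tendsto (fun N => normSq (fun l => f l + g l) fun l k => h l k - poly d τ (q N) l k)
      atTop (𝓝 0) :=
    tendsto_of_tendsto_of_tendsto_of_le_of_le tendsto_const_nhds hlim (fun _ => zero_le)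
      fun N => (hq N).le
  refine ⟨q, ?_, hq0⟩
  simp_rw [← obsComb_apply]
  have h0 : Tendsto (fun N => ENNReal.ofReal (‖obsComb d τ T ξ η (q N) - x‖ ^ 2)) atTop (𝓝 0) :=
    tendsto_of_tendsto_of_tendsto_of_le_of_le tendsto_const_nhds hq0 (fun _ => zero_le)
      fun N => hdist (q N)
  have h1 := (ENNReal.tendsto_toReal ENNReal.zero_ne_top).comp h0
  have h2 : Tendsto (fun N => ‖obsComb d τ T ξ η (q N) - x‖) atTop (𝓝 0) := by
    have h3 := (Real.continuous_sqrt.tendsto _).comp h1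
    simpa [Function.comp_def, ENNReal.toReal_ofReal, Real.sqrt_sq] using h3
  exact tendsto_iff_norm_sub_tendsto_zero.2 h2

end TimeDomain

end

end PCFilter

end

/-! ### The main theorem -/

theorem theorem7
    (d τ : ℕ) (hτ : 1 ≤ τ) (T : ℝ) (hT : 0 < T) (M : ℕ∞)
    (a : ℝ → ℂ) (ha : WeightCondition d τ T a)
    -- the known noise density and its canonical factorization
    (g : ℝ → Matrix ℕ ℕ ℂ) (hg : IsSpectralDensity d τ g)
    (Om : ℝ → Matrix ℕ (Idx M) ℂ) (hOm : IsCanonicalFactor (weighted d τ g) Om)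
    (hreg : NoiseRegular d τ T a g)
    -- one of the four classes, and a density in it
    (D : D0Data) (hD : D.Valid)
    (f₀ : ℝ → Matrix ℕ ℕ ℂ) (hf₀ : IsSpectralDensity d τ f₀) (hf₀D : D.Constraint f₀)
    -- canonical factorization of `f₀ + g` and the minimality condition
    (Θ : ℝ → Matrix ℕ (Idx M) ℂ) (Ψ : ℝ → Matrix (Idx M) ℕ ℂ)
    (hpair : IsFactorPair (weighted d τ fun l => f₀ l + g l) Θ Ψ)
    (hmin : MinimalityCondition Θ Ψ)
    -- `Θ_τ = w_τ Θ⁰`, where `|w_τ(e^{-iλ})|² = |1 - e^{iλτ}|^{2d} / λ^{2d}`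
    (w : ℝ → ℂ) (hw : IsH2 w) (hwsq : ∀ᵐ l ∂freqMeasure, ‖w l‖ ^ 2 = wsq d τ l)
    (Θ₀ : ℝ → Matrix ℕ (Idx M) ℂ) (hΘ₀ : ∀ᵐ l ∂freqMeasure, Θ l = w l • Θ₀ l)
    -- `c(λ) = ∑_j (ψ̄_τ C^g_τ)_j e^{-iλj}`
    (c : ℝ → Idx M → ℂ) (hc : ∀ i, IsH2 fun l => c l i)
    (hcc : ∀ (i : Idx M) (m : ℕ), coef (fun l => c l i) (m : ℤ) = psiC d τ T a Om Ψ m i)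
    -- the equation of the class: `c c^* = (Θ⁰)ᵀ K conj Θ⁰`
    (K : Matrix ℕ ℕ ℂ) (hK : D.IsMultiplier K)
    (heq : ∀ᵐ l ∂freqMeasure, ∀ i j,
      c l i * conj (c l j) = ∑' k, Θ₀ l k i * ∑' n, K k n * conj (Θ₀ l n j))
    -- `f₀ + g` solves the constrained optimization problem `⟨ψ̄_τ C^g_τ, ψ̄_τ C^g_τ⟩ → inf`
    (hsol : ∀ f : ℝ → Matrix ℕ ℕ ℂ, IsSpectralDensity d τ f → D.Constraint f →
      ∀ (Θ' : ℝ → Matrix ℕ (Idx M) ℂ) (Ψ' : ℝ → Matrix (Idx M) ℕ ℂ),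
        IsFactorPair (weighted d τ fun l => f l + g l) Θ' Ψ' →
          psiCNormSq d τ T a Om Ψ ≤ psiCNormSq d τ T a Om Ψ') :
    -- `f₀` is least favourable
    IsLeastFavourable d τ T a (D.admissible M d τ g) g f₀ ∧
    -- the formula gives the spectral characteristic of the optimal estimate for `(f₀, g)`
    (charFormula d τ T a Ψ c ∈ L20 d τ (fun l => f₀ l + g l) ∧
      mse d τ T a (charFormula d τ T a Ψ c) f₀ g = optMse d τ T a f₀ g) ∧
    -- it is minimax whenever it belongs to `H_D`
    (charFormula d τ T a Ψ c ∈ charClass d τ (D.admissible M d τ g) g →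
      IsMinimaxCharacteristic d τ T a (D.admissible M d τ g) g (charFormula d τ T a Ψ c)) ∧
    -- `Δ(f, g)` is the least mean-square error of linear estimates of `Aξ` by `ξ(t) + η(t)`, `t ≤ 0`
    (∀ f ∈ D.admissible M d τ g, ∀ (Ω : Type u) [MeasurableSpace Ω] (P : Measure Ω)
      [IsProbabilityMeasure P] (ξ η : ℝ → Lp ℂ 2 P), IsSignalNoise P d τ T ξ η f g →
        ENNReal.ofReal (Metric.infDist (functionalA d τ T a ξ) (obsSpace d τ T ξ η) ^ 2) =
          optMse d τ T a f g) ∧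
    -- and for `f₀` the optimal estimate (the projection) has this spectral characteristic
    (∀ (Ω : Type u) [MeasurableSpace Ω] (P : Measure Ω) [IsProbabilityMeasure P]
      (ξ η : ℝ → Lp ℂ 2 P), IsSignalNoise P d τ T ξ η f₀ g →
        ∃ x ∈ obsSpace d τ T ξ η,
          (∀ y ∈ obsSpace d τ T ξ η, inner ℂ y (functionalA d τ T a ξ - x) = 0) ∧
          HasSpectralCharacteristic d τ T ξ η (fun l => f₀ l + g l) x
            (charFormula d τ T a Ψ c)) := by
  have hb := ha.summableCoeffs hτ hT
  have C₀ : Ctx d τ T a f₀ g Om Θ Ψ := ⟨hτ, hb, hf₀, hg, hOm, hreg, hpair⟩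
  have hadm : f₀ ∈ D.admissible M d τ g := ⟨hf₀, hf₀D, Θ, Ψ, hpair⟩
  have X : Multiplier d τ T a f₀ g Om Θ Ψ w Θ₀ c K :=
    ⟨C₀, hmin, hwsq, hΘ₀, hc, hcc, hK.boundedHermitian hD, heq⟩
  have hopt : mse d τ T a (charFormula d τ T a Ψ c) f₀ g = rho d τ T a g Om Ψ := by
    rw [X.mse_char, C₀.optMse_eq]
  refine ⟨⟨hadm, ?_⟩, ⟨X.char_mem, X.mse_char⟩, X.minimax hD hK hf₀D, ?_, ?_⟩
  · rintro f ⟨hf, hfc, Θ', Ψ', hpair'⟩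
    exact C₀.optMse_le_of_psiCNormSq_le ⟨hτ, hb, hf, hg, hOm, hreg, hpair'⟩
      (hsol f hf hfc Θ' Ψ' hpair')
  · rintro f ⟨hf, -, Θ', Ψ', hpair'⟩ Ω _ P _ ξ η h
    have C : Ctx d τ T a f g Om Θ' Ψ' := ⟨hτ, hb, hf, hg, hOm, hreg, hpair'⟩
    have D : TimeDomain d τ T a ξ η f g := ⟨hτ, hT, ha, h.signal.periodicNorm τ,
      h.noise.periodicNorm τ, h.uncorrelated, h.signalDensity, h.noiseDensity⟩
    rw [D.infDist_sq C, C.optMse_eq]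
  · intro Ω _ P _ ξ η h
    have D : TimeDomain d τ T a ξ η f₀ g := ⟨hτ, hT, ha, h.signal.periodicNorm τ,
      h.noise.periodicNorm τ, h.uncorrelated, h.signalDensity, h.noiseDensity⟩
    exact D.exists_projection C₀ X.char_mem hopt
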